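/- **Setting.** Let $X$ be a locally compact Hausdorff space with a regular Borel measure $\mu$ and a homogeneous structure: open sets $B(x,r)$ ("balls", $x\in X$, $r>0$) and constants $c,K>1$ such that $x\in B(x,r)$; $B(x,r_1)\subset B(x,r_2)$ if $r_1\le r_2$; $0<\mu(B(x,r))<\infty$; $X=\bigcup_{r>0}B(x,r)$; $\mu(B(x,cr))\le K\mu(B(x,r))$; and $B(x_2,r_2)\subset B(x_1,cr_1)$ whenever $B(x_1,r_1)\cap B(x_2,r_2)\neq\emptyset$ and $r_1\ge r_2$. Assume also $\mu(\{x\})=0$ for all $x$; that $d(x,y):=\inf\{t>0: y\in B(x,t),\ x\in B(y,t)\}$ vanishes only for $x=y$; and that for some $\varepsilon_0>0$, $c^{j\varepsilon_0}\mu(B(x,t))\le\mu(B(x,c^jt))$ for all $x\in X$, $t>0$, $j\in\mathbb N$. For $b$ integrable on every ball let $\|b\|_*=\sup_B\frac1{\mu(B)}\int_B|b-m_B(b)|\,d\mu$, where $m_B(b)$ is the mean of $b$ on $B$; $b\in BMO(X)$ means $\|b\|_*<\infty$. Functions are complex valued. Put $\lambda(x,y)=\mu(B(x,d(x,y)))$.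 A *Calderón–Zygmund operator with exponent $\varepsilon>0$ and constant $A\ge0$*, bounded on $L^2(X)$, is a bounded linear operator $T$ on $L^2(X)$ for which there is a kernel $k$, locally integrable on $\{(x,y)\in X\times X:x\ne y\}$, with $|k(x,y)|\le A/\lambda(x,y)$ for $x\neq y$, $$|k(x,y)-k(x',y)|+|k(y,x)-k(y,x')|\le\Big(\frac{d(x,x')}{d(x,y)}\Big)^{\varepsilon}\frac{A}{\lambda(x,y)}\quad\text{whenever } x\ne y,\ d(x,y)\ge c\,d(x,x'),$$ and $\int (Tf)\,h\,d\mu=\int\!\int k(x,y)f(y)h(x)\,d\mu(y)\,d\mu(x)$ for all $f,h\in L^2(X)$ whose supports are bounded and at positive $d$-distance from each other. Such a $T$ is applied to a measurable function $f$ outside $L^2$ as follows: $Tf$ is the limit in $L^1(B)$, for every ball $B$, of $T\big(f\,\mathbf 1_{B(x_0,n)\cap\{|f|\le n\}}\big)$ as $n\to\infty$, if this limit exists for every $x_0\in X$ and does not depend on $x_0$. For $T_{j,1},T_{j,2}$ $(1\le j\le m)$ Calderón–Zygmund operators bounded on $L^2(X)$, and a function $b$, put $\mathcal T_b g=\sum_{j=1}^m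 T_{j,1}\big(b\,T_{j,2}g\big)$. **Theorem 6.1.** Let $1<p<\infty$. (a) For every $\varepsilon>0$ there is a constant $C$ depending only on $p$, $\varepsilon$ and the space (not on $m$, the operators, $g$ or $b$) such that the following holds. Let $T_{j,i}$ $(1\le j\le m,\ i=1,2)$ be Calderón–Zygmund operators bounded on $L^2(X)$, with exponent $\varepsilon$ and constants $A_{j,i}$. If $g\in L^p(X)$ and $\mathcal T_1(g)=0$ a.e., then for every $b\in BMO(X)$ all terms defining $\mathcal T_1(g)$ and $\mathcal T_b(g)$ exist, $\mathcal T_b(g)\in L^p(X)$, and $$\|\mathcal T_b(g)\|_{L^p}\le C\Big(\sum_{j=1}^m(\|T_{j,1}\|+A_{j,1})\Big)\Big(\sum_{j=1}^m(\|T_{j,2}\|+A_{j,2})\Big)\|g\|_{L^p}\|b\|_*,$$ where $\|T\|$ is the operator norm on $L^2(X)$. (b) For every finite family $T_{j,i}$ of Calderón–Zygmund operators bounded on $L^2(X)$ (with arbitrary exponents and constants) there is a constant $C_p$, depending on $p$, the space and the family, such that for all $g\in L^p(X)$ with $\mathcal T_1(g)=0$ a.e. and all $b\in BMO(X)$ one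 has $\mathcal T_b(g)\in L^p(X)$ and $$\|\mathcal T_b(g)\|_{L^p}\le C_p\Big(\sum_{j=1}^m\|T_{j,1}\|\Big)\Big(\sum_{j=1}^m\|T_{j,2}\|\Big)\|g\|_{L^p}\|b\|_*.$$ -/

import Mathlib

open MeasureTheory Filter Topology
open scoped ENNReal

/-- A homogeneous structure on a topological space carrying a measure `μ`: a family of open
"balls" `ball x r` (`r > 0`) which is increasing in `r`, has finite positive measure, exhausts the
space, is doubling and has the engulfing property, both with the same dilation constant `c`.
Points are null sets, and balls separate points, i.e. the quasi-distance `dist` below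
vanishes only on the diagonal. -/
structure HomogeneousStructure {X : Type*} [TopologicalSpace X] [MeasurableSpace X]
    (μ : Measure X) where
  ball : X → ℝ → Set X
  c : ℝ
  K : ℝ
  one_lt_c : 1 < c
  one_lt_K : 1 < K
  isOpen_ball : ∀ x r, 0 < r → IsOpen (ball x r)
  mem_ball : ∀ x r, 0 < r → x ∈ ball x r
  ball_mono : ∀ x r₁ r₂, 0 < r₁ → r₁ ≤ r₂ → ball x r₁ ⊆ ball x r₂
  measure_ball_pos : ∀ x r, 0 < r → 0 < μ (ball x r)
  measure_ball_lt_top : ∀ x r, 0 < r → μ (ball x r) < ∞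
  exists_mem_ball : ∀ x y, ∃ r, 0 < r ∧ y ∈ ball x r
  doubling : ∀ x r, 0 < r → μ (ball x (c * r)) ≤ ENNReal.ofReal K * μ (ball x r)
  engulfing : ∀ x₁ x₂ r₁ r₂, 0 < r₂ → r₂ ≤ r₁ → (ball x₁ r₁ ∩ ball x₂ r₂).Nonempty →
    ball x₂ r₂ ⊆ ball x₁ (c * r₁)
  measure_singleton : ∀ x, μ {x} = 0
  separates : ∀ x y, (∀ r, 0 < r → y ∈ ball x r) → y = x

noncomputable section

namespace HomogeneousStructure

variable {X : Type*} [TopologicalSpace X] [MeasurableSpace X] {μ : Measure X}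

/-- The quasi-distance of a homogeneous structure. -/
def dist (H : HomogeneousStructure μ) (x y : X) : ℝ :=
  sInf {t : ℝ | 0 < t ∧ y ∈ H.ball x t ∧ x ∈ H.ball y t}

/-- The growth condition `c ^ (j ε₀) μ(B(x,t)) ≤ μ(B(x, c ^ j t))` for some `ε₀ > 0`.
(The reverse bound `μ(B(x, c ^ j t)) ≤ K ^ j μ(B(x,t))` is contained in `doubling`.) -/
def ReverseDoubling (H : HomogeneousStructure μ) : Prop :=
  ∃ ε₀ : ℝ, 0 < ε₀ ∧ ∀ (x : X) (t : ℝ) (j : ℕ), 0 < t →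
    ENNReal.ofReal (H.c ^ ((j : ℝ) * ε₀)) * μ (H.ball x t) ≤ μ (H.ball x (H.c ^ j * t))

/-- The `BMO` seminorm: the supremum over all balls of the mean oscillation. -/
def bmoNorm (H : HomogeneousStructure μ) (b : X → ℂ) : ℝ≥0∞ :=
  ⨆ (x : X) (r : ℝ) (_ : 0 < r),
    (μ (H.ball x r))⁻¹ *
      ∫⁻ y in H.ball x r, ‖b y - ⨍ z in H.ball x r, b z ∂μ‖ₑ ∂μ

/-- `b` belongs to `BMO(X)`. -/
def IsBMO (H : HomogeneousStructure μ) (b : X → ℂ) : Prop :=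
  (∀ x r, 0 < r → IntegrableOn b (H.ball x r) μ) ∧ H.bmoNorm b < ∞

/-- `λ(x,y) = μ(B(x, d(x,y)))`. -/
def lam (H : HomogeneousStructure μ) (x y : X) : ℝ :=
  μ.real (H.ball x (H.dist x y))

/-- `k` is a standard kernel with smoothness exponent `ε` and constant `A`.
The values of `k` on the diagonal play no role. -/
structure IsStandardKernel (H : HomogeneousStructure μ) (ε A : ℝ) (k : X → X → ℂ) : Prop where
  size : ∀ x y, x ≠ y → ‖k x y‖ ≤ A / H.lam x y
  smooth : ∀ x x' y, x ≠ y → H.c * H.dist x x' ≤ H.dist x y →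
    ‖k x y - k x' y‖ + ‖k y x - k y x'‖ ≤
      (H.dist x x' / H.dist x y) ^ ε * (A / H.lam x y)

/-- The bounded operator `T` on `L²(X)` is associated to the kernel `k`: `k` is locally integrable
away from the diagonal, and `⟨T f, g⟩ = ∬ k(x,y) f(y) g(x) dμ(y) dμ(x)` for all `f, g ∈ L²(X)` with
bounded supports which are separated by a positive distance. -/
def IsAssociated (H : HomogeneousStructure μ) (T : Lp ℂ 2 μ →L[ℂ] Lp ℂ 2 μ)
    (k : X → X → ℂ) : Prop :=
  LocallyIntegrableOn (fun z : X × X => k z.1 z.2) {z : X × X | z.1 ≠ z.2} (μ.prod μ) ∧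
  ∀ (f g : X → ℂ) (hf : MemLp f 2 μ), MemLp g 2 μ →
    (∃ x r, 0 < r ∧ Function.support f ⊆ H.ball x r) →
    (∃ x r, 0 < r ∧ Function.support g ⊆ H.ball x r) →
    (∃ η : ℝ, 0 < η ∧ ∀ x ∈ Function.support g, ∀ y ∈ Function.support f, η ≤ H.dist x y) →
    ∫ x, (T (hf.toLp f)) x * g x ∂μ = ∫ x, ∫ y, k x y * f y * g x ∂μ ∂μ

/-- `T` is a Calderón–Zygmund operator bounded on `L²(X)`, whose standard kernel has exponent `ε`
and constant `A`. -/
def IsCZOperator (H : HomogeneousStructure μ) (ε A : ℝ) (T : Lp ℂ 2 μ →L[ℂ] Lp ℂ 2 μ) : Prop :=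
  0 < ε ∧ 0 ≤ A ∧ ∃ k : X → X → ℂ, H.IsStandardKernel ε A k ∧ H.IsAssociated T k

/-- The truncation of `f` to the set of points of `B(x₀, n+1)` where `|f| ≤ n+1`. -/
def trunc (H : HomogeneousStructure μ) (x₀ : X) (n : ℕ) (f : X → ℂ) : X → ℂ :=
  (H.ball x₀ (n + 1) ∩ {x | ‖f x‖ ≤ n + 1}).indicator f

open Classical in
/-- An operator on `L²(X)` applied to a function (only meaningful for `f ∈ L²`). -/
def applyL2 (T : Lp ℂ 2 μ →L[ℂ] Lp ℂ 2 μ) (f : X → ℂ) : X → ℂ :=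
  if h : MemLp f 2 μ then T (h.toLp f) else 0

/-- `u = T f` in the extended sense: `T`, applied to the truncations of `f` (which are bounded with
bounded support, hence in `L²`), converges to `u` in `L¹` on every ball, whatever the centre of the
truncations. Such a `u` is unique up to null sets. For `f` in some `L^p`, `1 < p < ∞`, and `T` a
Calderón–Zygmund operator this is the value at `f` of the continuous extension of `T` to `L^p`;
it also gives a meaning to `T (b h)` for `b ∈ BMO` and `h ∈ L^p`. -/
def HasValue (H : HomogeneousStructure μ) (T : Lp ℂ 2 μ →L[ℂ] Lp ℂ 2 μ) (f u : X → ℂ) : Prop :=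
  AEStronglyMeasurable f μ ∧ AEStronglyMeasurable u μ ∧
  ∀ (x₀ x : X) (r : ℝ), 0 < r →
    Tendsto (fun n : ℕ => ∫⁻ y in H.ball x r, ‖applyL2 T (H.trunc x₀ n f) y - u y‖ₑ ∂μ)
      atTop (𝓝 0)

open Classical in
/-- The value `T f` of the extended operator, if it exists, and `0` otherwise. -/
def ext (H : HomogeneousStructure μ) (T : Lp ℂ 2 μ →L[ℂ] Lp ℂ 2 μ) (f : X → ℂ) : X → ℂ :=
  if h : ∃ u, H.HasValue T f u then h.choose else 0

/-- The generalized Toeplitz operator `∑ j, T_{j,1} M_b T_{j,2}`. -/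
def toeplitz (H : HomogeneousStructure μ) {m : ℕ} (T₁ T₂ : Fin m → Lp ℂ 2 μ →L[ℂ] Lp ℂ 2 μ)
    (b g : X → ℂ) : X → ℂ :=
  fun x => ∑ j, H.ext (T₁ j) (fun y => b y * H.ext (T₂ j) g y) x

/-- All the values entering in `toeplitz T₁ T₂ b g` exist. -/
def ToeplitzDefined (H : HomogeneousStructure μ) {m : ℕ}
    (T₁ T₂ : Fin m → Lp ℂ 2 μ →L[ℂ] Lp ℂ 2 μ) (b g : X → ℂ) : Prop :=
  ∀ j, (∃ u, H.HasValue (T₂ j) g u) ∧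
    ∃ v, H.HasValue (T₁ j) (fun y => b y * H.ext (T₂ j) g y) v

end HomogeneousStructure

end

/-!
Write `N_j = ‖T_{j,1}‖ + A_{j,1}` and `h_j = T_{j,2} g`, which lies in `L^p`. The proof estimates the
sharp maximal function of `F = ∑ j, T_{j,1} (b h_j)`. Over a ball `B` the hypothesis
`∑ j, T_{j,1} h_j = 0` allows one to subtract the constant `m_B(b)` from `b`, so that `F` agrees with
`∑ j, T_{j,1} ((b - m_B(b)) h_j)`. The oscillation of `T f` over `B` is at most
`C N ∑ i, c ^ (-iε) (mean of |f| ^ s over c ^ i B) ^ (1 / s)` for every `s > 1`, and for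
`f = (b - m_B(b)) h_j` Hölder's inequality and the John–Nirenberg inequality bound this by
`C N_j ‖b‖_* (M |h_j| ^ q) ^ (1 / q)` with `s < q < p` (`exists_sharp_multSum_le`). The
Fefferman–Stein inequality `‖F‖_p ≤ C ‖F^#‖_p` and the maximal theorem give the result when `F` is
already known to lie in `L^p`, for instance for bounded `b`; a general `b` is truncated
(`exists_eLpNorm_multSum_le`).

The tools are developed for the structure at hand: a Vitali covering lemma and the maximal theorem,
the Fefferman–Stein inequality by a good-`λ` argument (`lintegral_rpow_le_sharp`), the
John–Nirenberg inequality (`exists_johnNirenberg`, `exists_eLpNorm_sub_mean_le`), and the `L^q`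
theory of Calderón–Zygmund operators. The latter needs no weak type `(1,1)` estimate: the
oscillation estimate with `s = 2` gives the bounds for `q > 2`, also for adjoints, and duality gives
those for `q < 2` (`exists_lpBound`). The kernel enters only through the pairings
`∫ (T f) h`, with `h` supported in a ball and `f` vanishing on a dilate of that ball (`FarPairing`).

Outside `L²` the operators act on *admissible* functions, for which the sum
`∑ i, (mean of |f| ^ s over c ^ i B) ^ (1 / s)` is finite for every ball `B`. This quantity bounds the
mean of `|T f|` over `B`, which makes the truncations converge (`SizeBound.exists_hasValue`);
functions in `L^p` and products of `BMO` functions with `L^p` functions are admissible because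
measures of balls grow geometrically.

The second part follows from the first by passing to a common exponent. The constant may depend on
the operators, so that kernel constants may be absorbed, except for operators of norm zero; these
have kernel constant zero for a suitable choice of the kernel (`exists_common_exponent`).
-/

open scoped NNReal

noncomputable section

namespace HomogeneousStructure

/-! ### Geometry of the balls -/

section Geometry

variable {X : Type*} [TopologicalSpace X] [MeasurableSpace X] {μ : Measure X}
  (H : HomogeneousStructure μ)

lemma c_pos : 0 < H.c := zero_lt_one.trans H.one_lt_c

lemma c_pow_pos (i : ℕ) : 0 < H.c ^ i := pow_pos H.c_pos i

lemma one_le_c_pow (i : ℕ) : 1 ≤ H.c ^ i := one_le_pow₀ H.one_lt_c.le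

/-- The doubling constant as an extended nonnegative real. -/
def doublingConst : ℝ≥0∞ := ENNReal.ofReal H.K

lemma one_le_doublingConst : 1 ≤ H.doublingConst :=
  ENNReal.one_le_ofReal.2 H.one_lt_K.le

lemma doublingConst_ne_top : H.doublingConst ≠ ∞ := ENNReal.ofReal_ne_top

lemma doublingConst_ne_zero : H.doublingConst ≠ 0 :=
  (zero_lt_one.trans_le H.one_le_doublingConst).ne'

lemma measure_ball_ne_top {x : X} {r : ℝ} (hr : 0 < r) : μ (H.ball x r) ≠ ∞ :=
  (H.measure_ball_lt_top x r hr).ne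

lemma measure_ball_ne_zero {x : X} {r : ℝ} (hr : 0 < r) : μ (H.ball x r) ≠ 0 :=
  (H.measure_ball_pos x r hr).ne'

lemma ball_subset_of_mem {x y : X} {t : ℝ} (ht : 0 < t) (h : y ∈ H.ball x t) :
    H.ball x t ⊆ H.ball y (H.c * t) :=
  H.engulfing y x t t ht le_rfl ⟨y, H.mem_ball y t ht, h⟩

lemma mem_ball_swap {x y : X} {t : ℝ} (ht : 0 < t) (h : y ∈ H.ball x t) :
    x ∈ H.ball y (H.c * t) :=
  H.ball_subset_of_mem ht h (H.mem_ball x t ht)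

lemma ball_subset_mul (x : X) {t a : ℝ} (ht : 0 < t) (ha : 1 ≤ a) :
    H.ball x t ⊆ H.ball x (a * t) :=
  H.ball_mono x _ _ ht (le_mul_of_one_le_left ht.le ha)

lemma distSet_nonempty (x y : X) :
    {t : ℝ | 0 < t ∧ y ∈ H.ball x t ∧ x ∈ H.ball y t}.Nonempty := by
  obtain ⟨r, hr, h⟩ := H.exists_mem_ball x y
  exact ⟨H.c * r, mul_pos H.c_pos hr, H.ball_subset_mul x hr H.one_lt_c.le h,
    H.mem_ball_swap hr h⟩

lemma distSet_bddBelow (x y : X) :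
    BddBelow {t : ℝ | 0 < t ∧ y ∈ H.ball x t ∧ x ∈ H.ball y t} :=
  ⟨0, fun _ h => h.1.le⟩

lemma dist_nonneg (x y : X) : 0 ≤ H.dist x y :=
  Real.sInf_nonneg fun _ h => h.1.le

lemma dist_comm (x y : X) : H.dist x y = H.dist y x := by
  simp only [dist]
  congr 1
  ext t
  simp [and_comm]

lemma dist_le_of_mem {x y : X} {t : ℝ} (ht : 0 < t) (h : y ∈ H.ball x t) :
    H.dist x y ≤ H.c * t :=
  csInf_le (H.distSet_bddBelow x y) ⟨mul_pos H.c_pos ht,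
    H.ball_subset_mul x ht H.one_lt_c.le h, H.mem_ball_swap ht h⟩

lemma mem_ball_of_dist_lt {x y : X} {t : ℝ} (h : H.dist x y < t) : y ∈ H.ball x t := by
  obtain ⟨s, hs, hst⟩ := exists_lt_of_csInf_lt (H.distSet_nonempty x y) h
  exact H.ball_mono x s t hs.1 hst.le hs.2.1

lemma le_dist_of_notMem {x y : X} {t : ℝ} (h : y ∉ H.ball x t) : t ≤ H.dist x y :=
  not_lt.1 fun h' => h (H.mem_ball_of_dist_lt h')

lemma dist_pos {x y : X} (h : x ≠ y) : 0 < H.dist x y := by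
  refine lt_of_le_of_ne (H.dist_nonneg x y) fun h0 => h ?_
  exact (H.separates x y fun r hr => H.mem_ball_of_dist_lt (h0 ▸ hr)).symm

lemma measurableSet_ball [OpensMeasurableSpace X] (x : X) {r : ℝ} (hr : 0 < r) :
    MeasurableSet (H.ball x r) := (H.isOpen_ball x r hr).measurableSet

lemma measure_ball_pow_le (x : X) {r : ℝ} (hr : 0 < r) (i : ℕ) :
    μ (H.ball x (H.c ^ i * r)) ≤ H.doublingConst ^ i * μ (H.ball x r) := by
  induction i with
  | zero => simp
  | succ i ih =>
    calc μ (H.ball x (H.c ^ (i + 1) * r)) = μ (H.ball x (H.c * (H.c ^ i * r))) := by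
          rw [pow_succ', mul_assoc]
      _ ≤ H.doublingConst * μ (H.ball x (H.c ^ i * r)) :=
          H.doubling x _ (mul_pos (H.c_pow_pos i) hr)
      _ ≤ H.doublingConst * (H.doublingConst ^ i * μ (H.ball x r)) := by gcongr
      _ = _ := by rw [pow_succ', mul_assoc]

lemma exists_ball_subset (x₀ x : X) {r : ℝ} (hr : 0 < r) :
    ∃ n : ℕ, H.ball x r ⊆ H.ball x₀ (n + 1) := by
  obtain ⟨t, ht, hx⟩ := H.exists_mem_ball x₀ x
  obtain ⟨n, hn⟩ := exists_nat_ge (H.c * max r t)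
  refine ⟨n, (H.engulfing x₀ x (max r t) r hr (le_max_left _ _)
    ⟨x, H.ball_mono x₀ t _ ht (le_max_right _ _) hx, H.mem_ball x r hr⟩).trans ?_⟩
  exact H.ball_mono x₀ _ _ (mul_pos H.c_pos (hr.trans_le (le_max_left _ _))) (by linarith)

lemma iUnion_ball (x₀ : X) : ⋃ n : ℕ, H.ball x₀ ((n : ℝ) + 1) = Set.univ := by
  refine Set.eq_univ_of_forall fun x => ?_
  obtain ⟨n, hn⟩ := H.exists_ball_subset x₀ x one_pos
  exact Set.mem_iUnion.2 ⟨n, hn (H.mem_ball x 1 one_pos)⟩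

lemma ball_nat_mono (x₀ : X) : Monotone fun n : ℕ => H.ball x₀ ((n : ℝ) + 1) := fun m n h =>
  H.ball_mono x₀ _ _ (by positivity) (by gcongr)

include H in
lemma sigmaFinite : SigmaFinite μ := by
  rcases isEmpty_or_nonempty X with hX | ⟨⟨x₀⟩⟩
  · have : μ = 0 := Measure.eq_zero_of_isEmpty μ
    subst this
    infer_instance
  · exact ⟨⟨⟨fun n => H.ball x₀ ((n : ℝ) + 1), fun _ => trivial,
      fun n => H.measure_ball_lt_top x₀ _ (by positivity), H.iUnion_ball x₀⟩⟩⟩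

lemma c_pow_unbounded (a : ℝ) {r : ℝ} (hr : 0 < r) : ∃ i : ℕ, a ≤ H.c ^ i * r := by
  obtain ⟨i, hi⟩ := pow_unbounded_of_one_lt (a / r) H.one_lt_c
  exact ⟨i, ((div_lt_iff₀ hr).1 hi).le⟩

lemma exists_mem_ball_pow (x y : X) {r : ℝ} (hr : 0 < r) : ∃ i : ℕ, y ∈ H.ball x (H.c ^ i * r) := by
  obtain ⟨t, ht, hy⟩ := H.exists_mem_ball x y
  obtain ⟨i, hi⟩ := H.c_pow_unbounded t hr
  exact ⟨i, H.ball_mono x _ _ ht hi hy⟩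

lemma exists_ball_subset_pow (x₀ x : X) {r s : ℝ} (hr : 0 < r) (hs : 0 < s) :
    ∃ i : ℕ, H.ball x s ⊆ H.ball x₀ (H.c ^ i * r) := by
  obtain ⟨n, hn⟩ := H.exists_ball_subset x₀ x hs
  obtain ⟨i, hi⟩ := H.c_pow_unbounded (n + 1) hr
  exact ⟨i, hn.trans (H.ball_mono x₀ _ _ (by positivity) hi)⟩

/-- Reverse doubling makes the measures of concentric balls grow without bound. -/
lemma exists_le_measure_ball (hH : H.ReverseDoubling) (x : X) {V : ℝ≥0∞} (hV : V ≠ ∞) :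
    ∃ R : ℝ, 0 < R ∧ ∀ r, R ≤ r → V ≤ μ (H.ball x r) := by
  obtain ⟨ε, hε, h⟩ := hH
  have hlim : Tendsto (fun j : ℕ => ENNReal.ofReal (H.c ^ ((j : ℝ) * ε)) * μ (H.ball x 1)) atTop
      (𝓝 ∞) := by
    have h1 : Tendsto (fun j : ℕ => H.c ^ ((j : ℝ) * ε)) atTop atTop := by
      have : Tendsto (fun j : ℕ => (H.c ^ ε) ^ j) atTop atTop :=
        tendsto_pow_atTop_atTop_of_one_lt (Real.one_lt_rpow H.one_lt_c hε)
      refine this.congr fun j => ?_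
      rw [← Real.rpow_natCast, ← Real.rpow_mul H.c_pos.le, mul_comm]
    have h2 := (ENNReal.tendsto_ofReal_nhds_top.2 h1)
    have := ENNReal.Tendsto.mul_const h2 (b := μ (H.ball x 1)) (Or.inl (by simp))
    rwa [ENNReal.top_mul (H.measure_ball_ne_zero one_pos)] at this
  obtain ⟨j, hj⟩ := (hlim.eventually (lt_mem_nhds (lt_top_iff_ne_top.2 hV))).exists
  refine ⟨H.c ^ j * 1, by simpa using H.c_pow_pos j, fun r hr => ?_⟩
  exact hj.le.trans ((h x 1 j one_pos).trans (measure_mono (H.ball_mono x _ _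
    (by simpa using H.c_pow_pos j) hr)))

/-- The balls containing a given point have measure bounded below in terms of the radius only. -/
lemma exists_le_measure_ball_of_mem (hH : H.ReverseDoubling) (x : X) {V : ℝ≥0∞} (hV : V ≠ ∞) :
    ∃ R : ℝ, 0 < R ∧ ∀ y r, R ≤ r → x ∈ H.ball y r → V ≤ μ (H.ball y r) := by
  obtain ⟨R, hR, h⟩ := H.exists_le_measure_ball hH x
    (V := H.doublingConst * V) (ENNReal.mul_ne_top H.doublingConst_ne_top hV)
  refine ⟨R, hR, fun y r hr hx => ?_⟩
  have h1 : H.ball x r ⊆ H.ball y (H.c * r) :=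
    H.engulfing y x r r (hR.trans_le hr) le_rfl ⟨x, hx, H.mem_ball x r (hR.trans_le hr)⟩
  have h2 := (h r hr).trans ((measure_mono h1).trans (H.doubling y r (hR.trans_le hr)))
  exact (ENNReal.mul_le_mul_iff_right H.doublingConst_ne_zero H.doublingConst_ne_top).1 h2

end Geometry

/-! ### Coverings and the Hardy–Littlewood maximal function -/

section Maximal

variable {X : Type*} [TopologicalSpace X] [MeasurableSpace X] {μ : Measure X}
  (H : HomogeneousStructure μ)

/-- The normalized restriction of `μ` to a ball; integrals against it are means over the ball. -/
def nu (x : X) (r : ℝ) : Measure X := (μ (H.ball x r))⁻¹ • μ.restrict (H.ball x r)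

lemma lintegral_nu (x : X) (r : ℝ) (φ : X → ℝ≥0∞) :
    ∫⁻ y, φ y ∂(H.nu x r) = (μ (H.ball x r))⁻¹ * ∫⁻ y in H.ball x r, φ y ∂μ := by
  rw [nu, lintegral_smul_measure, smul_eq_mul]

lemma isProbabilityMeasure_nu (x : X) {r : ℝ} (hr : 0 < r) : IsProbabilityMeasure (H.nu x r) := by
  constructor
  rw [nu, Measure.smul_apply, Measure.restrict_apply_univ, smul_eq_mul]
  exact ENNReal.inv_mul_cancel (H.measure_ball_ne_zero hr) (H.measure_ball_ne_top hr)

lemma nu_absolutelyContinuous (x : X) (r : ℝ) : H.nu x r ≪ μ :=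
  (Measure.smul_absolutelyContinuous).trans Measure.restrict_le_self.absolutelyContinuous

lemma setLIntegral_ball (x : X) {r : ℝ} (hr : 0 < r) (φ : X → ℝ≥0∞) :
    ∫⁻ y in H.ball x r, φ y ∂μ = μ (H.ball x r) * ∫⁻ y, φ y ∂(H.nu x r) := by
  rw [lintegral_nu, ← mul_assoc, ENNReal.mul_inv_cancel (H.measure_ball_ne_zero hr)
    (H.measure_ball_ne_top hr), one_mul]

/-- Comparison of the means over two nested balls of comparable measure. -/
lemma lintegral_nu_le_of_subset {x y : X} {r s : ℝ} (hr : 0 < r) (hs : 0 < s) {D : ℝ≥0∞}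
    (hsub : H.ball x r ⊆ H.ball y s) (hD : μ (H.ball y s) ≤ D * μ (H.ball x r))
    (φ : X → ℝ≥0∞) :
    ∫⁻ z, φ z ∂(H.nu x r) ≤ D * ∫⁻ z, φ z ∂(H.nu y s) := by
  rw [lintegral_nu, ENNReal.inv_mul_le_iff (H.measure_ball_ne_zero hr) (H.measure_ball_ne_top hr)]
  calc ∫⁻ z in H.ball x r, φ z ∂μ ≤ ∫⁻ z in H.ball y s, φ z ∂μ := lintegral_mono_set hsub
    _ = μ (H.ball y s) * ∫⁻ z, φ z ∂(H.nu y s) := H.setLIntegral_ball y hs φ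
    _ ≤ D * μ (H.ball x r) * ∫⁻ z, φ z ∂(H.nu y s) := by gcongr
    _ = _ := by ring

/-- **Vitali covering lemma** for a compact set covered by balls. -/
lemma exists_disjoint_cover {s : Set X} (hs : IsCompact s) {A : Set (X × ℝ)}
    (hA : ∀ a ∈ A, 0 < a.2) (hsA : s ⊆ ⋃ a ∈ A, H.ball a.1 a.2) :
    ∃ u : Finset (X × ℝ), (u : Set (X × ℝ)) ⊆ A ∧
      (u : Set (X × ℝ)).PairwiseDisjoint (fun a => H.ball a.1 a.2) ∧
      s ⊆ ⋃ a ∈ u, H.ball a.1 (H.c ^ 2 * a.2) := by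
  classical
  obtain ⟨t, htA, htf, hst⟩ := hs.elim_finite_subcover_image
    (fun a ha => H.isOpen_ball a.1 a.2 (hA a ha)) hsA
  obtain ⟨R, hR⟩ := (htf.image Prod.snd).bddAbove
  obtain ⟨u, hut, hdis, hcov⟩ := Vitali.exists_disjoint_subfamily_covering_enlargement
    (fun a : X × ℝ => H.ball a.1 a.2) t Prod.snd H.c H.one_lt_c (fun a ha => (hA a (htA ha)).le) R
    (fun a ha => hR (Set.mem_image_of_mem _ ha))
    (fun a ha => ⟨a.1, H.mem_ball _ _ (hA a (htA ha))⟩)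
  refine ⟨(htf.subset hut).toFinset, by simpa using hut.trans htA, by simpa using hdis, ?_⟩
  intro x hx
  obtain ⟨a, ha, hxa⟩ := Set.mem_iUnion₂.1 (hst hx)
  obtain ⟨b, hb, hab, hr⟩ := hcov a ha
  have hb0 := hA b (htA (hut hb))
  refine Set.mem_iUnion₂.2 ⟨b, by simpa using hb, ?_⟩
  have := H.engulfing b.1 a.1 (H.c * b.2) a.2 (hA a (htA ha)) hr
    (by
      obtain ⟨z, hz⟩ := hab
      exact ⟨z, H.ball_subset_mul _ hb0 H.one_lt_c.le hz.2, hz.1⟩)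
  rw [pow_two, mul_assoc]
  exact this hxa

lemma sum_measure_le_of_pairwiseDisjoint [OpensMeasurableSpace X] {u : Finset (X × ℝ)}
    (hu : ∀ a ∈ u, 0 < a.2)
    (hdis : (u : Set (X × ℝ)).PairwiseDisjoint (fun a => H.ball a.1 a.2)) (φ : X → ℝ≥0∞)
    {S : Set X} (hS : ∀ a ∈ u, H.ball a.1 a.2 ⊆ S) :
    ∑ a ∈ u, ∫⁻ y in H.ball a.1 a.2, φ y ∂μ ≤ ∫⁻ y in S, φ y ∂μ := by
  rw [← lintegral_biUnion_finset hdis (fun a ha => H.measurableSet_ball _ (hu a ha))]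
  exact lintegral_mono_set (Set.iUnion₂_subset hS)

/-- The uncentred Hardy–Littlewood maximal function. -/
def maximal (φ : X → ℝ≥0∞) (x : X) : ℝ≥0∞ :=
  ⨆ (y : X) (r : ℝ) (_ : 0 < r) (_ : x ∈ H.ball y r), ∫⁻ z, φ z ∂(H.nu y r)

lemma le_maximal (φ : X → ℝ≥0∞) {x y : X} {r : ℝ} (hr : 0 < r) (hx : x ∈ H.ball y r) :
    ∫⁻ z, φ z ∂(H.nu y r) ≤ H.maximal φ x :=
  le_iSup₂_of_le y r (le_iSup₂_of_le hr hx le_rfl)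

lemma lt_maximal_iff {φ : X → ℝ≥0∞} {x : X} {a : ℝ≥0∞} :
    a < H.maximal φ x ↔ ∃ y r, 0 < r ∧ x ∈ H.ball y r ∧ a < ∫⁻ z, φ z ∂(H.nu y r) := by
  simp only [maximal, lt_iSup_iff, exists_prop]

lemma maximal_congr_ae {φ ψ : X → ℝ≥0∞} (h : φ =ᵐ[μ] ψ) : H.maximal φ = H.maximal ψ := by
  funext x
  simp only [maximal]
  refine iSup_congr fun y => iSup_congr fun r => ?_
  rw [lintegral_congr_ae ((H.nu_absolutelyContinuous y r).ae_eq h)]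

lemma isOpen_lt_maximal (φ : X → ℝ≥0∞) (a : ℝ≥0∞) : IsOpen {x | a < H.maximal φ x} := by
  refine isOpen_iff_forall_mem_open.2 fun x hx => ?_
  obtain ⟨y, r, hr, hxy, h⟩ := H.lt_maximal_iff.1 hx
  exact ⟨H.ball y r, fun z hz => H.lt_maximal_iff.2 ⟨y, r, hr, hz, h⟩, H.isOpen_ball y r hr, hxy⟩

lemma measurable_maximal [BorelSpace X] (φ : X → ℝ≥0∞) : Measurable (H.maximal φ) :=
  measurable_of_Ioi fun a => (H.isOpen_lt_maximal φ a).measurableSet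

lemma measure_mul_pow_le_sum {u : Finset (X × ℝ)} (hu : ∀ a ∈ u, 0 < a.2) {s : Set X} (i : ℕ)
    (hs : s ⊆ ⋃ a ∈ u, H.ball a.1 (H.c ^ i * a.2)) :
    μ s ≤ H.doublingConst ^ i * ∑ a ∈ u, μ (H.ball a.1 a.2) := by
  calc μ s ≤ ∑ a ∈ u, μ (H.ball a.1 (H.c ^ i * a.2)) :=
        (measure_mono hs).trans (measure_biUnion_finset_le _ _)
    _ ≤ ∑ a ∈ u, H.doublingConst ^ i * μ (H.ball a.1 a.2) :=
        Finset.sum_le_sum fun a ha => H.measure_ball_pow_le a.1 (hu a ha) i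
    _ = _ := by rw [Finset.mul_sum]

/-- The weak type `(1,1)` inequality. -/
lemma mul_measure_lt_maximal_le [BorelSpace X] [μ.Regular] (φ : X → ℝ≥0∞) (t : ℝ≥0∞) :
    t * μ {x | t < H.maximal φ x} ≤ H.doublingConst ^ 2 * ∫⁻ x, φ x ∂μ := by
  rw [(H.isOpen_lt_maximal φ t).measure_eq_iSup_isCompact]
  simp only [ENNReal.mul_iSup]
  refine iSup_le fun s => iSup_le fun hs => iSup_le fun hsc => ?_
  obtain ⟨u, huA, hdis, hcov⟩ := H.exists_disjoint_cover hsc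
    (A := {a | 0 < a.2 ∧ t < ∫⁻ z, φ z ∂(H.nu a.1 a.2)}) (fun a ha => ha.1) (by
      intro x hx
      obtain ⟨y, r, hr, hxy, h⟩ := H.lt_maximal_iff.1 (hs hx)
      exact Set.mem_iUnion₂.2 ⟨(y, r), ⟨hr, h⟩, hxy⟩)
  have hu0 : ∀ a ∈ u, 0 < a.2 := fun a ha => (huA ha).1
  calc t * μ s ≤ t * (H.doublingConst ^ 2 * ∑ a ∈ u, μ (H.ball a.1 a.2)) := by
        gcongr
        exact H.measure_mul_pow_le_sum hu0 2 hcov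
    _ = H.doublingConst ^ 2 * ∑ a ∈ u, t * μ (H.ball a.1 a.2) := by
        rw [← Finset.mul_sum]; ring
    _ ≤ H.doublingConst ^ 2 * ∑ a ∈ u, ∫⁻ y in H.ball a.1 a.2, φ y ∂μ := by
        gcongr with a ha
        rw [H.setLIntegral_ball a.1 (hu0 a ha), mul_comm]
        gcongr
        exact (huA ha).2.le
    _ ≤ H.doublingConst ^ 2 * ∫⁻ x, φ x ∂μ := by
        gcongr
        simpa using H.sum_measure_le_of_pairwiseDisjoint hu0 hdis φ
          (S := Set.univ) (fun _ _ => Set.subset_univ _)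

/-- The weak type inequality where only the large values of the function enter. -/
lemma mul_measure_lt_maximal_le' [BorelSpace X] [μ.Regular] {φ : X → ℝ≥0∞} (hφ : Measurable φ)
    (t : ℝ≥0∞) :
    t * μ {x | t < H.maximal φ x} ≤ 2 * H.doublingConst ^ 2 * ∫⁻ x in {x | t < 2 * φ x}, φ x ∂μ := by
  set E := {x | t < 2 * φ x} with hE
  have hEm : MeasurableSet E := measurableSet_lt measurable_const (hφ.const_mul 2)
  have hsub : {x | t < H.maximal φ x} ⊆ {x | t / 2 < H.maximal (E.indicator φ) x} := by
    intro x hx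
    obtain ⟨y, r, hr, hxy, h⟩ := H.lt_maximal_iff.1 hx
    refine H.lt_maximal_iff.2 ⟨y, r, hr, hxy, ?_⟩
    by_contra hcon
    have := H.isProbabilityMeasure_nu y hr
    have h1 : ∫⁻ z, φ z ∂(H.nu y r) ≤ ∫⁻ z, (E.indicator φ z + t / 2) ∂(H.nu y r) := by
      refine lintegral_mono fun z => ?_
      by_cases hz : z ∈ E
      · simp [hz]
      · simp only [hz, not_false_eq_true, Set.indicator_of_notMem, zero_add]
        rw [ENNReal.le_div_iff_mul_le (by simp) (by simp), mul_comm]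
        exact not_lt.1 hz
    rw [lintegral_add_right _ measurable_const, lintegral_const, measure_univ, mul_one] at h1
    have : ∫⁻ z, φ z ∂(H.nu y r) ≤ t / 2 + t / 2 := h1.trans (by gcongr; exact not_lt.1 hcon)
    rw [ENNReal.add_halves] at this
    exact absurd h (not_lt.2 this)
  calc t * μ {x | t < H.maximal φ x} ≤ t * μ {x | t / 2 < H.maximal (E.indicator φ) x} := by gcongr
    _ = 2 * (t / 2 * μ {x | t / 2 < H.maximal (E.indicator φ) x}) := by
        rw [← mul_assoc, ENNReal.mul_div_cancel (by simp) (by simp)]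
    _ ≤ 2 * (H.doublingConst ^ 2 * ∫⁻ x, E.indicator φ x ∂μ) := by
        exact mul_le_mul' le_rfl (H.mul_measure_lt_maximal_le _ _)
    _ = _ := by rw [lintegral_indicator hEm, mul_assoc]

end Maximal

section LayerCake

lemma lintegral_Ioi_rpow_of_lt (a : ℝ≥0∞) {q : ℝ} (hq : 0 < q) :
    ∫⁻ t in Set.Ioi (0 : ℝ), {t : ℝ | ENNReal.ofReal t < a}.indicator
      (fun t => ENNReal.ofReal (q * t ^ (q - 1))) t = a ^ q := by
  have key : ∀ b : ℝ, 0 ≤ b → ∫⁻ t in Set.Ioi (0 : ℝ), {t : ℝ | ENNReal.ofReal t < ENNReal.ofReal b}.indicator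
      (fun t => ENNReal.ofReal (q * t ^ (q - 1))) t = ENNReal.ofReal b ^ q := by
    intro b hb
    have h := lintegral_rpow_eq_lintegral_meas_lt_mul (Measure.dirac ()) (f := fun _ => b)
      (Eventually.of_forall fun _ => hb) (by fun_prop) hq
    rw [lintegral_dirac, ← ENNReal.ofReal_rpow_of_nonneg hb hq.le, ← lintegral_const_mul' _ _ (by simp)] at h
    rw [h]
    refine setLIntegral_congr_fun measurableSet_Ioi fun t ht => ?_
    by_cases htb : t < b
    · have : ENNReal.ofReal t < ENNReal.ofReal b := (ENNReal.ofReal_lt_ofReal_iff (ht.trans htb)).2 htb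
      simp [this, htb, ENNReal.ofReal_mul hq.le]
    · have : ¬ ENNReal.ofReal t < ENNReal.ofReal b := not_lt.2 (ENNReal.ofReal_le_ofReal (not_lt.1 htb))
      simp [this, htb]
  rcases eq_or_ne a ∞ with rfl | ha
  · rw [ENNReal.top_rpow_of_pos hq]
    refine ENNReal.eq_top_of_forall_nnreal_le fun M => ?_
    have h1 := key ((M : ℝ) ^ (1 / q)) (by positivity)
    rw [ENNReal.ofReal_rpow_of_nonneg (by positivity) hq.le, ← Real.rpow_mul (by positivity),
      one_div_mul_cancel hq.ne', Real.rpow_one, ENNReal.ofReal_coe_nnreal] at h1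
    rw [← h1]
    refine lintegral_mono fun t => ?_
    refine Set.indicator_le_indicator_of_subset (fun t ht => ?_) (fun _ => zero_le) t
    exact ENNReal.ofReal_lt_top
  · simpa [ENNReal.ofReal_toReal ha] using key a.toReal ENNReal.toReal_nonneg

/-- The layer cake formula for the powers of an extended nonnegative function. -/
lemma lintegral_rpow_eq_lintegral_Ioi {X : Type*} [MeasurableSpace X] {μ : Measure X} [SFinite μ]
    {g : X → ℝ≥0∞} (hg : Measurable g) {q : ℝ} (hq : 0 < q) :
    ∫⁻ x, g x ^ q ∂μ = ∫⁻ t in Set.Ioi (0 : ℝ), ENNReal.ofReal (q * t ^ (q - 1)) *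
      μ {x | ENNReal.ofReal t < g x} := by
  simp_rw [← lintegral_Ioi_rpow_of_lt _ hq]
  have hm : MeasurableSet {z : X × ℝ | ENNReal.ofReal z.2 < g z.1} :=
    measurableSet_lt (by fun_prop) (hg.comp measurable_fst)
  rw [lintegral_lintegral_swap]
  · refine lintegral_congr fun t => ?_
    rw [← lintegral_indicator_const (measurableSet_lt measurable_const hg)]
    rfl
  · have h1 : Measurable fun z : X × ℝ => {z : X × ℝ | ENNReal.ofReal z.2 < g z.1}.indicator
        (fun z => ENNReal.ofReal (q * z.2 ^ (q - 1))) z :=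
      Measurable.indicator (by fun_prop) hm
    exact h1.aemeasurable

end LayerCake

section StrongType

variable {X : Type*} [TopologicalSpace X] [MeasurableSpace X] {μ : Measure X}
  (H : HomogeneousStructure μ)

/-- The strong type `(p,p)` inequality of the maximal function. -/
lemma lintegral_maximal_rpow_le [BorelSpace X] [μ.Regular] {p : ℝ} (hp : 1 < p) :
    ∃ C : ℝ≥0, ∀ φ : X → ℝ≥0∞, AEMeasurable φ μ →
      ∫⁻ x, H.maximal φ x ^ p ∂μ ≤ C * ∫⁻ x, φ x ^ p ∂μ := by
  have hp0 : 0 < p := by linarith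
  have hp1 : 0 < p - 1 := by linarith
  refine ⟨((2 * H.doublingConst ^ 2) * ENNReal.ofReal (p / (p - 1)) * 2 ^ (p - 1)).toNNReal,
    fun φ' hφ' => ?_⟩
  rw [ENNReal.coe_toNNReal (by
    refine ENNReal.mul_ne_top (ENNReal.mul_ne_top (ENNReal.mul_ne_top (by simp)
      (ENNReal.pow_ne_top H.doublingConst_ne_top)) (by simp))
      (ENNReal.rpow_ne_top_of_nonneg hp1.le (by simp)))]
  set φ := hφ'.mk φ'
  have hφ : Measurable φ := hφ'.measurable_mk
  rw [H.maximal_congr_ae hφ'.ae_eq_mk, lintegral_congr_ae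
    (show (fun x => φ' x ^ p) =ᵐ[μ] fun x => φ x ^ p from by
      filter_upwards [hφ'.ae_eq_mk] with x hx using by rw [hx])]
  have := H.sigmaFinite
  set ν := μ.withDensity φ with hν
  have h1 : ∫⁻ x, φ x * (2 * φ x) ^ (p - 1) ∂μ = ∫⁻ t in Set.Ioi (0 : ℝ),
      ENNReal.ofReal ((p - 1) * t ^ (p - 1 - 1)) * ν {x | ENNReal.ofReal t < 2 * φ x} := by
    rw [← lintegral_rpow_eq_lintegral_Ioi (hφ.const_mul 2) hp1,
      lintegral_withDensity_eq_lintegral_mul _ hφ (by fun_prop)]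
    rfl
  calc ∫⁻ x, H.maximal φ x ^ p ∂μ
      = ∫⁻ t in Set.Ioi (0 : ℝ), ENNReal.ofReal (p * t ^ (p - 1)) *
        μ {x | ENNReal.ofReal t < H.maximal φ x} :=
        lintegral_rpow_eq_lintegral_Ioi (H.measurable_maximal φ) hp0
    _ ≤ ∫⁻ t in Set.Ioi (0 : ℝ), (2 * H.doublingConst ^ 2) * ENNReal.ofReal (p / (p - 1)) *
        (ENNReal.ofReal ((p - 1) * t ^ (p - 1 - 1)) * ν {x | ENNReal.ofReal t < 2 * φ x}) := by
        refine setLIntegral_mono' measurableSet_Ioi fun t ht => ?_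
        replace ht : 0 < t := ht
        have h2 := H.mul_measure_lt_maximal_le' hφ (ENNReal.ofReal t)
        rw [← withDensity_apply _ (measurableSet_lt measurable_const (hφ.const_mul 2))] at h2
        have h3 : ENNReal.ofReal (p * t ^ (p - 1)) = ENNReal.ofReal (p / (p - 1)) *
            ENNReal.ofReal ((p - 1) * t ^ (p - 1 - 1)) * ENNReal.ofReal t := by
          rw [← ENNReal.ofReal_mul (by positivity), ← ENNReal.ofReal_mul (by positivity)]
          congr 1
          rw [Real.rpow_sub_one ht.ne' (p - 1)]
          field_simp
        rw [h3, mul_assoc]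
        calc _ ≤ ENNReal.ofReal (p / (p - 1)) * ENNReal.ofReal ((p - 1) * t ^ (p - 1 - 1)) *
              (2 * H.doublingConst ^ 2 * ν {x | ENNReal.ofReal t < 2 * φ x}) := by
              exact mul_le_mul' le_rfl h2
          _ = _ := by ring
    _ = (2 * H.doublingConst ^ 2) * ENNReal.ofReal (p / (p - 1)) *
        ∫⁻ x, φ x * (2 * φ x) ^ (p - 1) ∂μ := by
        rw [lintegral_const_mul' _ _ (ENNReal.mul_ne_top (ENNReal.mul_ne_top (by simp)
          (ENNReal.pow_ne_top H.doublingConst_ne_top)) (by simp)), h1]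
    _ = (2 * H.doublingConst ^ 2) * ENNReal.ofReal (p / (p - 1)) *
        ∫⁻ x, 2 ^ (p - 1) * φ x ^ p ∂μ := by
        congr 1
        refine lintegral_congr fun x => ?_
        rw [ENNReal.mul_rpow_of_nonneg _ _ hp1.le, mul_left_comm]
        congr 1
        nth_rewrite 1 [← ENNReal.rpow_one (φ x)]
        rw [← ENNReal.rpow_add_of_nonneg _ _ zero_le_one hp1.le]
        congr 1; ring
    _ = _ := by
        rw [lintegral_const_mul' _ _ (ENNReal.rpow_ne_top_of_nonneg hp1.le (by simp))]
        ring

lemma exists_ball_pow_le {s : Set X} (hs : IsCompact s) [T2Space X] {y : X} (hy : y ∉ s) :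
    ∃ n : ℕ, ∀ x ∈ s, y ∉ H.ball x (1 / ((n : ℝ) + 1)) := by
  have hc := H.c_pos
  have hr : ∀ x : X, ∃ r : ℝ, 0 < r ∧ (x ∈ s → y ∉ H.ball x r) := by
    intro x
    by_cases hx : x ∈ s
    · by_contra! hcon
      exact hy ((H.separates x y fun r hr => (hcon r hr).2) ▸ hx)
    · exact ⟨1, one_pos, fun h => absurd h hx⟩
  choose r hr0 hr using hr
  obtain ⟨t, hst⟩ := hs.elim_nhds_subcover' (fun x _ => H.ball x (r x / H.c))
    (fun x _ => (H.isOpen_ball x _ (div_pos (hr0 x) hc)).mem_nhds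
      (H.mem_ball x _ (div_pos (hr0 x) hc)))
  have hlim : ∀ᶠ n : ℕ in atTop, ∀ x ∈ t, 1 / ((n : ℝ) + 1) ≤ r x / H.c := by
    rw [Filter.eventually_all_finset]
    intro x _
    exact (tendsto_one_div_add_atTop_nhds_zero_nat.eventually_le_const (div_pos (hr0 x) hc))
  obtain ⟨n, hn⟩ := hlim.exists
  refine ⟨n, fun x hx hyx => ?_⟩
  obtain ⟨z, hz, hxz⟩ := Set.mem_iUnion₂.1 (hst hx)
  have h1 := H.engulfing z x (r z / H.c) (1 / ((n : ℝ) + 1)) (by positivity) (hn z hz)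
    ⟨x, hxz, H.mem_ball x _ (by positivity)⟩
  rw [mul_div_cancel₀ _ hc.ne'] at h1
  exact hr z z.2 (h1 hyx)

/-- A weak form of the density theorem: a compact set of positive measure almost fills some ball. -/
lemma exists_ball_lt_measure_inter [T2Space X] [BorelSpace X] [μ.Regular] {s : Set X}
    (hs : IsCompact s) (hμ : μ s ≠ 0) {θ : ℝ≥0∞} (hθ : θ < 1) :
    ∃ y r, 0 < r ∧ θ * μ (H.ball y r) < μ (H.ball y r ∩ s) := by
  by_contra! hcon
  set U : ℕ → Set X := fun n => ⋃ x ∈ s, H.ball x (1 / ((n : ℝ) + 1)) with hU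
  have hUo : ∀ n, IsOpen (U n) := fun n =>
    isOpen_biUnion fun x _ => H.isOpen_ball x _ (by positivity)
  have hUanti : Antitone U := by
    intro m n hmn
    refine Set.iUnion₂_mono fun x _ => H.ball_mono x _ _ (by positivity) ?_
    exact one_div_le_one_div_of_le (by positivity) (by gcongr)
  have hUtop : μ (U 0) ≠ ∞ := by
    obtain ⟨t, hts, hst⟩ := hs.elim_nhds_subcover (fun x => H.ball x 1)
      (fun x _ => (H.isOpen_ball x _ one_pos).mem_nhds (H.mem_ball x _ one_pos))
    have : U 0 ⊆ ⋃ x ∈ t, H.ball x (H.c * 1) := by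
      refine Set.iUnion₂_subset fun x hx => ?_
      obtain ⟨z, hz, hxz⟩ := Set.mem_iUnion₂.1 (hst hx)
      refine subset_trans ?_ (Set.subset_biUnion_of_mem (u := fun x => H.ball x (H.c * 1)) hz)
      exact H.engulfing z x 1 _ (by simp) (by simp) ⟨x, hxz, H.mem_ball x _ (by simp)⟩
    refine ((measure_mono this).trans_lt ((measure_biUnion_finset_le _ _).trans_lt ?_)).ne
    exact ENNReal.sum_lt_top.2 fun x _ => H.measure_ball_lt_top x _ (by simpa using H.c_pos)
  have hlim : Tendsto (fun n => H.doublingConst ^ 2 * μ (U n \ s)) atTop (𝓝 0) := by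
    have h1 : Tendsto (fun n => μ (U n \ s)) atTop (𝓝 (μ (⋂ n, U n \ s))) := by
      refine tendsto_measure_iInter_atTop
        (fun n => ((hUo n).measurableSet.diff hs.measurableSet).nullMeasurableSet)
        (fun m n h => Set.sdiff_subset_sdiff_left (hUanti h)) ⟨0, ?_⟩
      exact ((measure_mono Set.sdiff_subset).trans_lt hUtop.lt_top).ne
    have h2 : ⋂ n, U n \ s = ∅ := by
      refine Set.eq_empty_of_forall_notMem fun y hy => ?_
      have hys : y ∉ s := (Set.mem_iInter.1 hy 0).2
      obtain ⟨n, hn⟩ := H.exists_ball_pow_le hs hys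
      obtain ⟨x, hx, hyx⟩ := Set.mem_iUnion₂.1 (Set.mem_iInter.1 hy n).1
      exact hn x hx hyx
    rw [h2, measure_empty] at h1
    simpa using ENNReal.Tendsto.const_mul h1
      (Or.inr (ENNReal.pow_ne_top H.doublingConst_ne_top (n := 2)))
  have hbound : ∀ n, (1 - θ) * μ s ≤ H.doublingConst ^ 2 * μ (U n \ s) := by
    intro n
    have hn : (0 : ℝ) < 1 / ((n : ℝ) + 1) := by positivity
    obtain ⟨u, huA, hdis, hcov⟩ := H.exists_disjoint_cover hs
      (A := (fun x => (x, 1 / ((n : ℝ) + 1))) '' s) (by rintro _ ⟨x, -, rfl⟩; exact hn)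
      (fun x hx => Set.mem_iUnion₂.2 ⟨_, ⟨x, hx, rfl⟩, H.mem_ball x _ hn⟩)
    have hu0 : ∀ a ∈ u, 0 < a.2 := fun a ha => by
      obtain ⟨x, -, rfl⟩ := huA ha; exact hn
    calc (1 - θ) * μ s ≤ (1 - θ) * (H.doublingConst ^ 2 * ∑ a ∈ u, μ (H.ball a.1 a.2)) := by
          gcongr
          exact H.measure_mul_pow_le_sum hu0 2 hcov
      _ = H.doublingConst ^ 2 * ∑ a ∈ u, (1 - θ) * μ (H.ball a.1 a.2) := by
          rw [← Finset.mul_sum]; ring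
      _ ≤ H.doublingConst ^ 2 * ∑ a ∈ u, ∫⁻ y in H.ball a.1 a.2, sᶜ.indicator 1 y ∂μ := by
          gcongr with a ha
          rw [lintegral_indicator_one hs.measurableSet.compl,
            Measure.restrict_apply hs.measurableSet.compl, Set.inter_comm, ← Set.sdiff_eq,
            ENNReal.sub_mul (fun _ _ => H.measure_ball_ne_top (hu0 a ha)), one_mul,
            tsub_le_iff_left]
          calc μ (H.ball a.1 a.2) ≤ μ (H.ball a.1 a.2 ∩ s) + μ (H.ball a.1 a.2 \ s) :=
                measure_le_inter_add_sdiff _ _ _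
            _ ≤ _ := by gcongr; exact hcon _ _ (hu0 a ha)
      _ ≤ H.doublingConst ^ 2 * ∫⁻ y in U n, sᶜ.indicator 1 y ∂μ := by
          gcongr
          refine H.sum_measure_le_of_pairwiseDisjoint hu0 hdis _ fun a ha => ?_
          obtain ⟨x, hx, rfl⟩ := huA ha
          exact Set.subset_biUnion_of_mem (u := fun x => H.ball x (1 / ((n : ℝ) + 1))) hx
      _ = H.doublingConst ^ 2 * μ (U n \ s) := by
          rw [lintegral_indicator_one hs.measurableSet.compl,
            Measure.restrict_apply hs.measurableSet.compl, Set.inter_comm, ← Set.sdiff_eq]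
  have := ge_of_tendsto' hlim hbound
  rcases mul_eq_zero.1 (le_antisymm this zero_le) with h | h
  · exact absurd (tsub_eq_zero_iff_le.1 h) (not_le.2 hθ)
  · exact hμ h

/-- A function is almost everywhere dominated by its maximal function. -/
lemma ae_le_maximal [T2Space X] [BorelSpace X] [μ.Regular] {φ : X → ℝ≥0∞}
    (hφ : AEMeasurable φ μ) : ∀ᵐ x ∂μ, φ x ≤ H.maximal φ x := by
  suffices h : ∀ ψ : X → ℝ≥0∞, Measurable ψ → ∀ᵐ x ∂μ, ψ x ≤ H.maximal ψ x by
    filter_upwards [h _ hφ.measurable_mk, hφ.ae_eq_mk] with x h1 h2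
    rwa [H.maximal_congr_ae hφ.ae_eq_mk, h2]
  intro ψ hψ
  have := H.sigmaFinite
  -- A null set of exceptions for each pair of rational levels. Otherwise a density ball of a compact
  -- part of the exceptional set would have a mean of `ψ` above the bound given by `maximal ψ`.
  have key : ∀ q q' : ℚ, Real.toNNReal q < Real.toNNReal q' →
      ∀ᵐ x ∂μ, ¬ (H.maximal ψ x < Real.toNNReal q ∧ (Real.toNNReal q' : ℝ≥0∞) < ψ x) := by
    intro q q' hqq
    set t : ℝ≥0∞ := ((Real.toNNReal q : ℝ≥0) : ℝ≥0∞) with ht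
    set t' : ℝ≥0∞ := ((Real.toNNReal q' : ℝ≥0) : ℝ≥0∞) with ht'
    have htt : t < t' := ENNReal.coe_lt_coe.2 hqq
    have hE : MeasurableSet {x | H.maximal ψ x < t ∧ t' < ψ x} :=
      (measurableSet_lt (H.measurable_maximal ψ) measurable_const).inter
        (measurableSet_lt measurable_const hψ)
    rw [ae_iff]
    simp only [not_not]
    by_contra hne
    obtain ⟨S, hSE, hS0, hStop⟩ : ∃ S ⊆ {x | H.maximal ψ x < t ∧ t' < ψ x}, IsCompact S ∧ 0 < μ S := by
      exact hE.exists_lt_isCompact (pos_iff_ne_zero.2 hne)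
    obtain ⟨y, r, hr, h⟩ := H.exists_ball_lt_measure_inter hS0 hStop.ne' (θ := t / t')
      (ENNReal.div_lt_of_lt_mul (by rwa [one_mul]))
    obtain ⟨x, hx, hxS⟩ : (H.ball y r ∩ S).Nonempty := nonempty_of_measure_ne_zero
      (zero_le.trans_lt h).ne'
    have h1 : t' * μ (H.ball y r ∩ S) ≤ μ (H.ball y r) * ∫⁻ z, ψ z ∂(H.nu y r) := by
      rw [← H.setLIntegral_ball y hr, ← setLIntegral_const]
      refine (setLIntegral_mono hψ fun z hz => (hSE hz.2).2.le).trans ?_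
      exact lintegral_mono_set Set.inter_subset_left
    have h2 : ∫⁻ z, ψ z ∂(H.nu y r) < t := (H.le_maximal ψ hr hx).trans_lt (hSE hxS).1
    have ht0 : t' ≠ 0 := (zero_le.trans_lt htt).ne'
    have h3 : t * μ (H.ball y r) < t' * μ (H.ball y r ∩ S) := by
      have := (ENNReal.mul_lt_mul_iff_right ht0 (by simp [ht'] : t' ≠ ∞)).2 h
      rwa [← mul_assoc, ENNReal.mul_div_cancel ht0 (by simp [ht'])] at this
    have h4 := h3.trans_le h1
    rw [mul_comm] at h4
    exact absurd h4 (not_lt.2 (mul_le_mul' le_rfl h2.le))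
  have hall : ∀ᵐ x ∂μ, ∀ q q' : ℚ, Real.toNNReal q < Real.toNNReal q' →
      ¬ (H.maximal ψ x < Real.toNNReal q ∧ (Real.toNNReal q' : ℝ≥0∞) < ψ x) := by
    refine ae_all_iff.2 fun q => ae_all_iff.2 fun q' => ?_
    by_cases h : Real.toNNReal q < Real.toNNReal q'
    · filter_upwards [key q q' h] with x hx _ using hx
    · exact Eventually.of_forall fun x h' => absurd h' h
  filter_upwards [hall] with x hx
  by_contra! hcon
  obtain ⟨q, -, h1, h2⟩ := ENNReal.lt_iff_exists_rat_btwn.1 hcon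
  obtain ⟨q', -, h3, h4⟩ := ENNReal.lt_iff_exists_rat_btwn.1 h2
  exact hx q q' (ENNReal.coe_lt_coe.1 h3) ⟨h1, h4⟩

end StrongType

/-! ### Mean oscillation and the sharp maximal function -/

section Sharp

lemma lintegral_rpow_le_of_isProbabilityMeasure {Y : Type*} [MeasurableSpace Y] {ν : Measure Y}
    [IsProbabilityMeasure ν] {φ : Y → ℝ≥0∞} (hφ : AEMeasurable φ ν) {q : ℝ} (hq : 1 ≤ q) :
    (∫⁻ x, φ x ∂ν) ^ q ≤ ∫⁻ x, φ x ^ q ∂ν := by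
  have h := eLpNorm'_le_eLpNorm'_of_exponent_le one_pos hq ν hφ.aestronglyMeasurable
  simp only [eLpNorm', enorm_eq_self, ENNReal.rpow_one, div_one] at h
  calc (∫⁻ x, φ x ∂ν) ^ q ≤ ((∫⁻ x, φ x ^ q ∂ν) ^ (1 / q)) ^ q := by gcongr
    _ = _ := by
      rw [← ENNReal.rpow_mul, one_div_mul_cancel (by linarith), ENNReal.rpow_one]

variable {X : Type*} [TopologicalSpace X] [MeasurableSpace X] {μ : Measure X}
  (H : HomogeneousStructure μ)

/-- The mean of `F` over a ball. -/
def mean (F : X → ℂ) (x : X) (r : ℝ) : ℂ := ∫ y, F y ∂(H.nu x r)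

lemma setAverage_ball (F : X → ℂ) (x : X) (r : ℝ) : ⨍ y in H.ball x r, F y ∂μ = H.mean F x r := by
  rw [average, Measure.restrict_apply_univ, mean, nu]

/-- The mean oscillation of `F` over a ball. -/
def osc (F : X → ℂ) (x : X) (r : ℝ) : ℝ≥0∞ := ∫⁻ y, ‖F y - H.mean F x r‖ₑ ∂(H.nu x r)

lemma osc_le_bmoNorm (F : X → ℂ) (x : X) {r : ℝ} (hr : 0 < r) : H.osc F x r ≤ H.bmoNorm F := by
  rw [osc, lintegral_nu, ← setAverage_ball]
  exact le_iSup₂_of_le x r (le_iSup_of_le hr le_rfl)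

/-- The sharp maximal function of Fefferman and Stein. -/
def sharp (F : X → ℂ) (x : X) : ℝ≥0∞ :=
  ⨆ (y : X) (r : ℝ) (_ : 0 < r) (_ : x ∈ H.ball y r), H.osc F y r

lemma osc_le_sharp (F : X → ℂ) {x y : X} {r : ℝ} (hr : 0 < r) (hx : x ∈ H.ball y r) :
    H.osc F y r ≤ H.sharp F x :=
  le_iSup₂_of_le y r (le_iSup₂_of_le hr hx le_rfl)

lemma sharp_le {F : X → ℂ} {x : X} {a : ℝ≥0∞}
    (h : ∀ y r, 0 < r → x ∈ H.ball y r → H.osc F y r ≤ a) : H.sharp F x ≤ a :=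
  iSup₂_le fun y r => iSup₂_le fun hr hx => h y r hr hx

lemma measurable_sharp [BorelSpace X] (F : X → ℂ) : Measurable (H.sharp F) := by
  refine measurable_of_Ioi fun a => IsOpen.measurableSet ?_
  refine isOpen_iff_forall_mem_open.2 fun x hx => ?_
  simp only [sharp, Set.mem_preimage, Set.mem_Ioi, lt_iSup_iff] at hx
  obtain ⟨y, r, hr, hxy, h⟩ := hx
  exact ⟨H.ball y r, fun z hz => h.trans_le (H.osc_le_sharp F hr hz), H.isOpen_ball y r hr, hxy⟩

/-- A function integrable on every ball. -/
def LocInt (F : X → ℂ) : Prop := ∀ x r, 0 < r → IntegrableOn F (H.ball x r) μ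

variable {H} in
lemma LocInt.integrable_nu {F : X → ℂ} (hF : H.LocInt F) (x : X) {r : ℝ} (hr : 0 < r) :
    Integrable F (H.nu x r) :=
  (hF x r hr).smul_measure (ENNReal.inv_ne_top.2 (H.measure_ball_ne_zero hr))

variable {H} in
lemma LocInt.aestronglyMeasurable {F : X → ℂ} (hF : H.LocInt F) : AEStronglyMeasurable F μ := by
  rcases isEmpty_or_nonempty X with hX | ⟨⟨x₀⟩⟩
  · rw [Measure.eq_zero_of_isEmpty μ]
    exact aestronglyMeasurable_zero_measure F
  · rw [← Measure.restrict_univ (μ := μ), ← H.iUnion_ball x₀, aestronglyMeasurable_iUnion_iff]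
    exact fun n => (hF x₀ _ (by positivity)).aestronglyMeasurable

variable {H} in
lemma LocInt.sub_const {F : X → ℂ} (hF : H.LocInt F) (a : ℂ) : H.LocInt (fun y => F y - a) :=
  fun x r hr => (hF x r hr).sub (integrableOn_const (H.measure_ball_ne_top hr))

variable {H} in
lemma LocInt.enorm_mean_sub_le {F : X → ℂ} (hF : H.LocInt F) (x : X) {r : ℝ} (hr : 0 < r) (a : ℂ) :
    ‖H.mean F x r - a‖ₑ ≤ ∫⁻ y, ‖F y - a‖ₑ ∂(H.nu x r) := by
  have := H.isProbabilityMeasure_nu x hr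
  have : H.mean F x r - a = ∫ y, (F y - a) ∂(H.nu x r) := by
    rw [integral_sub (hF.integrable_nu x hr) (integrable_const a), mean]
    simp
  rw [this]
  exact enorm_integral_le_lintegral_enorm _

variable {H} in
lemma LocInt.osc_le_two_mul {F : X → ℂ} (hF : H.LocInt F) (x : X) {r : ℝ} (hr : 0 < r) (a : ℂ) :
    H.osc F x r ≤ 2 * ∫⁻ y, ‖F y - a‖ₑ ∂(H.nu x r) := by
  have := H.isProbabilityMeasure_nu x hr
  calc H.osc F x r ≤ ∫⁻ y, (‖F y - a‖ₑ + ‖a - H.mean F x r‖ₑ) ∂(H.nu x r) := by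
        refine lintegral_mono fun y => ?_
        rw [← sub_add_sub_cancel (F y) a]
        exact enorm_add_le _ _
    _ = (∫⁻ y, ‖F y - a‖ₑ ∂(H.nu x r)) + ‖a - H.mean F x r‖ₑ := by
        rw [lintegral_add_right _ measurable_const, lintegral_const, measure_univ, mul_one]
    _ ≤ _ := by
        rw [two_mul, ← enorm_neg, neg_sub]
        gcongr
        exact hF.enorm_mean_sub_le x hr a

/-- If `φ` lies in some `L^q`, the balls through a given point over which its mean exceeds a given
positive level have bounded radii. -/
lemma exists_radius_le (hH : H.ReverseDoubling) {φ : X → ℝ≥0∞} (hφ : AEMeasurable φ μ) {q : ℝ}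
    (hq : 1 ≤ q) (hfin : ∫⁻ x, φ x ^ q ∂μ ≠ ∞) {t : ℝ≥0∞} (ht : t ≠ 0) (ht' : t ≠ ∞) (x : X) :
    ∃ R, ∀ y r, 0 < r → x ∈ H.ball y r → t < ∫⁻ z, φ z ∂(H.nu y r) → r ≤ R := by
  have hq0 : 0 ≤ q := by linarith
  set V : ℝ≥0∞ := (∫⁻ x, φ x ^ q ∂μ) / t ^ q + 1
  have hV : V ≠ ∞ := ENNReal.add_ne_top.2 ⟨ENNReal.div_ne_top hfin
    (by simp [ENNReal.rpow_eq_zero_iff, ht, ht']), by simp⟩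
  obtain ⟨R, -, hR⟩ := H.exists_le_measure_ball_of_mem hH x hV
  refine ⟨R, fun y r hr hx h => ?_⟩
  by_contra! hRr
  have h1 := hR y r hRr.le hx
  have := H.isProbabilityMeasure_nu y hr
  have h2 : t ^ q * μ (H.ball y r) ≤ ∫⁻ x, φ x ^ q ∂μ := by
    calc t ^ q * μ (H.ball y r) ≤ (∫⁻ z, φ z ∂(H.nu y r)) ^ q * μ (H.ball y r) := by gcongr
      _ ≤ (∫⁻ z, φ z ^ q ∂(H.nu y r)) * μ (H.ball y r) := by
        gcongr
        exact lintegral_rpow_le_of_isProbabilityMeasure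
          (hφ.mono_ac (H.nu_absolutelyContinuous y r)) hq
      _ = ∫⁻ z in H.ball y r, φ z ^ q ∂μ := by rw [H.setLIntegral_ball y hr, mul_comm]
      _ ≤ _ := setLIntegral_le_lintegral _ _
  have h3 : μ (H.ball y r) ≤ (∫⁻ x, φ x ^ q ∂μ) / t ^ q := by
    rw [ENNReal.le_div_iff_mul_le (Or.inl (by simp [ENNReal.rpow_eq_zero_iff, ht, ht']))
      (Or.inl (ENNReal.rpow_ne_top_of_nonneg hq0 ht')), mul_comm]
    exact h2
  exact absurd (h1.trans h3) (not_le.2 (ENNReal.lt_add_right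
    (fun h => hV (by simp [V, h])) one_ne_zero))

/-- Stopping time argument: a compact subset of `{Mφ > t}` is covered by dilates of disjoint balls
over which the mean of `φ` exceeds `t`, while it is at most `t` over all larger concentric balls. -/
lemma exists_stopping_cover {φ : X → ℝ≥0∞} {t : ℝ≥0∞}
    (hbig : ∀ x, ∃ R, ∀ y r, 0 < r → x ∈ H.ball y r → t < ∫⁻ z, φ z ∂(H.nu y r) → r ≤ R)
    {s : Set X} (hs : IsCompact s) (hst : ∀ x ∈ s, t < H.maximal φ x) :
    ∃ u : Finset (X × ℝ), (∀ a ∈ u, 0 < a.2) ∧ (∀ a ∈ u, t < ∫⁻ z, φ z ∂(H.nu a.1 a.2)) ∧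
      (u : Set (X × ℝ)).PairwiseDisjoint (fun a => H.ball a.1 a.2) ∧
      s ⊆ ⋃ a ∈ u, H.ball a.1 (H.c ^ 2 * a.2) ∧
      ∀ a ∈ u, ∀ r, H.c * a.2 ≤ r → ∫⁻ z, φ z ∂(H.nu a.1 r) ≤ t := by
  obtain ⟨u, huA, hdis, hcov⟩ := H.exists_disjoint_cover hs
    (A := {a | 0 < a.2 ∧ t < ∫⁻ z, φ z ∂(H.nu a.1 a.2) ∧
      ∀ r, H.c * a.2 ≤ r → ∫⁻ z, φ z ∂(H.nu a.1 r) ≤ t}) (fun a ha => ha.1) (by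
      intro x hx
      obtain ⟨R, hR⟩ := hbig x
      set S : Set ℝ := {r | ∃ y, 0 < r ∧ x ∈ H.ball y r ∧ t < ∫⁻ z, φ z ∂(H.nu y r)} with hS
      have hSb : BddAbove S := ⟨R, fun r ⟨y, h1, h2, h3⟩ => hR y r h1 h2 h3⟩
      obtain ⟨y, r, hr, hxy, h⟩ := H.lt_maximal_iff.1 (hst x hx)
      have hrS : r ∈ S := ⟨y, hr, hxy, h⟩
      have hpos : 0 < sSup S := hr.trans_le (le_csSup hSb hrS)
      obtain ⟨r', ⟨y', hr', hxy', h'⟩, hlt⟩ := exists_lt_of_lt_csSup ⟨r, hrS⟩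
        (div_lt_self hpos H.one_lt_c)
      refine Set.mem_iUnion₂.2 ⟨(y', r'), ⟨hr', h', fun ρ hρ => ?_⟩, hxy'⟩
      by_contra! hcon
      have hρr : r' ≤ ρ := (le_mul_of_one_le_left hr'.le H.one_lt_c.le).trans hρ
      have hρS : ρ ∈ S := ⟨y', hr'.trans_le hρr, H.ball_mono y' r' ρ hr' hρr hxy', hcon⟩
      have h1 := le_csSup hSb hρS
      rw [div_lt_iff₀ H.c_pos] at hlt
      dsimp only at hρ
      linarith [mul_comm r' H.c])
  exact ⟨u, fun a ha => (huA ha).1, fun a ha => (huA ha).2.1, hdis, hcov,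
    fun a ha => (huA ha).2.2⟩

/-- To bound the measure of a set it is enough to bound the measures of its compact subsets which
avoid a given null set. -/
lemma measure_le_of_forall_isCompact [BorelSpace X] [μ.Regular] [T2Space X] {E : Set X}
    (hE : NullMeasurableSet E μ) {P : X → Prop} (hP : ∀ᵐ x ∂μ, P x) {V : ℝ≥0∞}
    (h : ∀ s ⊆ E, IsCompact s → (∀ x ∈ s, P x) → μ s ≤ V) (H : HomogeneousStructure μ) :
    μ E ≤ V := by
  have := H.sigmaFinite
  obtain ⟨E', hE'E, hE'm, hE'⟩ := (hE.inter (NullMeasurableSet.of_compl (s := {x | P x})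
    (NullMeasurableSet.of_null hP))).exists_measurable_subset_ae_eq
  have h1 : μ E = μ E' := by
    rw [measure_congr hE']
    refine measure_congr ?_
    filter_upwards [hP] with x hx
    exact propext ⟨fun h => ⟨h, hx⟩, fun h => h.1⟩
  rw [h1, hE'm.measure_eq_iSup_isCompact]
  exact iSup_le fun s => iSup_le fun hs => iSup_le fun hsc =>
    h s (fun x hx => (hE'E (hs hx)).1) hsc fun x hx => (hE'E (hs hx)).2

/-- The good-`λ` inequality between the maximal function and the sharp maximal function. -/
lemma measure_goodLambda_le [BorelSpace X] [μ.Regular] [T2Space X] {F : X → ℂ} (hF : H.LocInt F)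
    {t γ : ℝ≥0∞} (ht : t ≠ 0) (ht' : t ≠ ∞)
    (hbig : ∀ x, ∃ R, ∀ y r, 0 < r → x ∈ H.ball y r → t < ∫⁻ z, ‖F z‖ₑ ∂(H.nu y r) → r ≤ R) :
    μ {x | (H.doublingConst ^ 2 + 1) * t < H.maximal (fun y => ‖F y‖ₑ) x ∧ H.sharp F x ≤ γ * t} ≤
      H.doublingConst ^ 3 * γ * μ {x | t < H.maximal (fun y => ‖F y‖ₑ) x} := by
  set φ : X → ℝ≥0∞ := fun y => ‖F y‖ₑ with hφ
  set K := H.doublingConst with hK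
  have hc := H.c_pos
  have hc1 := H.one_lt_c.le
  have hK0 : K ^ 2 ≠ 0 := pow_ne_zero _ H.doublingConst_ne_zero
  have hKt : K ^ 2 ≠ ∞ := ENNReal.pow_ne_top H.doublingConst_ne_top
  have hm : MeasurableSet {x | (K ^ 2 + 1) * t < H.maximal φ x ∧ H.sharp F x ≤ γ * t} :=
    (measurableSet_lt measurable_const (H.measurable_maximal φ)).inter
      (measurableSet_le (H.measurable_sharp F) measurable_const)
  refine measure_le_of_forall_isCompact hm.nullMeasurableSet (P := fun _ => True)
    (Eventually.of_forall fun _ => trivial) (fun s hs hsc _ => ?_) H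
  obtain ⟨u, hu0, hut, hdis, hcov, hlarge⟩ := H.exists_stopping_cover hbig hsc (fun x hx => by
    refine lt_of_le_of_lt ?_ (hs hx).1
    exact le_mul_of_one_le_left zero_le le_add_self)
  have hball : ∀ a ∈ u, t * μ (s ∩ H.ball a.1 (H.c ^ 2 * a.2)) ≤
      t * (K ^ 3 * γ * μ (H.ball a.1 a.2)) := by
    intro a ha
    have ha0 := hu0 a ha
    have hc2 : 0 < H.c ^ 2 * a.2 := mul_pos (H.c_pow_pos 2) ha0
    have hc3 : 0 < H.c ^ 3 * a.2 := mul_pos (H.c_pow_pos 3) ha0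
    rcases (s ∩ H.ball a.1 (H.c ^ 2 * a.2)).eq_empty_or_nonempty with hemp | ⟨z, hzs, hzB⟩
    · simp [hemp]
    set Q := H.ball a.1 (H.c ^ 3 * a.2) with hQ
    set m := H.mean F a.1 (H.c ^ 3 * a.2) with hm
    -- `Q` is a ball about the centre of a stopping ball and larger than it, so its means are small
    have hm_le : ‖m‖ₑ ≤ t := by
      have := hF.enorm_mean_sub_le a.1 hc3 0
      simp only [sub_zero] at this
      refine this.trans (hlarge a ha _ ?_)
      have : H.c ≤ H.c ^ 3 := le_self_pow₀ hc1 (by norm_num)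
      gcongr
    -- the localized oscillation, to which the weak type inequality is applied
    set ψ : X → ℝ≥0∞ := Q.indicator fun y => ‖F y - m‖ₑ with hψ
    have hsub : s ∩ H.ball a.1 (H.c ^ 2 * a.2) ⊆ {x | K ^ 2 * t < H.maximal ψ x} := by
      rintro x ⟨hxs, hxB⟩
      obtain ⟨y, r, hr, hxy, hlt⟩ := H.lt_maximal_iff.1 (hs hxs).1
      have hr2 : r < H.c ^ 2 * a.2 := by
        by_contra! hcon
        -- a larger ball would be comparable to a ball centred at `a.1` with small mean
        have hxa : x ∈ H.ball a.1 r := H.ball_mono _ _ _ hc2 hcon hxB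
        have h1 : H.ball y r ⊆ H.ball a.1 (H.c * r) := H.engulfing _ _ _ _ hr le_rfl ⟨x, hxa, hxy⟩
        have h2 : H.ball a.1 r ⊆ H.ball y (H.c * r) := H.engulfing _ _ _ _ hr le_rfl ⟨x, hxy, hxa⟩
        have h3 : μ (H.ball a.1 (H.c * r)) ≤ K ^ 2 * μ (H.ball y r) :=
          calc _ ≤ K * μ (H.ball a.1 r) := H.doubling _ _ hr
            _ ≤ K * (K * μ (H.ball y r)) := by
              gcongr
              exact (measure_mono h2).trans (H.doubling _ _ hr)
            _ = _ := by ring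
        have h4 := H.lintegral_nu_le_of_subset hr (mul_pos hc hr) h1 h3 φ
        have h5 : ∫⁻ z, φ z ∂(H.nu a.1 (H.c * r)) ≤ t := by
          refine hlarge a ha _ ?_
          have : a.2 ≤ H.c ^ 2 * a.2 := le_mul_of_one_le_left ha0.le (H.one_le_c_pow 2)
          gcongr
          exact this.trans hcon
        refine absurd hlt (not_lt.2 ?_)
        calc _ ≤ K ^ 2 * t := h4.trans (by gcongr)
          _ ≤ _ := by gcongr; exact le_self_add
      have hyQ : H.ball y r ⊆ Q := by
        have := H.engulfing a.1 y (H.c ^ 2 * a.2) r hr hr2.le ⟨x, hxB, hxy⟩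
        rwa [← mul_assoc, ← pow_succ'] at this
      refine H.lt_maximal_iff.2 ⟨y, r, hr, hxy, ?_⟩
      have := H.isProbabilityMeasure_nu y hr
      have h6 : ∫⁻ z, φ z ∂(H.nu y r) ≤ ∫⁻ z, ψ z ∂(H.nu y r) + t := by
        calc ∫⁻ z, φ z ∂(H.nu y r) ≤ ∫⁻ z, (ψ z + t) ∂(H.nu y r) := by
              rw [lintegral_nu, lintegral_nu]
              refine mul_le_mul' le_rfl (setLIntegral_mono' (H.measurableSet_ball y hr) ?_)
              intro z hz
              rw [hψ, Set.indicator_of_mem (hyQ hz)]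
              calc φ z = ‖(F z - m) + m‖ₑ := by simp [hφ]
                _ ≤ ‖F z - m‖ₑ + ‖m‖ₑ := enorm_add_le _ _
                _ ≤ _ := by gcongr
          _ = _ := by
              rw [lintegral_add_right _ measurable_const, lintegral_const, measure_univ, mul_one]
      have h7 := hlt.trans_le h6
      rw [add_mul, one_mul] at h7
      exact lt_of_add_lt_add_right h7
    have hint : ∫⁻ x, ψ x ∂μ ≤ K ^ 3 * μ (H.ball a.1 a.2) * (γ * t) := by
      rw [hψ, lintegral_indicator (H.measurableSet_ball _ hc3), H.setLIntegral_ball _ hc3]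
      refine mul_le_mul' (H.measure_ball_pow_le _ ha0 3) ?_
      refine (H.osc_le_sharp F hc3 ?_).trans (hs hzs).2
      refine H.ball_mono _ _ _ hc2 ?_ hzB
      gcongr
      norm_num
    have hw : K ^ 2 * (t * μ (s ∩ H.ball a.1 (H.c ^ 2 * a.2))) ≤
        K ^ 2 * (t * (K ^ 3 * γ * μ (H.ball a.1 a.2))) := by
      calc _ = K ^ 2 * t * μ (s ∩ H.ball a.1 (H.c ^ 2 * a.2)) := by ring
        _ ≤ K ^ 2 * t * μ {x | K ^ 2 * t < H.maximal ψ x} := by gcongr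
        _ ≤ K ^ 2 * ∫⁻ x, ψ x ∂μ := H.mul_measure_lt_maximal_le _ _
        _ ≤ K ^ 2 * (K ^ 3 * μ (H.ball a.1 a.2) * (γ * t)) := by gcongr
        _ = _ := by ring
    exact (ENNReal.mul_le_mul_iff_right hK0 hKt).1 hw
  have hball' : ∀ a ∈ u, μ (s ∩ H.ball a.1 (H.c ^ 2 * a.2)) ≤ K ^ 3 * γ * μ (H.ball a.1 a.2) :=
    fun a ha => (ENNReal.mul_le_mul_iff_right ht ht').1 (hball a ha)
  calc μ s = μ (⋃ a ∈ u, s ∩ H.ball a.1 (H.c ^ 2 * a.2)) := by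
        rw [← Set.inter_iUnion₂, Set.inter_eq_left.2 hcov]
    _ ≤ ∑ a ∈ u, μ (s ∩ H.ball a.1 (H.c ^ 2 * a.2)) := measure_biUnion_finset_le _ _
    _ ≤ ∑ a ∈ u, K ^ 3 * γ * μ (H.ball a.1 a.2) := Finset.sum_le_sum hball'
    _ = K ^ 3 * γ * ∑ a ∈ u, ∫⁻ _ in H.ball a.1 a.2, 1 ∂μ := by
        rw [← Finset.mul_sum]; simp
    _ ≤ K ^ 3 * γ * ∫⁻ _ in {x | t < H.maximal φ x}, 1 ∂μ := by
        gcongr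
        refine H.sum_measure_le_of_pairwiseDisjoint hu0 hdis _ fun a ha x hx => ?_
        exact (hut a ha).trans_le (H.le_maximal φ (hu0 a ha) hx)
    _ = _ := by simp

end Sharp

section FeffermanStein

variable {X : Type*} [TopologicalSpace X] [MeasurableSpace X] {μ : Measure X}
  (H : HomogeneousStructure μ)

/-- The **Fefferman–Stein inequality**: in `L^q` the sharp maximal function controls the maximal
function, for functions which are known to lie in some `L^s`, `1 < s ≤ q`. -/
lemma lintegral_maximal_rpow_le_sharp [T2Space X] [BorelSpace X] [μ.Regular]
    (hH : H.ReverseDoubling) {q : ℝ} (hq : 0 < q) :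
    ∃ C : ℝ≥0, ∀ F : X → ℂ, H.LocInt F → ∀ s : ℝ, 1 < s → s ≤ q →
      ∫⁻ x, ‖F x‖ₑ ^ s ∂μ ≠ ∞ →
        ∫⁻ x, H.maximal (fun y => ‖F y‖ₑ) x ^ q ∂μ ≤ C * ∫⁻ x, H.sharp F x ^ q ∂μ := by
  have := H.sigmaFinite
  set K := H.doublingConst with hK
  have hK0 : K ≠ 0 := H.doublingConst_ne_zero
  have hKt : K ≠ ∞ := H.doublingConst_ne_top
  set a : ℝ≥0∞ := K ^ 2 + 1 with ha
  have ha0 : a ≠ 0 := by simp [ha]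
  have hat : a ≠ ∞ := by simp [ha, hKt]
  have ha1 : 1 ≤ a := le_add_self
  have haq0 : a ^ q ≠ 0 := by simp [ENNReal.rpow_eq_zero_iff, ha0, hat]
  have haqt : a ^ q ≠ ∞ := ENNReal.rpow_ne_top_of_nonneg hq.le hat
  -- the small parameter of the good-`λ` inequality, chosen so that the first term is absorbed
  set γ : ℝ≥0∞ := (2 * (a ^ q * K ^ 3))⁻¹ with hγ
  have hd0 : 2 * (a ^ q * K ^ 3) ≠ 0 := by simp [haq0, hK0]
  have hdt : 2 * (a ^ q * K ^ 3) ≠ ∞ :=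
    ENNReal.mul_ne_top (by simp) (ENNReal.mul_ne_top haqt (ENNReal.pow_ne_top hKt))
  have hγ0 : γ ≠ 0 := ENNReal.inv_ne_zero.2 hdt
  have hγt : γ ≠ ∞ := ENNReal.inv_ne_top.2 hd0
  have habs : 2 * (a ^ q * (K ^ 3 * γ)) = 1 := by
    rw [← mul_assoc (a ^ q), ← mul_assoc, hγ, ENNReal.mul_inv_cancel hd0 hdt]
  have hCt : 2 * (a ^ q * γ⁻¹ ^ q) ≠ ∞ := ENNReal.mul_ne_top (by simp) (ENNReal.mul_ne_top haqt
    (ENNReal.rpow_ne_top_of_nonneg hq.le (ENNReal.inv_ne_top.2 hγ0)))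
  refine ⟨(2 * (a ^ q * γ⁻¹ ^ q)).toNNReal, fun F hF s hs hsq hfin => ?_⟩
  rw [ENNReal.coe_toNNReal hCt]
  set φ : X → ℝ≥0∞ := fun y => ‖F y‖ₑ with hφ
  have hφm : AEMeasurable φ μ := hF.aestronglyMeasurable.enorm
  set g := H.maximal φ with hg
  have hgm : Measurable g := H.measurable_maximal φ
  set S := ∫⁻ x, H.sharp F x ^ q ∂μ with hS
  have hgs : ∫⁻ x, g x ^ s ∂μ ≠ ∞ := by
    obtain ⟨C, hC⟩ := H.lintegral_maximal_rpow_le hs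
    exact ((hC φ hφm).trans_lt (ENNReal.mul_lt_top (by simp) hfin.lt_top)).ne
  -- the truncation at height `N` makes the left side finite, so that half of it can be absorbed
  have key : ∀ N : ℕ, ∫⁻ x, min (g x) N ^ q ∂μ ≤ 2 * (a ^ q * γ⁻¹ ^ q) * S := by
    intro N
    set Φ := ∫⁻ x, min (g x) N ^ q ∂μ with hΦ
    have hΦt : Φ ≠ ∞ := by
      have h1 : Φ ≤ ∫⁻ x, (N : ℝ≥0∞) ^ (q - s) * g x ^ s ∂μ := by
        refine lintegral_mono fun x => ?_
        calc min (g x) N ^ q = min (g x) N ^ (q - s) * min (g x) N ^ s := by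
              rw [← ENNReal.rpow_add_of_nonneg _ _ (by linarith) (by linarith), sub_add_cancel]
          _ ≤ _ := mul_le_mul' (ENNReal.rpow_le_rpow (min_le_right _ _) (by linarith))
              (ENNReal.rpow_le_rpow (min_le_left _ _) (by linarith))
      rw [lintegral_const_mul' _ _ (ENNReal.rpow_ne_top_of_nonneg (by linarith) (by simp))] at h1
      exact (h1.trans_lt (ENNReal.mul_lt_top (ENNReal.rpow_lt_top_of_nonneg (by linarith)
        (by simp)) hgs.lt_top)).ne
    have h1 : Φ ≤ a ^ q * ∫⁻ x, min (g x / a) N ^ q ∂μ := by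
      rw [← lintegral_const_mul' _ _ haqt]
      refine lintegral_mono fun x => ?_
      rw [← ENNReal.mul_rpow_of_nonneg _ _ hq.le]
      gcongr
      rw [mul_min, ENNReal.mul_div_cancel ha0 hat]
      exact min_le_min le_rfl (le_mul_of_one_le_left zero_le ha1)
    have h2 : ∫⁻ x, min (g x / a) N ^ q ∂μ ≤ K ^ 3 * γ * Φ + γ⁻¹ ^ q * S := by
      have hm1 : Measurable fun x => min (g x) (N : ℝ≥0∞) := hgm.min measurable_const
      have hm2 : Measurable fun x => min (g x / a) (N : ℝ≥0∞) :=
        (hgm.div_const a).min measurable_const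
      have hm3 : Measurable fun x => γ⁻¹ * H.sharp F x := (H.measurable_sharp F).const_mul _
      have e3 : γ⁻¹ ^ q * S = ∫⁻ x, (γ⁻¹ * H.sharp F x) ^ q ∂μ := by
        rw [hS, ← lintegral_const_mul' _ _
          (ENNReal.rpow_ne_top_of_nonneg hq.le (ENNReal.inv_ne_top.2 hγ0))]
        simp_rw [ENNReal.mul_rpow_of_nonneg _ _ hq.le]
      rw [e3, hΦ, lintegral_rpow_eq_lintegral_Ioi hm1 hq, lintegral_rpow_eq_lintegral_Ioi hm2 hq,
        lintegral_rpow_eq_lintegral_Ioi hm3 hq, ← lintegral_const_mul' _ _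
          (ENNReal.mul_ne_top (ENNReal.pow_ne_top hKt) hγt)]
      have hmeas : Measurable fun t : ℝ => μ {x | ENNReal.ofReal t < min (g x) (N : ℝ≥0∞)} :=
        Antitone.measurable fun t t' h => measure_mono fun x hx =>
          (ENNReal.ofReal_le_ofReal h).trans_lt hx
      have hmeas' : Measurable fun t : ℝ => K ^ 3 * γ * (ENNReal.ofReal (q * t ^ (q - 1)) *
          μ {x | ENNReal.ofReal t < min (g x) (N : ℝ≥0∞)}) := by
        refine Measurable.const_mul (Measurable.mul ?_ hmeas) _
        fun_prop
      rw [← lintegral_add_left hmeas']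
      refine setLIntegral_mono' measurableSet_Ioi fun t ht => ?_
      replace ht : 0 < t := ht
      rw [mul_left_comm, ← mul_add]
      refine mul_le_mul' le_rfl ?_
      set τ := ENNReal.ofReal t with hτ
      have hτ0 : τ ≠ 0 := by simpa [hτ] using ht
      have hτt : τ ≠ ∞ := ENNReal.ofReal_ne_top
      by_cases hN : τ < N
      · have hsub : {x | τ < min (g x / a) (N : ℝ≥0∞)} ⊆
            {x | a * τ < g x ∧ H.sharp F x ≤ γ * τ} ∪ {x | τ < γ⁻¹ * H.sharp F x} := by
          intro x hx
          have hx1 : τ < g x / a := (lt_min_iff.1 hx).1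
          rw [ENNReal.lt_div_iff_mul_lt (Or.inl ha0) (Or.inl hat), mul_comm] at hx1
          by_cases hxs : H.sharp F x ≤ γ * τ
          · exact Or.inl ⟨hx1, hxs⟩
          · refine Or.inr ?_
            rw [Set.mem_ofPred_eq, mul_comm, ← div_eq_mul_inv,
              ENNReal.lt_div_iff_mul_lt (Or.inl hγ0) (Or.inl hγt), mul_comm]
            exact not_le.1 hxs
        have hmin : {x | τ < min (g x) (N : ℝ≥0∞)} = {x | τ < g x} := by
          ext x; simp [hN]
        rw [hmin]
        refine (measure_mono hsub).trans ((measure_union_le _ _).trans ?_)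
        gcongr
        exact H.measure_goodLambda_le hF hτ0 hτt
          (H.exists_radius_le hH hφm hs.le hfin hτ0 hτt)
      · have : {x | τ < min (g x / a) (N : ℝ≥0∞)} = ∅ := by
          ext x; simp [hN]
        rw [this, measure_empty]
        exact zero_le
    have h3 : Φ ≤ a ^ q * (K ^ 3 * γ) * Φ + a ^ q * γ⁻¹ ^ q * S := by
      refine h1.trans ?_
      calc _ ≤ a ^ q * (K ^ 3 * γ * Φ + γ⁻¹ ^ q * S) := by gcongr
        _ = _ := by ring
    have h4 : Φ + Φ ≤ Φ + 2 * (a ^ q * γ⁻¹ ^ q) * S := by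
      calc Φ + Φ = 2 * Φ := (two_mul _).symm
        _ ≤ 2 * (a ^ q * (K ^ 3 * γ) * Φ + a ^ q * γ⁻¹ ^ q * S) := by gcongr
        _ = 2 * (a ^ q * (K ^ 3 * γ)) * Φ + 2 * (a ^ q * γ⁻¹ ^ q) * S := by ring
        _ = _ := by rw [habs, one_mul]
    exact (ENNReal.add_le_add_iff_left hΦt).1 h4
  have hmono : ∫⁻ x, g x ^ q ∂μ = ⨆ N : ℕ, ∫⁻ x, min (g x) N ^ q ∂μ := by
    rw [← lintegral_iSup]
    · refine lintegral_congr fun x => ?_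
      refine le_antisymm ?_ (iSup_le fun N => by gcongr; exact min_le_left _ _)
      have hlim : Tendsto (fun N : ℕ => min (g x) (N : ℝ≥0∞) ^ q) atTop (𝓝 (g x ^ q)) := by
        have h1 : Tendsto (fun N : ℕ => min (g x) (N : ℝ≥0∞)) atTop (𝓝 (min (g x) ∞)) :=
          tendsto_const_nhds.min ENNReal.tendsto_nat_nhds_top
        rw [min_eq_left le_top] at h1
        exact (ENNReal.continuous_rpow_const.tendsto _).comp h1
      exact le_of_tendsto' hlim fun N => le_iSup (fun N : ℕ => min (g x) (N : ℝ≥0∞) ^ q) N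
    · exact fun N => (hgm.min measurable_const).pow_const q
    · intro M N hMN x
      dsimp only
      gcongr
  rw [hmono]
  exact iSup_le key

/-- The Fefferman–Stein inequality in terms of `L^q` norms. -/
lemma lintegral_rpow_le_sharp [T2Space X] [BorelSpace X] [μ.Regular]
    (hH : H.ReverseDoubling) {q : ℝ} (hq : 0 < q) :
    ∃ C : ℝ≥0, ∀ F : X → ℂ, H.LocInt F → ∀ s : ℝ, 1 < s → s ≤ q →
      ∫⁻ x, ‖F x‖ₑ ^ s ∂μ ≠ ∞ → ∫⁻ x, ‖F x‖ₑ ^ q ∂μ ≤ C * ∫⁻ x, H.sharp F x ^ q ∂μ := by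
  obtain ⟨C, hC⟩ := H.lintegral_maximal_rpow_le_sharp hH hq
  refine ⟨C, fun F hF s hs hsq hfin => le_trans (lintegral_mono_ae ?_) (hC F hF s hs hsq hfin)⟩
  filter_upwards [H.ae_le_maximal hF.aestronglyMeasurable.enorm] with x hx
  gcongr

end FeffermanStein

/-! ### The John–Nirenberg inequality -/

section JohnNirenberg

variable {X : Type*} [TopologicalSpace X] [MeasurableSpace X] {μ : Measure X}
  (H : HomogeneousStructure μ)

/-- The **John–Nirenberg inequality**. The proof is an induction on `n`, for all balls at once: the
points of a ball where `b` is far from its mean are covered by stopping balls, which have a small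
total measure and means close to that of the original ball. -/
lemma exists_johnNirenberg [T2Space X] [BorelSpace X] [μ.Regular] (hH : H.ReverseDoubling) :
    ∃ L : ℝ≥0∞, L ≠ 0 ∧ L ≠ ∞ ∧ ∀ b : X → ℂ, H.LocInt b → ∀ β : ℝ≥0∞, β ≠ 0 → β ≠ ∞ →
      (∀ x r, 0 < r → H.osc b x r ≤ β) → ∀ (n : ℕ) (x : X) (r : ℝ), 0 < r →
        μ {y ∈ H.ball x r | n * (L * β) < ‖b y - H.mean b x r‖ₑ} ≤ 2⁻¹ ^ n * μ (H.ball x r) := by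
  set K := H.doublingConst with hK
  have hK0 : K ≠ 0 := H.doublingConst_ne_zero
  have hKt : K ≠ ∞ := H.doublingConst_ne_top
  have hK1 : 1 ≤ K := H.one_le_doublingConst
  have hc := H.c_pos
  have hc1 := H.one_lt_c.le
  set D : ℝ≥0∞ := K * (1 + K) with hD
  have hD0 : D ≠ 0 := by simp [hD, hK0]
  have hDt : D ≠ ∞ := ENNReal.mul_ne_top hKt (by simp [hKt])
  have hL0 : 2 * K ^ 3 * D ≠ 0 := by simp [hK0, hD0]
  have hLt : 2 * K ^ 3 * D ≠ ∞ :=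
    ENNReal.mul_ne_top (ENNReal.mul_ne_top (by simp) (ENNReal.pow_ne_top hKt)) hDt
  refine ⟨2 * K ^ 3 * D, hL0, hLt, fun b hb β hβ0 hβt hosc n => ?_⟩
  set t := 2 * K ^ 3 * D * β with ht
  have ht0 : t ≠ 0 := mul_ne_zero hL0 hβ0
  have htt : t ≠ ∞ := ENNReal.mul_ne_top hLt hβt
  have hbm := hb.aestronglyMeasurable
  induction n with
  | zero =>
    intro x r hr
    simpa using measure_mono (μ := μ) (Set.sep_subset (H.ball x r) _)
  | succ n ih =>
  intro x₀ r₀ hr₀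
  set m₀ := H.mean b x₀ r₀ with hm₀
  have hcr : 0 < H.c * r₀ := mul_pos hc hr₀
  set φ : X → ℝ≥0∞ := (H.ball x₀ (H.c * r₀)).indicator fun y => ‖b y - m₀‖ₑ with hφ
  have hφm : AEMeasurable φ μ :=
    ((hbm.sub aestronglyMeasurable_const).enorm).indicator (H.measurableSet_ball _ hcr)
  have hsub : H.ball x₀ r₀ ⊆ H.ball x₀ (H.c * r₀) := H.ball_subset_mul _ hr₀ hc1
  have hφint : ∫⁻ y, φ y ∂μ ≤ D * β * μ (H.ball x₀ r₀) := by
    have := H.isProbabilityMeasure_nu x₀ hcr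
    rw [hφ, lintegral_indicator (H.measurableSet_ball _ hcr), H.setLIntegral_ball _ hcr]
    have h1 : ‖H.mean b x₀ (H.c * r₀) - m₀‖ₑ ≤ K * β := by
      rw [← enorm_neg, neg_sub]
      refine (hb.enorm_mean_sub_le x₀ hr₀ _).trans ?_
      refine (H.lintegral_nu_le_of_subset hr₀ hcr hsub (H.doubling x₀ r₀ hr₀) _).trans ?_
      exact mul_le_mul' le_rfl (hosc x₀ _ hcr)
    have h2 : ∫⁻ y, ‖b y - m₀‖ₑ ∂(H.nu x₀ (H.c * r₀)) ≤ β + K * β := by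
      calc _ ≤ ∫⁻ y, (‖b y - H.mean b x₀ (H.c * r₀)‖ₑ + K * β) ∂(H.nu x₀ (H.c * r₀)) := by
            refine lintegral_mono fun y => ?_
            rw [← sub_add_sub_cancel (b y) (H.mean b x₀ (H.c * r₀))]
            exact (enorm_add_le _ _).trans (by gcongr)
        _ ≤ _ := by
            rw [lintegral_add_right _ measurable_const, lintegral_const, measure_univ, mul_one]
            exact add_le_add (hosc x₀ _ hcr) le_rfl
    calc _ ≤ K * μ (H.ball x₀ r₀) * (β + K * β) := mul_le_mul' (H.doubling x₀ r₀ hr₀) h2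
      _ = _ := by rw [hD]; ring
  have hEm : NullMeasurableSet {y ∈ H.ball x₀ r₀ | (n + 1 : ℕ) * t < ‖b y - m₀‖ₑ} μ :=
    (H.measurableSet_ball x₀ hr₀).nullMeasurableSet.inter
      (nullMeasurableSet_lt aemeasurable_const (hbm.sub aestronglyMeasurable_const).enorm)
  refine measure_le_of_forall_isCompact hEm (H.ae_le_maximal hφm) (fun s hs hsc hsM => ?_) H
  obtain ⟨u, hu0, hut, hdis, hcov, hlarge⟩ := H.exists_stopping_cover (φ := φ) (t := t)
    (H.exists_radius_le hH hφm le_rfl (by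
      simp only [ENNReal.rpow_one]
      exact (hφint.trans_lt (ENNReal.mul_lt_top (ENNReal.mul_lt_top hDt.lt_top hβt.lt_top)
        (H.measure_ball_lt_top _ _ hr₀))).ne) ht0 htt) hsc (fun x hx => by
      refine lt_of_lt_of_le ?_ (hsM x hx)
      rw [hφ, Set.indicator_of_mem (hsub (hs hx).1)]
      refine lt_of_le_of_lt ?_ (hs hx).2
      exact le_mul_of_one_le_left zero_le (by simp))
  have hsum : t * ∑ a ∈ u, μ (H.ball a.1 a.2) ≤ D * β * μ (H.ball x₀ r₀) := by
    calc t * ∑ a ∈ u, μ (H.ball a.1 a.2) = ∑ a ∈ u, t * μ (H.ball a.1 a.2) := Finset.mul_sum _ _ _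
      _ ≤ ∑ a ∈ u, ∫⁻ y in H.ball a.1 a.2, φ y ∂μ := by
        refine Finset.sum_le_sum fun a ha => ?_
        rw [H.setLIntegral_ball _ (hu0 a ha), mul_comm]
        exact mul_le_mul' le_rfl (hut a ha).le
      _ ≤ ∫⁻ y in Set.univ, φ y ∂μ :=
        H.sum_measure_le_of_pairwiseDisjoint hu0 hdis φ (fun _ _ => Set.subset_univ _)
      _ ≤ _ := by rw [Measure.restrict_univ]; exact hφint
  have hDβ0 : D * β ≠ 0 := mul_ne_zero hD0 hβ0
  have hDβt : D * β ≠ ∞ := ENNReal.mul_ne_top hDt hβt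
  -- `t` is chosen so large that the dilated stopping balls fill at most half of the original ball
  have hsum' : 2 * K ^ 3 * ∑ a ∈ u, μ (H.ball a.1 a.2) ≤ μ (H.ball x₀ r₀) := by
    refine (ENNReal.mul_le_mul_iff_right hDβ0 hDβt).1 (le_trans (le_of_eq ?_) hsum)
    rw [ht]; ring
  have hball : ∀ a ∈ u, μ (s ∩ H.ball a.1 (H.c ^ 2 * a.2)) ≤
      2⁻¹ ^ n * (K ^ 2 * μ (H.ball a.1 a.2)) := by
    intro a ha
    have ha0 := hu0 a ha
    have hc2 : 0 < H.c ^ 2 * a.2 := mul_pos (H.c_pow_pos 2) ha0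
    rcases (s ∩ H.ball a.1 (H.c ^ 2 * a.2)).eq_empty_or_nonempty with hemp | ⟨z, hzs, hzB⟩
    · simp [hemp]
    have hzB₀ : z ∈ H.ball x₀ r₀ := (hs hzs).1
    have hle : H.c ^ 2 * a.2 ≤ r₀ := by
      by_contra! hcon
      -- otherwise the stopping ball would be at least as large as the original one
      have h1 := H.engulfing a.1 x₀ (H.c ^ 2 * a.2) r₀ hr₀ hcon.le ⟨z, hzB, hzB₀⟩
      rw [← mul_assoc, ← pow_succ'] at h1
      have h2 := (measure_mono h1).trans (H.measure_ball_pow_le a.1 ha0 3)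
      have h3 : μ (H.ball a.1 a.2) ≤ ∑ a ∈ u, μ (H.ball a.1 a.2) :=
        Finset.single_le_sum (f := fun a : X × ℝ => μ (H.ball a.1 a.2)) (fun _ _ => zero_le) ha
      have h4 : 2 * (K ^ 3 * μ (H.ball a.1 a.2)) ≤ K ^ 3 * μ (H.ball a.1 a.2) := by
        refine le_trans ?_ (hsum'.trans h2)
        rw [mul_assoc]
        gcongr
      have h5 : K ^ 3 * μ (H.ball a.1 a.2) ≠ 0 :=
        mul_ne_zero (pow_ne_zero _ hK0) (H.measure_ball_ne_zero ha0)
      have h6 : K ^ 3 * μ (H.ball a.1 a.2) ≠ ∞ :=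
        ENNReal.mul_ne_top (ENNReal.pow_ne_top hKt) (H.measure_ball_ne_top ha0)
      rw [two_mul] at h4
      exact absurd h4 (not_le.2 (ENNReal.lt_add_right h6 h5))
    have hsubQ : H.ball a.1 (H.c ^ 2 * a.2) ⊆ H.ball x₀ (H.c * r₀) :=
      H.engulfing x₀ a.1 r₀ _ hc2 hle ⟨z, hzB₀, hzB⟩
    have hmean : ‖H.mean b a.1 (H.c ^ 2 * a.2) - m₀‖ₑ ≤ t := by
      refine (hb.enorm_mean_sub_le a.1 hc2 m₀).trans (le_trans ?_ (hlarge a ha (H.c ^ 2 * a.2) ?_))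
      · rw [lintegral_nu, lintegral_nu]
        refine mul_le_mul' le_rfl (setLIntegral_mono' (H.measurableSet_ball _ hc2) fun y hy => ?_)
        rw [hφ, Set.indicator_of_mem (hsubQ hy)]
      · have : H.c ≤ H.c ^ 2 := le_self_pow₀ hc1 (by norm_num)
        gcongr
    calc μ (s ∩ H.ball a.1 (H.c ^ 2 * a.2))
        ≤ μ {y ∈ H.ball a.1 (H.c ^ 2 * a.2) | n * t <
          ‖b y - H.mean b a.1 (H.c ^ 2 * a.2)‖ₑ} := by
          refine measure_mono fun y hy => ⟨hy.2, ?_⟩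
          have h1 := (hs hy.1).2
          have h2 : ‖b y - m₀‖ₑ ≤ ‖b y - H.mean b a.1 (H.c ^ 2 * a.2)‖ₑ + t := by
            rw [← sub_add_sub_cancel (b y) (H.mean b a.1 (H.c ^ 2 * a.2))]
            exact (enorm_add_le _ _).trans (by gcongr)
          have h3 := h1.trans_le h2
          rw [Nat.cast_add, Nat.cast_one, add_mul, one_mul] at h3
          exact lt_of_add_lt_add_right h3
      _ ≤ 2⁻¹ ^ n * μ (H.ball a.1 (H.c ^ 2 * a.2)) := ih _ _ hc2
      _ ≤ _ := by
        gcongr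
        exact H.measure_ball_pow_le _ ha0 2
  calc μ s = μ (⋃ a ∈ u, s ∩ H.ball a.1 (H.c ^ 2 * a.2)) := by
        rw [← Set.inter_iUnion₂, Set.inter_eq_left.2 hcov]
    _ ≤ ∑ a ∈ u, μ (s ∩ H.ball a.1 (H.c ^ 2 * a.2)) := measure_biUnion_finset_le _ _
    _ ≤ ∑ a ∈ u, 2⁻¹ ^ n * (K ^ 2 * μ (H.ball a.1 a.2)) := Finset.sum_le_sum hball
    _ = 2⁻¹ ^ (n + 1) * (2 * K ^ 2 * ∑ a ∈ u, μ (H.ball a.1 a.2)) := by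
        rw [← Finset.mul_sum, ← Finset.mul_sum, pow_succ 2⁻¹ n,
          mul_assoc (2⁻¹ ^ n), mul_assoc 2, ← mul_assoc 2⁻¹ 2,
          ENNReal.inv_mul_cancel (by simp) (by simp), one_mul]
    _ ≤ 2⁻¹ ^ (n + 1) * μ (H.ball x₀ r₀) := by
        refine mul_le_mul' le_rfl (le_trans ?_ hsum')
        gcongr
        norm_num

lemma tsum_add_one_pow_mul_pow_ne_top {r : ℝ≥0∞} (hr : r < 1) (k : ℕ) :
    ∑' n : ℕ, ((n : ℝ≥0∞) + 1) ^ k * r ^ n ≠ ∞ := by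
  lift r to ℝ≥0 using (hr.trans ENNReal.one_lt_top).ne
  have hr1 : (r : ℝ) < 1 := by exact_mod_cast hr
  have h : Summable fun n : ℕ => ((n : ℝ≥0) + 1) ^ k * r ^ n := by
    rw [← NNReal.summable_coe]
    push_cast
    have h1 : Summable fun n : ℕ => (n : ℝ) ^ k * (r : ℝ) ^ n :=
      summable_pow_mul_geometric_of_norm_lt_one k (by simpa using hr1)
    have h2 : Summable fun n : ℕ => (r : ℝ) ^ n :=
      summable_geometric_of_lt_one r.2 hr1
    refine Summable.of_nonneg_of_le (fun n => by positivity) (fun n => ?_)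
      ((h1.add h2).mul_left (2 ^ k))
    rw [← add_one_mul, ← mul_assoc]
    gcongr
    rcases Nat.eq_zero_or_pos n with rfl | hn
    · simp only [Nat.cast_zero, zero_add, one_pow]
      have : (0 : ℝ) ≤ (0 : ℝ) ^ k := by positivity
      have : (1 : ℝ) ≤ 2 ^ k := one_le_pow₀ (by norm_num)
      nlinarith
    · have hn' : (1 : ℝ) ≤ n := by exact_mod_cast hn
      calc ((n : ℝ) + 1) ^ k ≤ (2 * n) ^ k := by gcongr; linarith
        _ = 2 ^ k * (n : ℝ) ^ k := mul_pow _ _ _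
        _ ≤ _ := by gcongr; linarith
  have := ENNReal.tsum_coe_ne_top_iff_summable.2 h
  simpa using this

/-- The `L^s` mean oscillation of a function is controlled by its `BMO` seminorm. -/
lemma exists_eLpNorm_sub_mean_le [T2Space X] [BorelSpace X] [μ.Regular] (hH : H.ReverseDoubling)
    {s : ℝ≥0∞} (hs : s ≠ ∞) :
    ∃ C : ℝ≥0, ∀ b : X → ℂ, H.LocInt b → ∀ β : ℝ≥0∞, β ≠ ∞ →
      (∀ x r, 0 < r → H.osc b x r ≤ β) →
      ∀ (x : X) (r : ℝ), 0 < r → eLpNorm (fun y => b y - H.mean b x r) s (H.nu x r) ≤ C * β := by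
  obtain ⟨L, hL0, hLt, hL⟩ := H.exists_johnNirenberg hH
  obtain ⟨k, hk⟩ := ENNReal.exists_nat_gt (r := max s 1) (by simp [hs])
  have hk1 : 1 < k := by exact_mod_cast (le_max_right s 1).trans_lt hk
  have hk0 : (k : ℝ) ≠ 0 := by positivity
  set A : ℝ≥0∞ := ∑' n : ℕ, ((n : ℝ≥0∞) + 1) ^ k * 2⁻¹ ^ n with hA
  have hAt : A ≠ ∞ := tsum_add_one_pow_mul_pow_ne_top (by simp) k
  have hCt : A ^ (1 / (k : ℝ)) * L ≠ ∞ :=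
    ENNReal.mul_ne_top (ENNReal.rpow_ne_top_of_nonneg (by positivity) hAt) hLt
  refine ⟨(A ^ (1 / (k : ℝ)) * L).toNNReal, fun b hb β hβt hosc x r hr => ?_⟩
  rw [ENNReal.coe_toNNReal hCt]
  have hprob := H.isProbabilityMeasure_nu x hr
  have hbm := hb.aestronglyMeasurable
  have hbm' : AEStronglyMeasurable (fun y => b y - H.mean b x r) (H.nu x r) :=
    (hbm.sub aestronglyMeasurable_const).mono_ac (H.nu_absolutelyContinuous x r)
  have main : ∀ β' : ℝ≥0∞, β ≤ β' → β' ≠ 0 → β' ≠ ∞ →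
      eLpNorm (fun y => b y - H.mean b x r) s (H.nu x r) ≤ A ^ (1 / (k : ℝ)) * L * β' := by
    intro β' hβ hβ0 hβt
    have hjn := hL b hb β' hβ0 hβt (fun x r hr => (hosc x r hr).trans hβ)
    set t := L * β' with ht
    have ht0 : t ≠ 0 := mul_ne_zero hL0 hβ0
    have htt : t ≠ ∞ := ENNReal.mul_ne_top hLt hβt
    refine (eLpNorm_le_eLpNorm_of_exponent_le ((le_max_left s 1).trans hk.le) hbm').trans ?_
    rw [eLpNorm_eq_lintegral_rpow_enorm_toReal (by simpa using (by omega : k ≠ 0)) (by simp)]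
    simp only [ENNReal.toReal_natCast, ENNReal.rpow_natCast]
    set v : X → ℝ≥0∞ := fun y => ‖b y - H.mean b x r‖ₑ with hv
    have hvm : AEMeasurable v (H.nu x r) := hbm'.enorm
    have hpt : ∀ y, v y ^ k ≤ ∑' n : ℕ, {y | n * t < v y}.indicator
        (fun _ => (((n : ℝ≥0∞) + 1) * t) ^ k) y := by
      intro y
      rcases eq_or_ne (v y) 0 with h0 | h0
      · rw [h0, zero_pow (by omega)]; exact zero_le
      have hex : ∃ n : ℕ, v y ≤ n * t := by
        obtain ⟨n, hn⟩ := ENNReal.exists_nat_mul_gt ht0 (by simp [hv] : v y ≠ ∞)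
        exact ⟨n, hn.le⟩
      classical
      have hn := Nat.find_spec hex
      obtain ⟨n, hn'⟩ : ∃ n, Nat.find hex = n + 1 := by
        refine Nat.exists_eq_succ_of_ne_zero fun h => h0 ?_
        rw [h] at hn
        simpa using hn
      have hlt : n * t < v y := not_le.1 (Nat.find_min hex (by omega))
      rw [hn'] at hn
      push_cast at hn
      refine le_trans ?_ (ENNReal.le_tsum n)
      rw [Set.indicator_of_mem (by exact hlt)]
      gcongr
    have hI : ∫⁻ y, v y ^ k ∂(H.nu x r) ≤ A * t ^ k := by
      calc ∫⁻ y, v y ^ k ∂(H.nu x r)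
          ≤ ∫⁻ y, ∑' n : ℕ, {y | n * t < v y}.indicator
            (fun _ => (((n : ℝ≥0∞) + 1) * t) ^ k) y ∂(H.nu x r) := lintegral_mono hpt
        _ = ∑' n : ℕ, ∫⁻ y, {y | n * t < v y}.indicator
            (fun _ => (((n : ℝ≥0∞) + 1) * t) ^ k) y ∂(H.nu x r) := by
            refine lintegral_tsum fun n => ?_
            exact aemeasurable_const.indicator₀ (nullMeasurableSet_lt aemeasurable_const hvm)
        _ ≤ ∑' n : ℕ, (((n : ℝ≥0∞) + 1) ^ k * 2⁻¹ ^ n) * t ^ k := by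
            refine ENNReal.tsum_le_tsum fun n => ?_
            rw [lintegral_indicator_const₀ (nullMeasurableSet_lt aemeasurable_const hvm), mul_pow,
              mul_right_comm]
            refine mul_le_mul' (mul_le_mul' le_rfl ?_) le_rfl
            rw [nu, Measure.smul_apply, smul_eq_mul,
              Measure.restrict_apply' (H.measurableSet_ball x hr), Set.inter_comm,
              ENNReal.inv_mul_le_iff (H.measure_ball_ne_zero hr) (H.measure_ball_ne_top hr)]
            exact (hjn n x r hr).trans_eq (mul_comm _ _)
        _ = A * t ^ k := ENNReal.tsum_mul_right
    calc (∫⁻ y, v y ^ k ∂(H.nu x r)) ^ (1 / (k : ℝ)) ≤ (A * t ^ k) ^ (1 / (k : ℝ)) := by gcongr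
      _ = A ^ (1 / (k : ℝ)) * t := by
          rw [ENNReal.mul_rpow_of_nonneg _ _ (by positivity), ← ENNReal.rpow_natCast t k,
            ← ENNReal.rpow_mul, mul_one_div_cancel hk0, ENNReal.rpow_one]
      _ = _ := by rw [ht, mul_assoc]
  -- `β` may vanish, and is approximated by positive numbers
  have hlim : Tendsto (fun n : ℕ => A ^ (1 / (k : ℝ)) * L * (β + (n : ℝ≥0∞)⁻¹)) atTop
      (𝓝 (A ^ (1 / (k : ℝ)) * L * (β + 0))) :=
    ENNReal.Tendsto.const_mul (tendsto_const_nhds.add ENNReal.tendsto_inv_nat_nhds_zero)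
      (Or.inr hCt)
  rw [add_zero] at hlim
  refine ge_of_tendsto hlim ?_
  filter_upwards [eventually_gt_atTop 0] with n hn
  have hn' : (n : ℝ≥0∞) ≠ 0 := by exact_mod_cast hn.ne'
  exact main _ le_self_add (by simp) (by simp [hβt, hn'])

end JohnNirenberg

/-! ### Standard kernels -/

section Kernel

variable {X : Type*} [TopologicalSpace X] [MeasurableSpace X] {μ : Measure X}
  (H : HomogeneousStructure μ)

/-- The weighted sum `∑ ρ ^ i (⨍_{B(x, c ^ i r)} |f| ^ s) ^ (1 / s)` of means over dilated balls. -/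
def theta (ρ s : ℝ≥0∞) (f : X → ℂ) (x : X) (r : ℝ) : ℝ≥0∞ :=
  ∑' i : ℕ, ρ ^ i * eLpNorm f s (H.nu x (H.c ^ i * r))

/-- The decay rate, from one ball to the next dilate, of a kernel of smoothness `ε`. -/
def rate (ε : ℝ) : ℝ≥0∞ := ENNReal.ofReal (H.c ^ (-ε))

lemma rate_lt_one {ε : ℝ} (hε : 0 < ε) : H.rate ε < 1 :=
  ENNReal.ofReal_lt_one.2 (Real.rpow_lt_one_of_one_lt_of_neg H.one_lt_c (by linarith))

lemma rate_ne_zero (ε : ℝ) : H.rate ε ≠ 0 := by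
  simpa [rate] using Real.rpow_pos_of_pos H.c_pos _

/-- The geometric constant in the kernel estimates. -/
def kernelConst (ε : ℝ) : ℝ≥0∞ := H.doublingConst * (1 + ENNReal.ofReal (H.c ^ (2 * ε)))

lemma kernelConst_ne_top (ε : ℝ) : H.kernelConst ε ≠ ∞ :=
  ENNReal.mul_ne_top H.doublingConst_ne_top (by simp)

/-- The complement of a dilated ball is split into annuli, on which the weight is bounded by its
values at the corresponding scales. -/
lemma lintegral_annuli_le [OpensMeasurableSpace X] {x : X} {r : ℝ} (hr : 0 < r) {w : X → ℝ≥0∞}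
    {a : ℕ → ℝ≥0∞}
    (hw : ∀ i, 2 ≤ i → ∀ y ∈ H.ball x (H.c ^ (i + 1) * r), y ∉ H.ball x (H.c ^ i * r) →
      w y ≤ a (i + 1) * (μ (H.ball x (H.c ^ (i + 1) * r)))⁻¹)
    {f : X → ℂ} (hf : AEStronglyMeasurable f μ) (hf0 : ∀ y ∈ H.ball x (H.c ^ 2 * r), f y = 0) :
    ∫⁻ y, w y * ‖f y‖ₑ ∂μ ≤ ∑' i, a i * eLpNorm f 1 (H.nu x (H.c ^ i * r)) := by
  have hpos : ∀ i : ℕ, 0 < H.c ^ i * r := fun i => mul_pos (H.c_pow_pos i) hr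
  calc ∫⁻ y, w y * ‖f y‖ₑ ∂μ
      ≤ ∫⁻ y, ∑' i, (H.ball x (H.c ^ i * r)).indicator
        (fun y => a i * (μ (H.ball x (H.c ^ i * r)))⁻¹ * ‖f y‖ₑ) y ∂μ := by
        refine lintegral_mono fun y => ?_
        rcases eq_or_ne (f y) 0 with h0 | h0
        · simp [h0]
        classical
        have hex := H.exists_mem_ball_pow x y hr
        have h1 := Nat.find_spec hex
        have h3 : 2 < Nat.find hex := by
          by_contra! hcon
          refine h0 (hf0 y (H.ball_mono x _ _ (hpos _) ?_ h1))
          have := H.one_lt_c.le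
          gcongr
        obtain ⟨i, hi⟩ : ∃ i, Nat.find hex = i + 1 :=
          Nat.exists_eq_succ_of_ne_zero (by omega)
        have h2 := Nat.find_min hex (m := i) (by omega)
        rw [hi] at h1
        refine le_trans ?_ (ENNReal.le_tsum (i + 1))
        rw [Set.indicator_of_mem h1]
        gcongr
        exact hw i (by omega) y h1 h2
    _ = ∑' i, ∫⁻ y, (H.ball x (H.c ^ i * r)).indicator
        (fun y => a i * (μ (H.ball x (H.c ^ i * r)))⁻¹ * ‖f y‖ₑ) y ∂μ := by
        refine lintegral_tsum fun i => ?_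
        exact (hf.enorm.const_mul _).indicator (H.measurableSet_ball _ (hpos i))
    _ = _ := by
        refine tsum_congr fun i => ?_
        rw [lintegral_indicator (H.measurableSet_ball _ (hpos i)),
          lintegral_const_mul'' _ hf.enorm.restrict, eLpNorm_one_eq_lintegral_enorm,
          lintegral_nu, mul_assoc]

variable {H}
variable {ε A : ℝ} {k : X → X → ℂ}

lemma mul_dist_le_dist {x₀ x y : X} {r : ℝ} (hr : 0 < r) {i : ℕ} (hi : 2 ≤ i)
    (hx : x ∈ H.ball x₀ r) (hy : y ∉ H.ball x₀ (H.c ^ i * r)) :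
    H.c * H.dist x₀ x ≤ H.dist x₀ y := by
  have hc := H.c_pos
  have hc1 := H.one_lt_c.le
  calc H.c * H.dist x₀ x ≤ H.c * (H.c * r) := by gcongr; exact H.dist_le_of_mem hr hx
    _ = H.c ^ 2 * r := by ring
    _ ≤ H.c ^ i * r := by gcongr
    _ ≤ _ := H.le_dist_of_notMem hy

lemma ofReal_div_lam_le {x₀ y : X} {r : ℝ} (hr : 0 < r) {i : ℕ}
    (hy : y ∉ H.ball x₀ (H.c ^ i * r)) :
    ENNReal.ofReal (A / H.lam x₀ y) ≤
      ENNReal.ofReal A * H.doublingConst * (μ (H.ball x₀ (H.c ^ (i + 1) * r)))⁻¹ := by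
  have hri : 0 < H.c ^ i * r := mul_pos (H.c_pow_pos i) hr
  have hri' : 0 < H.c ^ (i + 1) * r := mul_pos (H.c_pow_pos _) hr
  have hd := H.le_dist_of_notMem hy
  have hd0 : 0 < H.dist x₀ y := hri.trans_le hd
  have hlam : 0 < H.lam x₀ y :=
    ENNReal.toReal_pos (H.measure_ball_ne_zero hd0) (H.measure_ball_ne_top hd0)
  rw [ENNReal.ofReal_div_of_pos hlam, lam, Measure.real,
    ENNReal.ofReal_toReal (H.measure_ball_ne_top hd0), mul_assoc, div_eq_mul_inv]
  gcongr
  have h1 : μ (H.ball x₀ (H.c ^ (i + 1) * r)) ≤ H.doublingConst * μ (H.ball x₀ (H.dist x₀ y)) := by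
    calc _ = μ (H.ball x₀ (H.c * (H.c ^ i * r))) := by rw [pow_succ', mul_assoc]
      _ ≤ H.doublingConst * μ (H.ball x₀ (H.c ^ i * r)) := H.doubling x₀ _ hri
      _ ≤ _ := by gcongr; exact H.ball_mono _ _ _ hri hd
  rw [← div_eq_mul_inv, ENNReal.le_div_iff_mul_le (Or.inl (H.measure_ball_ne_zero hri'))
    (Or.inl (H.measure_ball_ne_top hri')), ENNReal.inv_mul_le_iff (H.measure_ball_ne_zero hd0)
    (H.measure_ball_ne_top hd0)]
  exact h1.trans_eq (mul_comm _ _)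

lemma IsStandardKernel.enorm_sub_add_enorm_sub_le (hk : H.IsStandardKernel ε A k) (hε : 0 < ε) (hA : 0 ≤ A)
    {x₀ x y : X} {r : ℝ} (hr : 0 < r) {i : ℕ} (hi : 2 ≤ i) (hx : x ∈ H.ball x₀ r)
    (hy : y ∉ H.ball x₀ (H.c ^ i * r)) :
    ‖k x₀ y - k x y‖ₑ + ‖k y x₀ - k y x‖ₑ ≤ H.kernelConst ε * ENNReal.ofReal A *
      H.rate ε ^ (i + 1) * (μ (H.ball x₀ (H.c ^ (i + 1) * r)))⁻¹ := by
  have hc := H.c_pos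
  have hri : 0 < H.c ^ i * r := mul_pos (H.c_pow_pos i) hr
  have hne : x₀ ≠ y := fun h => hy (h ▸ H.mem_ball x₀ _ hri)
  have h1 := hk.smooth x₀ x y hne (mul_dist_le_dist hr hi hx hy)
  have hd0 : 0 < H.dist x₀ y := H.dist_pos hne
  have h2 : (H.dist x₀ x / H.dist x₀ y) ^ ε ≤ H.c ^ (2 * ε) * (H.c ^ (-ε)) ^ (i + 1) := by
    have h3 : H.dist x₀ x / H.dist x₀ y ≤ H.c ^ (2 : ℝ) * (H.c ^ (-1 : ℝ)) ^ (i + 1) := by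
      have e1 : H.c ^ (2 : ℝ) * (H.c ^ (-1 : ℝ)) ^ (i + 1) = H.c / H.c ^ i := by
        rw [Real.rpow_neg_one, inv_pow, Real.rpow_two]
        field_simp
        ring
      rw [e1, div_le_div_iff₀ hd0 (H.c_pow_pos i)]
      calc H.dist x₀ x * H.c ^ i ≤ H.c * r * H.c ^ i := by
            have := H.c_pow_pos i
            gcongr
            exact H.dist_le_of_mem hr hx
        _ = H.c * (H.c ^ i * r) := by ring
        _ ≤ _ := by gcongr; exact H.le_dist_of_notMem hy
    calc _ ≤ (H.c ^ (2 : ℝ) * (H.c ^ (-1 : ℝ)) ^ (i + 1)) ^ ε :=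
          Real.rpow_le_rpow (div_nonneg (H.dist_nonneg _ _) (H.dist_nonneg _ _)) h3 hε.le
      _ = _ := by
          rw [Real.mul_rpow (by positivity) (by positivity), ← Real.rpow_natCast,
            ← Real.rpow_natCast, ← Real.rpow_mul hc.le, ← Real.rpow_mul hc.le,
            ← Real.rpow_mul hc.le, ← Real.rpow_mul hc.le]
          congr 2
          ring
  have hl0 : 0 ≤ A / H.lam x₀ y := div_nonneg hA measureReal_nonneg
  calc ‖k x₀ y - k x y‖ₑ + ‖k y x₀ - k y x‖ₑ
      = ENNReal.ofReal (‖k x₀ y - k x y‖ + ‖k y x₀ - k y x‖) := by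
        rw [ENNReal.ofReal_add (norm_nonneg _) (norm_nonneg _), ofReal_norm, ofReal_norm]
    _ ≤ ENNReal.ofReal (H.c ^ (2 * ε) * (H.c ^ (-ε)) ^ (i + 1) * (A / H.lam x₀ y)) := by
        refine ENNReal.ofReal_le_ofReal (h1.trans ?_)
        gcongr
    _ = ENNReal.ofReal (H.c ^ (2 * ε)) * H.rate ε ^ (i + 1) * ENNReal.ofReal (A / H.lam x₀ y) := by
        rw [ENNReal.ofReal_mul (by positivity), ENNReal.ofReal_mul (by positivity),
          ENNReal.ofReal_pow (by positivity), rate]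
    _ ≤ (1 + ENNReal.ofReal (H.c ^ (2 * ε))) * H.rate ε ^ (i + 1) *
        (ENNReal.ofReal A * H.doublingConst * (μ (H.ball x₀ (H.c ^ (i + 1) * r)))⁻¹) := by
        gcongr
        · exact le_add_self
        · exact ofReal_div_lam_le hr hy
    _ = _ := by rw [kernelConst]; ring

lemma IsStandardKernel.enorm_kernel_le (hk : H.IsStandardKernel ε A k) (hε : 0 < ε) (hA : 0 ≤ A)
    {x₀ x y : X} {r : ℝ} (hr : 0 < r) {i : ℕ} (hi : 2 ≤ i) (hx : x ∈ H.ball x₀ r)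
    (hy : y ∉ H.ball x₀ (H.c ^ i * r)) :
    ‖k x y‖ₑ ≤ 2 * (H.kernelConst ε * ENNReal.ofReal A) *
      (μ (H.ball x₀ (H.c ^ (i + 1) * r)))⁻¹ := by
  have hri : 0 < H.c ^ i * r := mul_pos (H.c_pow_pos i) hr
  have hne : x₀ ≠ y := fun h => hy (h ▸ H.mem_ball x₀ _ hri)
  have h1 := hk.enorm_sub_add_enorm_sub_le hε hA hr hi hx hy
  have h2 : ‖k x₀ y‖ₑ ≤ H.kernelConst ε * ENNReal.ofReal A *
      (μ (H.ball x₀ (H.c ^ (i + 1) * r)))⁻¹ := by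
    rw [← ofReal_norm]
    calc _ ≤ ENNReal.ofReal (A / H.lam x₀ y) := ENNReal.ofReal_le_ofReal (hk.size _ _ hne)
      _ ≤ _ := ofReal_div_lam_le hr hy
      _ ≤ (1 + ENNReal.ofReal (H.c ^ (2 * ε))) * (ENNReal.ofReal A * H.doublingConst *
          (μ (H.ball x₀ (H.c ^ (i + 1) * r)))⁻¹) :=
          le_mul_of_one_le_left zero_le le_self_add
      _ = _ := by rw [kernelConst]; ring
  calc ‖k x y‖ₑ = ‖k x₀ y - (k x₀ y - k x y)‖ₑ := by congr 1; ring
    _ ≤ ‖k x₀ y‖ₑ + ‖k x₀ y - k x y‖ₑ := enorm_sub_le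
    _ ≤ H.kernelConst ε * ENNReal.ofReal A * (μ (H.ball x₀ (H.c ^ (i + 1) * r)))⁻¹ +
        H.kernelConst ε * ENNReal.ofReal A * 1 * (μ (H.ball x₀ (H.c ^ (i + 1) * r)))⁻¹ := by
        gcongr
        refine (le_self_add.trans h1).trans ?_
        gcongr
        exact pow_le_one₀ zero_le (H.rate_lt_one hε).le
    _ = _ := by ring

lemma tendsto_dist_nhds (y : X) : Tendsto (fun y' => H.dist y y') (𝓝 y) (𝓝 0) := by
  have hc := H.c_pos
  refine tendsto_order.2 ⟨fun a ha => Eventually.of_forall fun y' =>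
    ha.trans_le (H.dist_nonneg _ _), fun a ha => ?_⟩
  have h2 : 0 < a / (2 * H.c) := by positivity
  filter_upwards [(H.isOpen_ball y _ h2).mem_nhds (H.mem_ball y _ h2)] with y' hy'
  refine (H.dist_le_of_mem h2 hy').trans_lt ?_
  have : H.c * (a / (2 * H.c)) = a / 2 := by field_simp
  linarith

lemma IsStandardKernel.continuousAt (hk : H.IsStandardKernel ε A k) (hε : 0 < ε)
    {x y : X} (hxy : y ≠ x) : ContinuousAt (k x) y := by
  have hd0 : 0 < H.dist y x := H.dist_pos hxy
  have hlim := tendsto_dist_nhds (H := H) y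
  have h1 : ∀ᶠ y' in 𝓝 y, ‖k x y' - k x y‖ ≤ (H.dist y y' / H.dist y x) ^ ε * (A / H.lam y x) := by
    have : ∀ᶠ y' in 𝓝 y, H.c * H.dist y y' < H.dist y x := by
      have h2 := hlim.const_mul H.c
      rw [mul_zero] at h2
      exact h2.eventually_lt_const hd0
    filter_upwards [this] with y' hy'
    rw [norm_sub_rev]
    exact (le_add_of_nonneg_left (norm_nonneg _)).trans (hk.smooth y y' x hxy hy'.le)
  refine tendsto_iff_norm_sub_tendsto_zero.2 (squeeze_zero' (Eventually.of_forall fun _ =>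
    norm_nonneg _) h1 ?_)
  have h3 : Tendsto (fun y' => (H.dist y y' / H.dist y x) ^ ε * (A / H.lam y x)) (𝓝 y)
      (𝓝 ((0 / H.dist y x) ^ ε * (A / H.lam y x))) :=
    ((hlim.div_const _).rpow_const (Or.inr hε.le)).mul_const _
  simpa [Real.zero_rpow hε.ne'] using h3

lemma IsStandardKernel.aestronglyMeasurable [T2Space X] [BorelSpace X]
    (hk : H.IsStandardKernel ε A k) (hε : 0 < ε) (x : X) : AEStronglyMeasurable (k x) μ := by
  have h1 : AEStronglyMeasurable (k x) (μ.restrict {x}ᶜ) :=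
    ContinuousOn.aestronglyMeasurable
      (fun y hy => (hk.continuousAt hε hy).continuousWithinAt) (measurableSet_singleton x).compl
  rwa [Measure.restrict_eq_self_of_ae_mem] at h1
  rw [ae_iff]
  simpa using H.measure_singleton x

end Kernel

section Conj

variable {X : Type*} [MeasurableSpace X] {μ : Measure X}

lemma applyL2_of_memLp (T : Lp ℂ 2 μ →L[ℂ] Lp ℂ 2 μ) {f : X → ℂ} (hf : MemLp f 2 μ) :
    applyL2 T f = T (hf.toLp f) := by
  simp [applyL2, hf]

lemma memLp_applyL2 (T : Lp ℂ 2 μ →L[ℂ] Lp ℂ 2 μ) (f : X → ℂ) : MemLp (applyL2 T f) 2 μ := by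
  by_cases hf : MemLp f 2 μ
  · rw [applyL2_of_memLp T hf]; exact Lp.memLp _
  · simp [applyL2, hf]

lemma memLp_conj {f : X → ℂ} {p : ℝ≥0∞} (hf : MemLp f p μ) :
    MemLp (fun x => starRingEnd ℂ (f x)) p μ :=
  hf.star

lemma enorm_conj (z : ℂ) : ‖starRingEnd ℂ z‖ₑ = ‖z‖ₑ := by
  rw [← ofReal_norm, ← ofReal_norm, RCLike.norm_conj]

lemma eLpNorm_conj (f : X → ℂ) (p : ℝ≥0∞) (ν : Measure X) :
    eLpNorm (fun x => starRingEnd ℂ (f x)) p ν = eLpNorm f p ν :=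
  eLpNorm_congr_enorm_ae (Eventually.of_forall fun x => enorm_conj (f x))

lemma enorm_integral_adjoint (T : Lp ℂ 2 μ →L[ℂ] Lp ℂ 2 μ) {f h : X → ℂ} (hf : MemLp f 2 μ)
    (hh : MemLp h 2 μ) :
    ‖∫ y, applyL2 (ContinuousLinearMap.adjoint T) f y * h y ∂μ‖ₑ =
      ‖∫ y, applyL2 T (fun x => starRingEnd ℂ (h x)) y * starRingEnd ℂ (f y) ∂μ‖ₑ := by
  have hh' := memLp_conj hh
  rw [applyL2_of_memLp _ hf, applyL2_of_memLp _ hh']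
  have h1 := ContinuousLinearMap.adjoint_inner_right T (hh'.toLp _) (hf.toLp f)
  rw [L2.inner_def, L2.inner_def] at h1
  have h2 : ∫ y, (ContinuousLinearMap.adjoint T (hf.toLp f)) y * h y ∂μ =
      ∫ a, inner ℂ ((hh'.toLp _) a) ((ContinuousLinearMap.adjoint T (hf.toLp f)) a) ∂μ := by
    refine integral_congr_ae ?_
    filter_upwards [hh'.coeFn_toLp] with y hy
    rw [hy, RCLike.inner_apply]
    simp
  have h3 : ∫ a, inner ℂ ((T (hh'.toLp _)) a) ((hf.toLp f) a) ∂μ =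
      starRingEnd ℂ (∫ y, (T (hh'.toLp _)) y * starRingEnd ℂ (f y) ∂μ) := by
    rw [← integral_conj]
    refine integral_congr_ae ?_
    filter_upwards [hf.coeFn_toLp] with y hy
    rw [hy, RCLike.inner_apply]
    simp [mul_comm]
  rw [h2, h1, h3, enorm_conj]

end Conj

/-! ### Pairings with test functions far from the support -/

section FarPairing

variable {X : Type*} [TopologicalSpace X] [MeasurableSpace X] {μ : Measure X}
  (H : HomogeneousStructure μ)

lemma integrable_of_support_subset_ball {f : X → ℂ} {p : ℝ≥0∞} (hp : 1 ≤ p) (hf : MemLp f p μ)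
    {x : X} {r : ℝ} (hr : 0 < r) (hfs : Function.support f ⊆ H.ball x r) : Integrable f μ := by
  rw [← integrableOn_iff_integrable_of_support_subset hfs]
  have : IsFiniteMeasure (μ.restrict (H.ball x r)) :=
    ⟨by simpa using H.measure_ball_lt_top x r hr⟩
  exact (hf.restrict _).integrable hp

/-- Decay of the pairings `∫ (S f) h` for a test function `h` in a ball `B(x, r)`, subject to a
side condition `Z`, and `f` supported off `B(x, c² r)`. -/
def FarPairing (S : Lp ℂ 2 μ →L[ℂ] Lp ℂ 2 μ) (ρ κ : ℝ≥0∞) (Z : (X → ℂ) → Prop) : Prop :=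
  ∀ (x : X) (r : ℝ), 0 < r → ∀ f h : X → ℂ, MemLp f 2 μ → MemLp h 2 μ →
    (∃ x' r', 0 < r' ∧ Function.support f ⊆ H.ball x' r') →
    (∀ y ∈ H.ball x (H.c ^ 2 * r), f y = 0) → Function.support h ⊆ H.ball x r → Z h →
    ‖∫ y, applyL2 S f y * h y ∂μ‖ₑ ≤ κ * (∫⁻ y, ‖h y‖ₑ ∂μ) * H.theta ρ 1 f x r

variable {H}

lemma le_dist_of_mem_of_notMem {x₀ x y : X} {r : ℝ} (hr : 0 < r) (hx : x ∈ H.ball x₀ r)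
    (hy : y ∉ H.ball x₀ (H.c ^ 2 * r)) : r ≤ H.dist x y := by
  by_contra! hcon
  have h1 := H.mem_ball_of_dist_lt hcon
  have h2 := H.engulfing x₀ x r r hr le_rfl ⟨x, hx, H.mem_ball x r hr⟩ h1
  refine hy (H.ball_mono x₀ _ _ (mul_pos H.c_pos hr) ?_ h2)
  have : H.c ≤ H.c ^ 2 := le_self_pow₀ H.one_lt_c.le (by norm_num)
  gcongr

variable {ε A : ℝ} {k : X → X → ℂ} {T : Lp ℂ 2 μ →L[ℂ] Lp ℂ 2 μ}

lemma lintegral_kernel_le [OpensMeasurableSpace X] (hk : H.IsStandardKernel ε A k) (hε : 0 < ε)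
    (hA : 0 ≤ A) {x₀ x : X} {r : ℝ} (hr : 0 < r) (hx : x ∈ H.ball x₀ r) {f : X → ℂ}
    (hf : AEStronglyMeasurable f μ) (hf0 : ∀ y ∈ H.ball x₀ (H.c ^ 2 * r), f y = 0) :
    ∫⁻ y, ‖k x y‖ₑ * ‖f y‖ₑ ∂μ ≤
      2 * (H.kernelConst ε * ENNReal.ofReal A) * H.theta 1 1 f x₀ r := by
  have := H.lintegral_annuli_le hr (w := fun y => ‖k x y‖ₑ)
    (a := fun _ => 2 * (H.kernelConst ε * ENNReal.ofReal A))
    (fun i hi y _ hy => hk.enorm_kernel_le hε hA hr hi hx hy) hf hf0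
  rw [ENNReal.tsum_mul_left] at this
  simpa [theta] using this

lemma lintegral_kernel_sub_le [OpensMeasurableSpace X] (hk : H.IsStandardKernel ε A k) (hε : 0 < ε)
    (hA : 0 ≤ A) {x₀ x : X} {r : ℝ} (hr : 0 < r) (hx : x ∈ H.ball x₀ r) {f : X → ℂ}
    (hf : AEStronglyMeasurable f μ) (hf0 : ∀ y ∈ H.ball x₀ (H.c ^ 2 * r), f y = 0) :
    ∫⁻ y, ‖k x₀ y - k x y‖ₑ * ‖f y‖ₑ ∂μ ≤
      H.kernelConst ε * ENNReal.ofReal A * H.theta (H.rate ε) 1 f x₀ r := by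
  have := H.lintegral_annuli_le hr (w := fun y => ‖k x₀ y - k x y‖ₑ)
    (a := fun i => H.kernelConst ε * ENNReal.ofReal A * H.rate ε ^ i)
    (fun i hi y _ hy => le_self_add.trans (hk.enorm_sub_add_enorm_sub_le hε hA hr hi hx hy)) hf hf0
  simp_rw [mul_assoc (H.kernelConst ε * ENNReal.ofReal A), ENNReal.tsum_mul_left] at this
  exact this

lemma integrable_kernel_mul [T2Space X] [BorelSpace X] (hk : H.IsStandardKernel ε A k)
    (hε : 0 < ε) (hA : 0 ≤ A) {x₀ x : X} {r : ℝ} (hr : 0 < r) (hx : x ∈ H.ball x₀ r) {f : X → ℂ}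
    (hf : Integrable f μ) (hf0 : ∀ y ∈ H.ball x₀ (H.c ^ 2 * r), f y = 0) :
    Integrable (fun y => k x y * f y) μ := by
  have hr2 : 0 < H.c ^ 2 * r := mul_pos (H.c_pow_pos 2) hr
  refine ⟨(hk.aestronglyMeasurable hε x).mul hf.1, ?_⟩
  set M := 2 * (H.kernelConst ε * ENNReal.ofReal A) * (μ (H.ball x₀ (H.c ^ (2 + 1) * r)))⁻¹
  have hM : M ≠ ∞ := ENNReal.mul_ne_top (ENNReal.mul_ne_top (by simp)
    (ENNReal.mul_ne_top (H.kernelConst_ne_top ε) (by simp)))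
    (ENNReal.inv_ne_top.2 (H.measure_ball_ne_zero (mul_pos (H.c_pow_pos _) hr)))
  refine (lintegral_mono (g := fun y => M * ‖f y‖ₑ) fun y => ?_).trans_lt ?_
  · rw [enorm_mul]
    by_cases hy : y ∈ H.ball x₀ (H.c ^ 2 * r)
    · simp [hf0 y hy]
    · exact mul_le_mul' (hk.enorm_kernel_le hε hA hr le_rfl hx hy) le_rfl
  · rw [lintegral_const_mul' _ _ hM]
    exact ENNReal.mul_lt_top hM.lt_top hf.2

/-- The size estimate for pairings with a Calderón–Zygmund operator. -/
lemma IsAssociated.farPairing_size [T2Space X] [BorelSpace X] (hk : H.IsStandardKernel ε A k)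
    (hε : 0 < ε) (hA : 0 ≤ A) (hT : H.IsAssociated T k) :
    H.FarPairing T 1 (2 * (H.kernelConst ε * ENNReal.ofReal A)) (fun _ => True) := by
  intro x₀ r hr f h hf hh hfs hf0 hhs _
  rw [applyL2_of_memLp T hf, hT.2 f h hf hh hfs ⟨x₀, r, hr, hhs⟩ ⟨r, hr, fun x hx y hy =>
    le_dist_of_mem_of_notMem hr (hhs hx) fun hyB => hy (hf0 y hyB)⟩]
  refine (enorm_integral_le_lintegral_enorm _).trans ?_
  calc ∫⁻ x, ‖∫ y, k x y * f y * h x ∂μ‖ₑ ∂μ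
      ≤ ∫⁻ x, 2 * (H.kernelConst ε * ENNReal.ofReal A) * H.theta 1 1 f x₀ r * ‖h x‖ₑ ∂μ := by
        refine lintegral_mono fun x => ?_
        rw [integral_mul_const, enorm_mul]
        by_cases hx : x ∈ H.ball x₀ r
        · gcongr
          refine (enorm_integral_le_lintegral_enorm _).trans ?_
          simp_rw [enorm_mul]
          exact lintegral_kernel_le hk hε hA hr hx hf.1 hf0
        · simp [Function.notMem_support.1 fun h' => hx (hhs h')]
    _ = _ := by rw [lintegral_const_mul'' _ hh.1.enorm]; ring

/-- The smoothness estimate for pairings of a Calderón–Zygmund operator with functions of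
integral zero. -/
lemma IsAssociated.farPairing_osc [T2Space X] [BorelSpace X] (hk : H.IsStandardKernel ε A k)
    (hε : 0 < ε) (hA : 0 ≤ A) (hT : H.IsAssociated T k) :
    H.FarPairing T (H.rate ε) (H.kernelConst ε * ENNReal.ofReal A) (fun h => ∫ x, h x ∂μ = 0) := by
  intro x₀ r hr f h hf hh hfs hf0 hhs hh0
  rw [applyL2_of_memLp T hf, hT.2 f h hf hh hfs ⟨x₀, r, hr, hhs⟩ ⟨r, hr, fun x hx y hy =>
    le_dist_of_mem_of_notMem hr (hhs hx) fun hyB => hy (hf0 y hyB)⟩]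
  have hhi := H.integrable_of_support_subset_ball (by norm_num) hh hr hhs
  have hfi : Integrable f μ := by
    obtain ⟨x', r', hr', hfs'⟩ := hfs
    exact H.integrable_of_support_subset_ball (by norm_num) hf hr' hfs'
  simp_rw [integral_mul_const]
  set G : X → ℂ := fun x => ∫ y, k x y * f y ∂μ with hG
  by_cases hGi : Integrable (fun x => G x * h x) μ
  swap
  · rw [integral_undef hGi]; simp
  have h1 : ∫ x, G x * h x ∂μ = ∫ x, (G x - G x₀) * h x ∂μ := by
    simp_rw [sub_mul]
    rw [integral_sub hGi (hhi.const_mul _), integral_const_mul, hh0, mul_zero, sub_zero]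
  rw [h1]
  refine (enorm_integral_le_lintegral_enorm _).trans ?_
  calc ∫⁻ x, ‖(G x - G x₀) * h x‖ₑ ∂μ
      ≤ ∫⁻ x, H.kernelConst ε * ENNReal.ofReal A * H.theta (H.rate ε) 1 f x₀ r * ‖h x‖ₑ ∂μ := by
        refine lintegral_mono fun x => ?_
        rw [enorm_mul]
        by_cases hx : x ∈ H.ball x₀ r
        · gcongr
          rw [hG, ← enorm_neg, neg_sub]
          dsimp only
          rw [← integral_sub
            (integrable_kernel_mul hk hε hA hr (H.mem_ball x₀ r hr) hfi hf0)
            (integrable_kernel_mul hk hε hA hr hx hfi hf0)]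
          refine (enorm_integral_le_lintegral_enorm _).trans ?_
          simp_rw [← sub_mul, enorm_mul]
          exact lintegral_kernel_sub_le hk hε hA hr hx hf.1 hf0
        · simp [Function.notMem_support.1 fun h' => hx (hhs h')]
    _ = _ := by rw [lintegral_const_mul'' _ hh.1.enorm]; ring

/-- The pairing of `T h` with a function far from the support of `h`, when `h` has integral zero. -/
lemma IsAssociated.enorm_integral_le [T2Space X] [BorelSpace X] (hk : H.IsStandardKernel ε A k)
    (hε : 0 < ε) (hA : 0 ≤ A) (hT : H.IsAssociated T k) {x₀ : X} {r : ℝ} (hr : 0 < r)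
    {f h : X → ℂ} (hf : MemLp f 2 μ) (hh : MemLp h 2 μ)
    (hfs : ∃ x' r', 0 < r' ∧ Function.support f ⊆ H.ball x' r')
    (hf0 : ∀ y ∈ H.ball x₀ (H.c ^ 2 * r), f y = 0) (hhs : Function.support h ⊆ H.ball x₀ r)
    (hh0 : ∫ x, h x ∂μ = 0) :
    ‖∫ y, applyL2 T h y * f y ∂μ‖ₑ ≤
      H.kernelConst ε * ENNReal.ofReal A * (∫⁻ y, ‖h y‖ₑ ∂μ) * H.theta (H.rate ε) 1 f x₀ r := by
  rw [applyL2_of_memLp T hh, hT.2 h f hh hf ⟨x₀, r, hr, hhs⟩ hfs ⟨r, hr, fun x hx y hy => by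
    rw [H.dist_comm]
    exact le_dist_of_mem_of_notMem hr (hhs hy) fun hyB => hx (hf0 x hyB)⟩]
  have hhi := H.integrable_of_support_subset_ball (by norm_num) hh hr hhs
  simp_rw [integral_mul_const]
  refine (enorm_integral_le_lintegral_enorm _).trans ?_
  simp_rw [enorm_mul]
  have := H.lintegral_annuli_le hr (w := fun x => ‖∫ y, k x y * h y ∂μ‖ₑ)
    (a := fun i => H.kernelConst ε * ENNReal.ofReal A * (∫⁻ y, ‖h y‖ₑ ∂μ) * H.rate ε ^ i)
    (fun i hi x _ hx => ?_) hf.1 hf0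
  · simp_rw [mul_assoc (H.kernelConst ε * ENNReal.ofReal A * (∫⁻ y, ‖h y‖ₑ ∂μ)),
      ENNReal.tsum_mul_left] at this
    exact this
  by_cases hi' : Integrable (fun y => k x y * h y) μ
  swap
  · rw [integral_undef hi']; simp
  have h1 : ∫ y, k x y * h y ∂μ = ∫ y, (k x y - k x x₀) * h y ∂μ := by
    simp_rw [sub_mul]
    rw [integral_sub hi' (hhi.const_mul _), integral_const_mul, hh0, mul_zero, sub_zero]
  rw [h1]
  refine (enorm_integral_le_lintegral_enorm _).trans ?_
  calc ∫⁻ y, ‖(k x y - k x x₀) * h y‖ₑ ∂μ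
      ≤ ∫⁻ y, H.kernelConst ε * ENNReal.ofReal A * H.rate ε ^ (i + 1) *
        (μ (H.ball x₀ (H.c ^ (i + 1) * r)))⁻¹ * ‖h y‖ₑ ∂μ := by
        refine lintegral_mono fun y => ?_
        rw [enorm_mul]
        by_cases hy : y ∈ H.ball x₀ r
        · gcongr
          rw [← enorm_neg, neg_sub]
          exact le_add_self.trans (hk.enorm_sub_add_enorm_sub_le hε hA hr hi hy hx)
        · simp [Function.notMem_support.1 fun h' => hy (hhs h')]
    _ = _ := by rw [lintegral_const_mul'' _ hh.1.enorm]; ring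

/-- The smoothness estimate for the adjoint. -/
lemma IsAssociated.farPairing_adjoint [T2Space X] [BorelSpace X] (hk : H.IsStandardKernel ε A k)
    (hε : 0 < ε) (hA : 0 ≤ A) (hT : H.IsAssociated T k) :
    H.FarPairing (ContinuousLinearMap.adjoint T) (H.rate ε)
      (H.kernelConst ε * ENNReal.ofReal A) (fun h => ∫ x, h x ∂μ = 0) := by
  intro x₀ r hr f h hf hh hfs hf0 hhs hh0
  rw [enorm_integral_adjoint T hf hh]
  have h1 := hT.enorm_integral_le hk hε hA hr (memLp_conj hf) (memLp_conj hh)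
    (by
      obtain ⟨x', r', hr', hfs'⟩ := hfs
      exact ⟨x', r', hr', fun y hy => hfs' fun h' => hy (by simp [h'])⟩)
    (fun y hy => by simp [hf0 y hy]) (fun y hy => hhs fun h' => hy (by simp [h']))
    (by rw [integral_conj, hh0, map_zero])
  simpa only [enorm_conj, theta, eLpNorm_conj] using h1

end FarPairing

/-! ### Oscillation and size estimates for operators bounded on `L^s` -/

section TestFunctions

variable {X : Type*} [TopologicalSpace X] [MeasurableSpace X] {μ : Measure X}
  (H : HomogeneousStructure μ)

/-- Bounded measurable functions supported in a ball. -/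
def IsTest (f : X → ℂ) : Prop :=
  AEStronglyMeasurable f μ ∧ (∃ M : ℝ, ∀ x, ‖f x‖ ≤ M) ∧
    ∃ x r, 0 < r ∧ Function.support f ⊆ H.ball x r

variable {H}

lemma IsTest.memLp {f : X → ℂ} (hf : H.IsTest f) (p : ℝ≥0∞) : MemLp f p μ := by
  obtain ⟨hm, ⟨M, hM⟩, _, _, hr, hs⟩ := hf
  have h1 : MemLp f ∞ μ := memLp_top_of_bound hm M (Eventually.of_forall hM)
  exact MemLp.mono_exponent_of_measure_support_ne_top h1
    (fun y hy => Function.notMem_support.1 fun h => hy (hs h)) (H.measure_ball_ne_top hr) le_top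

lemma IsTest.mono {f g : X → ℂ} (hf : H.IsTest f) (hg : AEStronglyMeasurable g μ)
    (h : ∀ x, ‖g x‖ ≤ ‖f x‖) : H.IsTest g := by
  obtain ⟨hm, ⟨M, hM⟩, x, r, hr, hs⟩ := hf
  refine ⟨hg, ⟨M, fun x => (h x).trans (hM x)⟩, x, r, hr, fun y hy => hs fun h' => hy ?_⟩
  have := h y
  rw [h', norm_zero] at this
  exact norm_le_zero_iff.1 this

lemma IsTest.indicator {f : X → ℂ} (hf : H.IsTest f) {s : Set X} (hs : MeasurableSet s) :
    H.IsTest (s.indicator f) :=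
  hf.mono (hf.1.indicator hs) fun x => norm_indicator_le_norm_self f x

lemma IsTest.conj {f : X → ℂ} (hf : H.IsTest f) : H.IsTest fun x => starRingEnd ℂ (f x) :=
  hf.mono hf.1.star fun _ => (RCLike.norm_conj _).le

lemma IsTest.sub {f g : X → ℂ} (hf : H.IsTest f) (hg : H.IsTest g) :
    H.IsTest (fun x => f x - g x) := by
  obtain ⟨hm, ⟨M, hM⟩, x, r, hr, hs⟩ := hf
  obtain ⟨hm', ⟨M', hM'⟩, x', r', hr', hs'⟩ := hg
  obtain ⟨i, hi⟩ := H.exists_ball_subset_pow x x' hr hr'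
  refine ⟨hm.sub hm', ⟨M + M', fun y => (norm_sub_le _ _).trans (add_le_add (hM y) (hM' y))⟩,
    x, H.c ^ i * r, mul_pos (H.c_pow_pos i) hr, fun y hy => ?_⟩
  by_cases hy' : f y = 0
  · refine hi (hs' fun h => hy ?_)
    simp [hy', h]
  · exact H.ball_subset_mul x hr (H.one_le_c_pow i) (hs hy')

end TestFunctions

section ApplyL2

variable {X : Type*} [MeasurableSpace X] {μ : Measure X} (T : Lp ℂ 2 μ →L[ℂ] Lp ℂ 2 μ)

lemma applyL2_add_ae {f g : X → ℂ} (hf : MemLp f 2 μ) (hg : MemLp g 2 μ) :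
    applyL2 T (fun x => f x + g x) =ᵐ[μ] fun x => applyL2 T f x + applyL2 T g x := by
  have h1 : applyL2 T (fun x => f x + g x) = T (hf.toLp f + hg.toLp g) := by
    exact applyL2_of_memLp T (hf.add hg)
  rw [h1, map_add, applyL2_of_memLp T hf, applyL2_of_memLp T hg]
  exact Lp.coeFn_add _ _

lemma applyL2_sub_ae {f g : X → ℂ} (hf : MemLp f 2 μ) (hg : MemLp g 2 μ) :
    applyL2 T (fun x => f x - g x) =ᵐ[μ] fun x => applyL2 T f x - applyL2 T g x := by
  have h1 : applyL2 T (fun x => f x - g x) = T (hf.toLp f - hg.toLp g) := by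
    exact applyL2_of_memLp T (hf.sub hg)
  rw [h1, map_sub, applyL2_of_memLp T hf, applyL2_of_memLp T hg]
  exact Lp.coeFn_sub _ _

lemma eLpNorm_applyL2_le {f : X → ℂ} (hf : MemLp f 2 μ) :
    eLpNorm (applyL2 T f) 2 μ ≤ ‖T‖ₑ * eLpNorm f 2 μ := by
  rw [applyL2_of_memLp T hf, ← Lp.enorm_def, ← Lp.enorm_toLp hf]
  exact T.le_opENorm _

end ApplyL2

section Testing

variable {X : Type*} [TopologicalSpace X] [MeasurableSpace X] {μ : Measure X}
  (H : HomogeneousStructure μ)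

/-- `S` satisfies an a priori `L^s` estimate on test functions. -/
def LpBound (S : Lp ℂ 2 μ →L[ℂ] Lp ℂ 2 μ) (s N : ℝ≥0∞) : Prop :=
  ∀ f, H.IsTest f → eLpNorm (applyL2 S f) s μ ≤ N * eLpNorm f s μ

lemma lpBound_two (S : Lp ℂ 2 μ →L[ℂ] Lp ℂ 2 μ) : H.LpBound S 2 ‖S‖ₑ := fun _ hf =>
  eLpNorm_applyL2_le S (hf.memLp 2)

/-- The unimodular factor `conj z / |z|`. -/
def conjSign (z : ℂ) : ℂ := (‖z‖⁻¹ : ℝ) * starRingEnd ℂ z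

lemma norm_conjSign_le (z : ℂ) : ‖conjSign z‖ ≤ 1 := by
  rw [conjSign, norm_mul, Complex.norm_real, norm_inv, norm_norm, RCLike.norm_conj]
  exact inv_mul_le_one

lemma mul_conjSign (z : ℂ) : z * conjSign z = (‖z‖ : ℝ) := by
  rcases eq_or_ne z 0 with rfl | hz
  · simp
  · rw [conjSign, mul_left_comm, Complex.mul_conj, Complex.normSq_eq_norm_sq]
    have : (‖z‖ : ℂ) ≠ 0 := by simpa using hz
    push_cast
    field_simp

lemma measurable_conjSign : Measurable conjSign := by
  unfold conjSign
  exact (Complex.measurable_ofReal.comp measurable_norm.inv).mul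
    Complex.continuous_conj.measurable

/-- An `L^2` function is integrable on every ball. -/
lemma locInt_of_memLp {p : ℝ≥0∞} (hp : 1 ≤ p) {F : X → ℂ} (hF : MemLp F p μ) : H.LocInt F := by
  intro x r hr
  have : IsFiniteMeasure (μ.restrict (H.ball x r)) :=
    ⟨by simpa using H.measure_ball_lt_top x r hr⟩
  exact (hF.restrict _).integrable hp

variable {H}

lemma isTest_indicator_ball [OpensMeasurableSpace X] {g : X → ℂ} (hg : AEStronglyMeasurable g μ)
    {M : ℝ} (hM : ∀ x, ‖g x‖ ≤ M) (x : X) {r : ℝ} (hr : 0 < r) :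
    H.IsTest ((H.ball x r).indicator g) :=
  ⟨hg.indicator (H.measurableSet_ball x hr), ⟨M, fun y =>
    (norm_indicator_le_norm_self g y).trans (hM y)⟩, x, r, hr, Set.support_indicator_subset⟩

/-- The `L¹` norm on a ball is attained by a test function of absolute value at most one. -/
lemma LocInt.exists_test_size [OpensMeasurableSpace X] {F : X → ℂ} (hF : H.LocInt F) (x : X) {r : ℝ}
    (hr : 0 < r) :
    ∃ h : X → ℂ, H.IsTest h ∧ (∀ y, ‖h y‖ ≤ 2) ∧ Function.support h ⊆ H.ball x r ∧
      ∫⁻ y in H.ball x r, ‖F y‖ₑ ∂μ = ‖∫ y, F y * h y ∂μ‖ₑ := by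
  have hB := H.measurableSet_ball x hr
  have hm : AEStronglyMeasurable (fun y => conjSign (F y)) μ :=
    (measurable_conjSign.comp_aemeasurable hF.aestronglyMeasurable.aemeasurable).aestronglyMeasurable
  refine ⟨(H.ball x r).indicator fun y => conjSign (F y),
    isTest_indicator_ball hm (fun y => norm_conjSign_le _) x hr, fun y => ?_,
    Set.support_indicator_subset, ?_⟩
  · exact (norm_indicator_le_norm_self _ y).trans ((norm_conjSign_le _).trans (by norm_num))
  · have h1 : ∫ y, F y * (H.ball x r).indicator (fun y => conjSign (F y)) y ∂μ =
        ((∫ y in H.ball x r, ‖F y‖ ∂μ : ℝ) : ℂ) := by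
      rw [← integral_complex_ofReal, ← integral_indicator hB]
      congr 1
      funext y
      by_cases hy : y ∈ H.ball x r
      · simp [hy, mul_conjSign]
      · simp [hy]
    rw [h1, ← ofReal_norm, Complex.norm_real, Real.norm_of_nonneg (integral_nonneg fun _ =>
      norm_nonneg _), ofReal_integral_norm_eq_lintegral_enorm (hF x r hr)]

/-- The mean oscillation over a ball is attained by a test function of integral zero. -/
lemma LocInt.exists_test_osc [OpensMeasurableSpace X] {F : X → ℂ} (hF : H.LocInt F) (x : X) {r : ℝ}
    (hr : 0 < r) :
    ∃ h : X → ℂ, H.IsTest h ∧ (∀ y, ‖h y‖ ≤ 2) ∧ Function.support h ⊆ H.ball x r ∧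
      ∫ y, h y ∂μ = 0 ∧
      ∫⁻ y in H.ball x r, ‖F y - H.mean F x r‖ₑ ∂μ = ‖∫ y, F y * h y ∂μ‖ₑ := by
  have hB := H.measurableSet_ball x hr
  have hprob := H.isProbabilityMeasure_nu x hr
  have hfin : IsFiniteMeasure (μ.restrict (H.ball x r)) :=
    ⟨by simpa using H.measure_ball_lt_top x r hr⟩
  set m := H.mean F x r with hm
  set σ : X → ℂ := fun y => conjSign (F y - m) with hσ
  have hσm : AEStronglyMeasurable σ μ := (measurable_conjSign.comp_aemeasurable
    (hF.aestronglyMeasurable.aemeasurable.sub_const m)).aestronglyMeasurable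
  have hσ1 : ∀ y, ‖σ y‖ ≤ 1 := fun y => norm_conjSign_le _
  have hσi : IntegrableOn σ (H.ball x r) μ :=
    Integrable.of_bound hσm.restrict 1 (Eventually.of_forall hσ1)
  set e := H.mean σ x r with he
  have hmul : ∀ G : X → ℂ, ∫ y in H.ball x r, G y ∂μ = μ.real (H.ball x r) * H.mean G x r := by
    intro G
    rw [← setAverage_ball, ← measure_smul_setAverage _ (H.measure_ball_ne_top hr)]
    simp
  have he1 : ‖e‖ ≤ 1 := by
    have := norm_integral_le_of_norm_le_const (μ := H.nu x r) (Eventually.of_forall hσ1)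
    simpa [he, mean] using this
  have hFi := hF x r hr
  have hFm : IntegrableOn (fun y => F y - m) (H.ball x r) μ := hF.sub_const m x r hr
  have hFm0 : ∫ y in H.ball x r, (F y - m) ∂μ = 0 := by
    rw [integral_sub hFi (integrable_const m), hmul F]
    simp [hm]
  have hh0 : ∫ y in H.ball x r, (σ y - e) ∂μ = 0 := by
    rw [integral_sub hσi (integrable_const e), hmul σ]
    simp [he]
  refine ⟨(H.ball x r).indicator fun y => σ y - e,
    isTest_indicator_ball (hσm.sub aestronglyMeasurable_const) (M := 2) (fun y => ?_) x hr,
    fun y => ?_, Set.support_indicator_subset, ?_, ?_⟩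
  · exact (norm_sub_le _ _).trans (by linarith [hσ1 y])
  · exact (norm_indicator_le_norm_self _ y).trans ((norm_sub_le _ _).trans (by linarith [hσ1 y]))
  · rw [integral_indicator hB, hh0]
  · have h1 : ∫ y, F y * (H.ball x r).indicator (fun y => σ y - e) y ∂μ =
        ((∫ y in H.ball x r, ‖F y - m‖ ∂μ : ℝ) : ℂ) := by
      have e1 : ∀ y, F y * (H.ball x r).indicator (fun y => σ y - e) y =
          (H.ball x r).indicator (fun y => F y * (σ y - e)) y := by
        intro y
        by_cases hy : y ∈ H.ball x r <;> simp [hy]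
      simp_rw [e1]
      rw [integral_indicator hB]
      have e2 : ∀ y, F y * (σ y - e) =
          ((‖F y - m‖ : ℝ) : ℂ) - (F y - m) * e + m * (σ y - e) := by
        intro y
        rw [← mul_conjSign]
        simp only [hσ]
        ring
      simp_rw [e2]
      have i1 : IntegrableOn (fun y => ((‖F y - m‖ : ℝ) : ℂ)) (H.ball x r) μ := hFm.norm.ofReal
      have i2 : IntegrableOn (fun y => (F y - m) * e) (H.ball x r) μ := hFm.mul_const e
      have i3 : IntegrableOn (fun y => m * (σ y - e)) (H.ball x r) μ :=
        (hσi.sub (integrable_const e)).const_mul m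
      rw [integral_add (show IntegrableOn (fun y => ((‖F y - m‖ : ℝ) : ℂ) - (F y - m) * e)
        (H.ball x r) μ from i1.sub i2) i3, integral_sub i1 i2, integral_mul_const, hFm0,
        integral_const_mul, hh0, ← integral_complex_ofReal]
      simp
    rw [h1, ← ofReal_norm, Complex.norm_real, Real.norm_of_nonneg (integral_nonneg fun _ =>
      norm_nonneg _), ofReal_integral_norm_eq_lintegral_enorm hFm]

lemma eLpNorm_nu {s : ℝ≥0∞} (hs : s ≠ ∞) (f : X → ℂ) (x : X) (r : ℝ) :
    eLpNorm f s (H.nu x r) =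
      (μ (H.ball x r))⁻¹ ^ (1 / s.toReal) * eLpNorm f s (μ.restrict (H.ball x r)) := by
  rw [nu, eLpNorm_smul_measure_of_ne_top hs, smul_eq_mul]
  simp

lemma theta_mono {ρ s : ℝ≥0∞} {f g : X → ℂ} (h : ∀ y, ‖f y‖ ≤ ‖g y‖) (x : X) (r : ℝ) :
    H.theta ρ s f x r ≤ H.theta ρ s g x r :=
  ENNReal.tsum_le_tsum fun _ => mul_le_mul' le_rfl (eLpNorm_mono h)

lemma theta_mono_exponent {ρ s t : ℝ≥0∞} (hst : s ≤ t) {f : X → ℂ} (hf : AEStronglyMeasurable f μ)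
    (x : X) {r : ℝ} (hr : 0 < r) : H.theta ρ s f x r ≤ H.theta ρ t f x r := by
  refine ENNReal.tsum_le_tsum fun i => mul_le_mul' le_rfl ?_
  have := H.isProbabilityMeasure_nu x (mul_pos (H.c_pow_pos i) hr)
  exact eLpNorm_le_eLpNorm_of_exponent_le hst (hf.mono_ac (H.nu_absolutelyContinuous _ _))

lemma pow_mul_eLpNorm_le_theta (ρ s : ℝ≥0∞) (f : X → ℂ) (x : X) (r : ℝ) (i : ℕ) :
    ρ ^ i * eLpNorm f s (H.nu x (H.c ^ i * r)) ≤ H.theta ρ s f x r :=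
  ENNReal.le_tsum i

/-- The constant in the local estimates. -/
def localConst (H : HomogeneousStructure μ) (ρ : ℝ≥0∞) : ℝ≥0∞ :=
  2 * (1 + H.doublingConst ^ 2 * (ρ ^ 2)⁻¹)

lemma localConst_ne_top (ρ : ℝ≥0∞) (hρ : ρ ≠ 0) : H.localConst ρ ≠ ∞ :=
  ENNReal.mul_ne_top (by simp) (ENNReal.add_ne_top.2 ⟨by simp, ENNReal.mul_ne_top
    (ENNReal.pow_ne_top H.doublingConst_ne_top) (ENNReal.inv_ne_top.2 (pow_ne_zero _ hρ))⟩)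

variable {S : Lp ℂ 2 μ →L[ℂ] Lp ℂ 2 μ} {ρ κ s N : ℝ≥0∞} {Z : (X → ℂ) → Prop}

/-- The estimate for pairings with test functions in a ball, obtained by splitting `f` into a part
near the ball, to which the `L^s` bound applies, and a part far away. -/
lemma FarPairing.enorm_integral_le [BorelSpace X] (hfar : H.FarPairing S ρ κ Z)
    (hS : H.LpBound S s N) (hs1 : 1 ≤ s) (hs : s ≠ ∞) (hρ0 : ρ ≠ 0) (hρ1 : ρ ≤ 1)
    {f h : X → ℂ} (hf : H.IsTest f) (hh : H.IsTest h) (hh2 : ∀ y, ‖h y‖ ≤ 2) {x : X} {r : ℝ}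
    (hr : 0 < r) (hhs : Function.support h ⊆ H.ball x r) (hZ : Z h) :
    ‖∫ y, applyL2 S f y * h y ∂μ‖ₑ ≤
      μ (H.ball x r) * (H.localConst ρ * (N + κ) * H.theta ρ s f x r) := by
  have hr2 : 0 < H.c ^ 2 * r := mul_pos (H.c_pow_pos 2) hr
  have hprob := H.isProbabilityMeasure_nu x hr
  have hB2 := H.measurableSet_ball x hr2
  have hs0 : s ≠ 0 := (zero_lt_one.trans_le hs1).ne'
  have hsr : 1 ≤ s.toReal := by
    rw [← ENNReal.toReal_one]; exact (ENNReal.toReal_le_toReal (by simp) hs).2 hs1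
  have hμ0 := H.measure_ball_ne_zero (x := x) hr
  have hμt := H.measure_ball_ne_top (x := x) hr
  have hμ20 := H.measure_ball_ne_zero (x := x) hr2
  have hμ2t := H.measure_ball_ne_top (x := x) hr2
  set B := H.ball x r with hB
  set B2 := H.ball x (H.c ^ 2 * r) with hB2'
  set f1 := B2.indicator f with hf1
  set f2 := B2ᶜ.indicator f with hf2
  have ht1 : H.IsTest f1 := hf.indicator hB2
  have ht2 : H.IsTest f2 := hf.indicator hB2.compl
  have h2 : (2 : ℝ≥0∞) ≠ ∞ := by simp
  have hsum : (fun y => f1 y + f2 y) = f := Set.indicator_self_add_compl B2 f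
  have hae := applyL2_add_ae S (ht1.memLp 2) (ht2.memLp 2)
  rw [hsum] at hae
  have hh_enorm : ∀ y, ‖h y‖ₑ ≤ 2 := fun y => by
    rw [← ofReal_norm]
    exact (ENNReal.ofReal_le_ofReal (hh2 y)).trans (by simp)
  have hhint : ∫⁻ y, ‖h y‖ₑ ∂μ ≤ 2 * μ B := by
    calc ∫⁻ y, ‖h y‖ₑ ∂μ ≤ ∫⁻ y, B.indicator (fun _ => 2) y ∂μ := by
          refine lintegral_mono fun y => ?_
          by_cases hy : y ∈ B
          · simpa [hy] using hh_enorm y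
          · simp [Function.notMem_support.1 fun h' => hy (hhs h')]
      _ = 2 * μ B := by
          rw [lintegral_indicator_const (H.measurableSet_ball x hr)]
  have hint : ∀ g : X → ℂ, Integrable (fun y => applyL2 S g y * h y) μ := fun g =>
    (memLp_applyL2 S g).integrable_mul (hh.memLp 2)
  have hsplit : ∫ y, applyL2 S f y * h y ∂μ =
      ∫ y, applyL2 S f1 y * h y ∂μ + ∫ y, applyL2 S f2 y * h y ∂μ := by
    rw [← integral_add (hint f1) (hint f2)]
    refine integral_congr_ae ?_
    filter_upwards [hae] with y hy
    rw [hy, add_mul]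
  -- the part near the ball
  have hnear : ‖∫ y, applyL2 S f1 y * h y ∂μ‖ₑ ≤
      μ B * (2 * (H.doublingConst ^ 2 * (ρ ^ 2)⁻¹) * N * H.theta ρ s f x r) := by
    have hSm : AEStronglyMeasurable (applyL2 S f1) (H.nu x r) :=
      (memLp_applyL2 S f1).1.mono_ac (H.nu_absolutelyContinuous x r)
    have e1 : ∫⁻ y, ‖applyL2 S f1 y * h y‖ₑ ∂μ ≤
        2 * ∫⁻ y in B, ‖applyL2 S f1 y‖ₑ ∂μ := by
      rw [← lintegral_const_mul' _ _ h2, ← lintegral_indicator (H.measurableSet_ball x hr)]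
      refine lintegral_mono fun y => ?_
      rw [enorm_mul]
      by_cases hy : y ∈ B
      · rw [Set.indicator_of_mem hy, mul_comm]
        exact mul_le_mul' (hh_enorm y) le_rfl
      · simp [Function.notMem_support.1 fun h' => hy (hhs h')]
    have e2 : ∫⁻ y, ‖applyL2 S f1 y‖ₑ ∂(H.nu x r) ≤
        H.doublingConst ^ 2 * N * eLpNorm f s (H.nu x (H.c ^ 2 * r)) := by
      rw [← eLpNorm_one_eq_lintegral_enorm]
      refine (eLpNorm_le_eLpNorm_of_exponent_le hs1 hSm).trans ?_
      rw [eLpNorm_nu hs, eLpNorm_nu hs]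
      have e3 : eLpNorm (applyL2 S f1) s (μ.restrict B) ≤ N * eLpNorm f s (μ.restrict B2) := by
        refine (eLpNorm_mono_measure _ Measure.restrict_le_self).trans ((hS f1 ht1).trans ?_)
        rw [hf1, eLpNorm_indicator_eq_eLpNorm_restrict hB2]
      have e4 : (μ B)⁻¹ ^ (1 / s.toReal) ≤ H.doublingConst ^ 2 * (μ B2)⁻¹ ^ (1 / s.toReal) := by
        have e5 : (μ B)⁻¹ ≤ H.doublingConst ^ 2 * (μ B2)⁻¹ := by
          rw [← div_eq_mul_inv, ENNReal.le_div_iff_mul_le (Or.inl hμ20) (Or.inl hμ2t),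
            ENNReal.inv_mul_le_iff hμ0 hμt]
          exact (H.measure_ball_pow_le x hr 2).trans_eq (mul_comm _ _)
        calc _ ≤ (H.doublingConst ^ 2 * (μ B2)⁻¹) ^ (1 / s.toReal) := by gcongr
          _ = (H.doublingConst ^ 2) ^ (1 / s.toReal) * (μ B2)⁻¹ ^ (1 / s.toReal) :=
            ENNReal.mul_rpow_of_nonneg _ _ (by positivity)
          _ ≤ (H.doublingConst ^ 2) ^ (1 : ℝ) * (μ B2)⁻¹ ^ (1 / s.toReal) := by
            gcongr
            · exact one_le_pow₀ H.one_le_doublingConst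
            · rw [div_le_one (by linarith)]; exact hsr
          _ = _ := by rw [ENNReal.rpow_one]
      calc _ ≤ H.doublingConst ^ 2 * (μ B2)⁻¹ ^ (1 / s.toReal) *
            (N * eLpNorm f s (μ.restrict B2)) := mul_le_mul' e4 e3
        _ = _ := by ring
    have e6 : eLpNorm f s (H.nu x (H.c ^ 2 * r)) ≤ (ρ ^ 2)⁻¹ * H.theta ρ s f x r := by
      have hρ2 : ρ ^ 2 ≠ 0 := pow_ne_zero _ hρ0
      have hρ2t : ρ ^ 2 ≠ ∞ := ENNReal.pow_ne_top (hρ1.trans_lt ENNReal.one_lt_top).ne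
      rw [mul_comm (ρ ^ 2)⁻¹, ← div_eq_mul_inv,
        ENNReal.le_div_iff_mul_le (Or.inl hρ2) (Or.inl hρ2t), mul_comm _ (ρ ^ 2)]
      exact pow_mul_eLpNorm_le_theta ρ s f x r 2
    calc ‖∫ y, applyL2 S f1 y * h y ∂μ‖ₑ ≤ ∫⁻ y, ‖applyL2 S f1 y * h y‖ₑ ∂μ :=
          enorm_integral_le_lintegral_enorm _
      _ ≤ 2 * (μ B * ∫⁻ y, ‖applyL2 S f1 y‖ₑ ∂(H.nu x r)) := by
          rw [← H.setLIntegral_ball x hr]; exact e1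
      _ ≤ 2 * (μ B * (H.doublingConst ^ 2 * N * ((ρ ^ 2)⁻¹ * H.theta ρ s f x r))) := by
          gcongr
          exact e2.trans (by gcongr)
      _ = _ := by ring
  have hfarf : ‖∫ y, applyL2 S f2 y * h y ∂μ‖ₑ ≤ μ B * (2 * κ * H.theta ρ s f x r) := by
    refine (hfar x r hr f2 h (ht2.memLp 2) (hh.memLp 2) ht2.2.2 (fun y hy => ?_) hhs hZ).trans ?_
    · simp [hf2, B2, hy]
    calc _ ≤ κ * (2 * μ B) * H.theta ρ s f x r := by
          gcongr
          refine (theta_mono (fun y => ?_) x r).trans (theta_mono_exponent hs1 hf.1 x hr)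
          exact norm_indicator_le_norm_self f y
      _ = _ := by ring
  rw [hsplit]
  refine (enorm_add_le _ _).trans ((add_le_add hnear hfarf).trans ?_)
  rw [← mul_add, localConst]
  gcongr
  set θ := H.theta ρ s f x r
  set E := H.doublingConst ^ 2 * (ρ ^ 2)⁻¹
  calc 2 * E * N * θ + 2 * κ * θ ≤ 2 * E * N * θ + 2 * κ * θ + (2 * N * θ + 2 * E * κ * θ) :=
        le_self_add
    _ = _ := by ring

/-- The oscillation estimate on test functions. -/
lemma FarPairing.osc_applyL2_le [BorelSpace X]
    (hfar : H.FarPairing S ρ κ fun h => ∫ x, h x ∂μ = 0)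
    (hS : H.LpBound S s N) (hs1 : 1 ≤ s) (hs : s ≠ ∞) (hρ0 : ρ ≠ 0) (hρ1 : ρ ≤ 1)
    {f : X → ℂ} (hf : H.IsTest f) (x : X) {r : ℝ} (hr : 0 < r) :
    H.osc (applyL2 S f) x r ≤ H.localConst ρ * (N + κ) * H.theta ρ s f x r := by
  obtain ⟨h, hh, hh2, hhs, hh0, heq⟩ :=
    (H.locInt_of_memLp (by norm_num) (memLp_applyL2 S f)).exists_test_osc x hr
  rw [osc, lintegral_nu, heq, ENNReal.inv_mul_le_iff (H.measure_ball_ne_zero hr)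
    (H.measure_ball_ne_top hr)]
  exact hfar.enorm_integral_le hS hs1 hs hρ0 hρ1 hf hh hh2 hr hhs hh0

/-- The size estimate on test functions. -/
lemma FarPairing.lintegral_applyL2_le [BorelSpace X] (hfar : H.FarPairing S ρ κ fun _ => True)
    (hS : H.LpBound S s N) (hs1 : 1 ≤ s) (hs : s ≠ ∞) (hρ0 : ρ ≠ 0) (hρ1 : ρ ≤ 1)
    {f : X → ℂ} (hf : H.IsTest f) (x : X) {r : ℝ} (hr : 0 < r) :
    ∫⁻ y, ‖applyL2 S f y‖ₑ ∂(H.nu x r) ≤ H.localConst ρ * (N + κ) * H.theta ρ s f x r := by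
  obtain ⟨h, hh, hh2, hhs, heq⟩ :=
    (H.locInt_of_memLp (by norm_num) (memLp_applyL2 S f)).exists_test_size x hr
  rw [lintegral_nu, heq, ENNReal.inv_mul_le_iff (H.measure_ball_ne_zero hr)
    (H.measure_ball_ne_top hr)]
  exact hfar.enorm_integral_le hS hs1 hs hρ0 hρ1 hf hh hh2 hr hhs trivial

end Testing

/-! ### `L^q` bounds for Calderón–Zygmund operators -/

section LpBounds

lemma eLpNorm_le_mul_of_ae_le {Y ε ε' : Type*} [MeasurableSpace Y] [TopologicalSpace ε]
    [ContinuousENorm ε] [TopologicalSpace ε'] [ContinuousENorm ε'] {ν : Measure Y} {q : ℝ≥0∞}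
    (hq0 : q ≠ 0) (hq : q ≠ ∞) {f : Y → ε} {g : Y → ε'} (hg : AEStronglyMeasurable g ν) {c : ℝ≥0∞}
    (h : ∀ᵐ y ∂ν, ‖f y‖ₑ ≤ c * ‖g y‖ₑ) : eLpNorm f q ν ≤ c * eLpNorm g q ν := by
  have hq' := ENNReal.toReal_pos hq0 hq
  rw [eLpNorm_eq_lintegral_rpow_enorm_toReal hq0 hq, eLpNorm_eq_lintegral_rpow_enorm_toReal hq0 hq]
  calc (∫⁻ y, ‖f y‖ₑ ^ q.toReal ∂ν) ^ (1 / q.toReal)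
      ≤ (∫⁻ y, c ^ q.toReal * ‖g y‖ₑ ^ q.toReal ∂ν) ^ (1 / q.toReal) := by
        refine ENNReal.rpow_le_rpow (lintegral_mono_ae ?_) (by positivity)
        filter_upwards [h] with y hy
        rw [← ENNReal.mul_rpow_of_nonneg _ _ hq'.le]
        gcongr
    _ = _ := by
        rw [lintegral_const_mul'' _ (hg.enorm.pow_const _),
          ENNReal.mul_rpow_of_nonneg _ _ (by positivity), ← ENNReal.rpow_mul,
          mul_one_div_cancel hq'.ne', ENNReal.rpow_one]

variable {X : Type*} [TopologicalSpace X] [MeasurableSpace X] {μ : Measure X}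
  (H : HomogeneousStructure μ)

/-- The maximal function `(M |f| ^ s) ^ (1 / s)`. -/
def maximalPow (s : ℝ≥0∞) (f : X → ℂ) (x : X) : ℝ≥0∞ :=
  H.maximal (fun y => ‖f y‖ₑ ^ s.toReal) x ^ (1 / s.toReal)

lemma measurable_maximalPow [BorelSpace X] (s : ℝ≥0∞) (f : X → ℂ) :
    Measurable (H.maximalPow s f) :=
  (H.measurable_maximal _).pow_const _

lemma eLpNorm_nu_le_maximalPow {s : ℝ≥0∞} (hs0 : s ≠ 0) (hs : s ≠ ∞) (f : X → ℂ) {x y : X} {r : ℝ}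
    (hr : 0 < r) (hx : x ∈ H.ball y r) : eLpNorm f s (H.nu y r) ≤ H.maximalPow s f x := by
  rw [eLpNorm_eq_lintegral_rpow_enorm_toReal hs0 hs, maximalPow]
  gcongr
  exact H.le_maximal (fun y => ‖f y‖ₑ ^ s.toReal) hr hx

lemma theta_le_maximalPow {ρ s : ℝ≥0∞} (hs0 : s ≠ 0) (hs : s ≠ ∞) (f : X → ℂ) {x y : X} {r : ℝ}
    (hr : 0 < r) (hx : x ∈ H.ball y r) :
    H.theta ρ s f y r ≤ (1 - ρ)⁻¹ * H.maximalPow s f x := by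
  calc H.theta ρ s f y r ≤ ∑' i : ℕ, ρ ^ i * H.maximalPow s f x := by
        refine ENNReal.tsum_le_tsum fun i => mul_le_mul' le_rfl ?_
        exact H.eLpNorm_nu_le_maximalPow hs0 hs f (mul_pos (H.c_pow_pos i) hr)
          (H.ball_subset_mul y hr (H.one_le_c_pow i) hx)
    _ = _ := by rw [ENNReal.tsum_mul_right, ENNReal.tsum_geometric]

lemma exists_eLpNorm_maximalPow_le [BorelSpace X] [μ.Regular] {s q : ℝ≥0∞} (hs0 : s ≠ 0)
    (hsq : s < q) (hq : q ≠ ∞) :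
    ∃ C : ℝ≥0, ∀ f : X → ℂ, AEStronglyMeasurable f μ →
      eLpNorm (H.maximalPow s f) q μ ≤ C * eLpNorm f q μ := by
  have hs : s ≠ ∞ := (hsq.trans_le le_top).ne
  have hq0 : q ≠ 0 := (zero_le.trans_lt hsq).ne'
  have hs' := ENNReal.toReal_pos hs0 hs
  have hq' := ENNReal.toReal_pos hq0 hq
  have hsq' : s.toReal < q.toReal := (ENNReal.toReal_lt_toReal hs hq).2 hsq
  have hp : 1 < q.toReal / s.toReal := (one_lt_div hs').2 hsq'
  obtain ⟨C, hC⟩ := H.lintegral_maximal_rpow_le hp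
  refine ⟨C ^ (1 / q.toReal), fun f hf => ?_⟩
  rw [eLpNorm_eq_lintegral_rpow_enorm_toReal hq0 hq, eLpNorm_eq_lintegral_rpow_enorm_toReal hq0 hq,
    ENNReal.coe_rpow_of_nonneg _ (by positivity), ← ENNReal.mul_rpow_of_nonneg _ _ (by positivity)]
  refine ENNReal.rpow_le_rpow ?_ (by positivity)
  have h := hC (fun y => ‖f y‖ₑ ^ s.toReal) (hf.enorm.pow_const _)
  refine le_trans (le_of_eq (lintegral_congr fun x => ?_)) (h.trans_eq ?_)
  · rw [enorm_eq_self, maximalPow, ← ENNReal.rpow_mul]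
    congr 1
    field_simp
  · congr 1
    refine lintegral_congr fun x => ?_
    rw [← ENNReal.rpow_mul]
    congr 1
    field_simp

/-- The Fefferman–Stein inequality for `eLpNorm`. -/
lemma exists_eLpNorm_le_sharp [T2Space X] [BorelSpace X] [μ.Regular] (hH : H.ReverseDoubling)
    {q : ℝ≥0∞} (hq0 : q ≠ 0) (hq : q ≠ ∞) :
    ∃ C : ℝ≥0, ∀ F : X → ℂ, ∀ s : ℝ≥0∞, 1 < s → s ≤ q → MemLp F s μ →
      eLpNorm F q μ ≤ C * eLpNorm (H.sharp F) q μ := by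
  have hq' := ENNReal.toReal_pos hq0 hq
  obtain ⟨C, hC⟩ := H.lintegral_rpow_le_sharp hH hq'
  refine ⟨C ^ (1 / q.toReal), fun F s hs hsq hF => ?_⟩
  have hs0 : s ≠ 0 := (zero_lt_one.trans hs).ne'
  have hst : s ≠ ∞ := (hsq.trans_lt hq.lt_top).ne
  rw [eLpNorm_eq_lintegral_rpow_enorm_toReal hq0 hq, eLpNorm_eq_lintegral_rpow_enorm_toReal hq0 hq,
    ENNReal.coe_rpow_of_nonneg _ (by positivity), ← ENNReal.mul_rpow_of_nonneg _ _ (by positivity)]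
  refine ENNReal.rpow_le_rpow ?_ (by positivity)
  simp only [enorm_eq_self]
  refine hC F (H.locInt_of_memLp hs.le hF) s.toReal ?_ ((ENNReal.toReal_le_toReal hst hq).2 hsq)
    (lintegral_rpow_enorm_lt_top_of_eLpNorm_lt_top hs0 hst hF.2).ne
  rw [← ENNReal.toReal_one]
  exact (ENNReal.toReal_lt_toReal (by simp) hst).2 hs

/-- For `q > 2` the `L^q` bound follows from the oscillation estimate with `L²` means. -/
lemma exists_lpBound_of_two_lt [T2Space X] [BorelSpace X] [μ.Regular] (hH : H.ReverseDoubling)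
    {ρ : ℝ≥0∞} (hρ0 : ρ ≠ 0) (hρ1 : ρ < 1) {q : ℝ≥0∞} (hq2 : 2 < q) (hq : q ≠ ∞) :
    ∃ C : ℝ≥0, ∀ (S : Lp ℂ 2 μ →L[ℂ] Lp ℂ 2 μ) (κ : ℝ≥0∞),
      (H.FarPairing S ρ κ fun h => ∫ x, h x ∂μ = 0) → H.LpBound S q (C * (‖S‖ₑ + κ)) := by
  have hq0 : q ≠ 0 := (zero_le.trans_lt hq2).ne'
  obtain ⟨C₁, hC₁⟩ := H.exists_eLpNorm_le_sharp hH hq0 hq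
  obtain ⟨C₂, hC₂⟩ := H.exists_eLpNorm_maximalPow_le (s := 2) (by simp) hq2 hq
  have hCt : H.localConst ρ * (1 - ρ)⁻¹ ≠ ∞ := ENNReal.mul_ne_top (localConst_ne_top ρ hρ0)
    (ENNReal.inv_ne_top.2 (tsub_pos_iff_lt.2 hρ1).ne')
  refine ⟨C₁ * (H.localConst ρ * (1 - ρ)⁻¹).toNNReal * C₂, fun S κ hS f hf => ?_⟩
  push_cast
  rw [ENNReal.coe_toNNReal hCt]
  have hosc : ∀ x, H.sharp (applyL2 S f) x ≤
      H.localConst ρ * (1 - ρ)⁻¹ * (‖S‖ₑ + κ) * H.maximalPow 2 f x := by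
    refine fun x => H.sharp_le fun y r hr hx => ?_
    refine (hS.osc_applyL2_le (H.lpBound_two S) (by norm_num) (by simp) hρ0 hρ1.le hf y hr).trans ?_
    calc _ ≤ H.localConst ρ * (‖S‖ₑ + κ) * ((1 - ρ)⁻¹ * H.maximalPow 2 f x) := by
          gcongr
          exact H.theta_le_maximalPow (by simp) (by simp) f hr hx
      _ = _ := by ring
  calc eLpNorm (applyL2 S f) q μ ≤ C₁ * eLpNorm (H.sharp (applyL2 S f)) q μ :=
        hC₁ _ 2 (by norm_num) hq2.le (memLp_applyL2 S f)
    _ ≤ C₁ * (H.localConst ρ * (1 - ρ)⁻¹ * (‖S‖ₑ + κ) * eLpNorm (H.maximalPow 2 f) q μ) := by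
        gcongr
        refine eLpNorm_le_mul_of_ae_le hq0 hq
          (H.measurable_maximalPow 2 f).aestronglyMeasurable (Eventually.of_forall fun x => ?_)
        simpa only [enorm_eq_self] using hosc x
    _ ≤ C₁ * (H.localConst ρ * (1 - ρ)⁻¹ * (‖S‖ₑ + κ) * (C₂ * eLpNorm f q μ)) := by
        gcongr
        exact hC₂ f hf.1
    _ = _ := by ring

variable {H}

/-- Duality: an `L^b` bound for the adjoint gives an `L^a` bound for the conjugate exponent. -/
lemma LpBound.of_adjoint [BorelSpace X] {T : Lp ℂ 2 μ →L[ℂ] Lp ℂ 2 μ} {a b N : ℝ≥0∞}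
    (hab : a.toReal.HolderConjugate b.toReal) (ha : a ≠ ∞) (hb : b ≠ ∞)
    (h : H.LpBound (ContinuousLinearMap.adjoint T) b N) : H.LpBound T a N := by
  intro f hf
  rcases isEmpty_or_nonempty X with hX | ⟨⟨x₀⟩⟩
  · have h0 : applyL2 T f = 0 := funext fun x => isEmptyElim x
    rw [h0, eLpNorm_zero]
    exact zero_le
  have ha0 : a ≠ 0 := by rintro rfl; simpa using hab.pos
  have hb0 : b ≠ 0 := by rintro rfl; simpa using hab.symm.pos
  set p := a.toReal with hp
  set p' := b.toReal with hp'
  have hp0 : 0 < p := hab.pos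
  have hp'0 : 0 < p' := hab.symm.pos
  have hp1 : 1 < p := hab.lt
  set F := applyL2 T f with hF
  have hFm : AEStronglyMeasurable F μ := (memLp_applyL2 T f).1
  set F' := hFm.mk F with hF'
  have hF'm : StronglyMeasurable F' := hFm.stronglyMeasurable_mk
  have hFF' : F =ᵐ[μ] F' := hFm.ae_eq_mk
  set E : ℕ → Set X := fun n => H.ball x₀ ((n : ℝ) + 1) ∩ {x | ‖F' x‖ ≤ n} with hE
  have hEm : ∀ n, MeasurableSet (E n) := fun n =>
    (H.measurableSet_ball x₀ (by positivity)).inter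
      (measurableSet_le hF'm.measurable.norm measurable_const)
  have hEmono : Monotone E := fun m n hmn => Set.inter_subset_inter (H.ball_nat_mono x₀ hmn)
    fun x (hx : ‖F' x‖ ≤ m) => hx.trans (by exact_mod_cast hmn)
  have hEU : ⋃ n, E n = Set.univ := by
    refine Set.eq_univ_of_forall fun x => ?_
    obtain ⟨m, hm⟩ := Set.mem_iUnion.1 ((H.iUnion_ball x₀).symm ▸ Set.mem_univ x)
    obtain ⟨n, hn⟩ := exists_nat_ge ‖F' x‖
    refine Set.mem_iUnion.2 ⟨max m n, H.ball_nat_mono x₀ (le_max_left m n) hm, ?_⟩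
    exact hn.trans (by exact_mod_cast le_max_right m n)
  have key : ∀ n, ∫⁻ x in E n, ‖F' x‖ₑ ^ p ∂μ ≤ (N * eLpNorm f a μ) ^ p := by
    intro n
    set I := ∫⁻ x in E n, ‖F' x‖ₑ ^ p ∂μ with hI
    have hIt : I ≠ ∞ := by
      have h1 : I ≤ ∫⁻ _ in E n, (n : ℝ≥0∞) ^ p ∂μ := by
        refine setLIntegral_mono' (hEm n) fun x hx => ?_
        have : ‖F' x‖ₑ ≤ n := by
          rw [← ofReal_norm]
          exact (ENNReal.ofReal_le_ofReal hx.2).trans (by simp)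
        gcongr
      rw [setLIntegral_const] at h1
      refine (h1.trans_lt (ENNReal.mul_lt_top (ENNReal.rpow_lt_top_of_nonneg hp0.le (by simp))
        ((measure_mono Set.inter_subset_left).trans_lt
          (H.measure_ball_lt_top x₀ _ (by positivity))))).ne
    -- the dual function
    set h₀ : X → ℂ := (E n).indicator fun x => conjSign (F' x) * ((‖F' x‖ ^ (p - 1) : ℝ) : ℂ)
      with hh₀
    have hnorm : ∀ x, ‖conjSign (F' x) * ((‖F' x‖ ^ (p - 1) : ℝ) : ℂ)‖ = ‖F' x‖ ^ (p - 1) := by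
      intro x
      rw [norm_mul, Complex.norm_real, Real.norm_of_nonneg (by positivity)]
      rcases eq_or_ne (F' x) 0 with h0 | h0
      · rw [h0, norm_zero, Real.zero_rpow (by linarith), mul_zero]
      · have : ‖conjSign (F' x)‖ = 1 := by
          rw [conjSign, norm_mul, Complex.norm_real, norm_inv, norm_norm, RCLike.norm_conj]
          exact inv_mul_cancel₀ (by simpa using h0)
        rw [this, one_mul]
    have hmeas : Measurable fun x => conjSign (F' x) * ((‖F' x‖ ^ (p - 1) : ℝ) : ℂ) :=
      (measurable_conjSign.comp hF'm.measurable).mul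
        (Complex.measurable_ofReal.comp (hF'm.measurable.norm.pow_const _))
    have hh₀t : H.IsTest h₀ := by
      refine ⟨(hmeas.indicator (hEm n)).aestronglyMeasurable, ⟨(n : ℝ) ^ (p - 1), fun x => ?_⟩,
        x₀, n + 1, by positivity, Set.support_indicator_subset.trans Set.inter_subset_left⟩
      by_cases hx : x ∈ E n
      · rw [hh₀, Set.indicator_of_mem hx, hnorm]
        exact Real.rpow_le_rpow (norm_nonneg _) hx.2 (by linarith)
      · rw [hh₀, Set.indicator_of_notMem hx, norm_zero]
        positivity
    have hI1 : ‖∫ x, F x * h₀ x ∂μ‖ₑ = I := by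
      have e1 : ∫ x, F x * h₀ x ∂μ = ((∫ x in E n, ‖F' x‖ ^ p ∂μ : ℝ) : ℂ) := by
        rw [← integral_complex_ofReal, ← integral_indicator (hEm n)]
        refine integral_congr_ae ?_
        filter_upwards [hFF'] with x hx
        rw [hx]
        by_cases hxE : x ∈ E n
        · simp only [hh₀, Set.indicator_of_mem hxE]
          rw [← mul_assoc, mul_conjSign, ← Complex.ofReal_mul]
          congr 1
          rcases eq_or_ne (F' x) 0 with h0 | h0
          · simp [h0, Real.zero_rpow hp0.ne']
          · nth_rewrite 1 [← Real.rpow_one ‖F' x‖]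
            rw [← Real.rpow_add (by simpa using h0)]
            congr 1
            ring
        · simp [hh₀, hxE]
      have hnn : 0 ≤ ∫ x in E n, ‖F' x‖ ^ p ∂μ := integral_nonneg fun _ => by positivity
      rw [e1, ← ofReal_norm, Complex.norm_real, Real.norm_of_nonneg hnn,
        integral_eq_lintegral_of_nonneg_ae (Eventually.of_forall fun _ => by positivity)
          (hF'm.measurable.norm.pow_const _).aestronglyMeasurable]
      have e2 : ∫⁻ x in E n, ENNReal.ofReal (‖F' x‖ ^ p) ∂μ = I := by
        refine lintegral_congr fun x => ?_
        rw [← ENNReal.ofReal_rpow_of_nonneg (norm_nonneg _) hp0.le, ofReal_norm]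
      rw [e2, ENNReal.ofReal_toReal hIt]
    have hI2 : eLpNorm h₀ b μ = I ^ (1 / p') := by
      rw [eLpNorm_eq_lintegral_rpow_enorm_toReal hb0 hb, hI, ← lintegral_indicator (hEm n)]
      congr 1
      refine lintegral_congr fun x => ?_
      by_cases hxE : x ∈ E n
      · simp only [hh₀, Set.indicator_of_mem hxE]
        rw [← ofReal_norm, hnorm, ← ENNReal.ofReal_rpow_of_nonneg (norm_nonneg _) (by linarith),
          ofReal_norm, ← ENNReal.rpow_mul]
        congr 1
        exact hab.sub_one_mul_conj
      · simpa [hh₀, hxE] using hp'0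
    have hI3 : I ≤ N * I ^ (1 / p') * eLpNorm f a μ := by
      have e1 := enorm_integral_adjoint (ContinuousLinearMap.adjoint T) (hf.memLp 2) (hh₀t.memLp 2)
      rw [ContinuousLinearMap.adjoint_adjoint] at e1
      refine (hI1.symm.trans e1).le.trans ?_
      refine (enorm_integral_le_lintegral_enorm _).trans ?_
      simp_rw [enorm_mul, enorm_conj]
      have e2 := ENNReal.lintegral_mul_le_Lp_mul_Lq μ hab.symm
        (memLp_applyL2 (ContinuousLinearMap.adjoint T) fun x => starRingEnd ℂ (h₀ x)).1.enorm
        hf.1.enorm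
      refine e2.trans ?_
      rw [← eLpNorm_eq_lintegral_rpow_enorm_toReal ha0 ha,
        ← eLpNorm_eq_lintegral_rpow_enorm_toReal hb0 hb]
      refine mul_le_mul' ?_ le_rfl
      refine (h _ hh₀t.conj).trans_eq ?_
      rw [eLpNorm_conj, hI2]
    rcases eq_or_ne I 0 with hI0 | hI0
    · rw [hI0]; exact zero_le
    have e3 : I = I ^ (1 / p) * I ^ (1 / p') := by
      rw [← ENNReal.rpow_add _ _ hI0 hIt, one_div, one_div, hab.inv_add_inv_eq_one,
        ENNReal.rpow_one]
    have e4 : I ^ (1 / p) ≤ N * eLpNorm f a μ := by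
      have e5 : I ^ (1 / p') ≠ 0 := by simp [ENNReal.rpow_eq_zero_iff, hI0, hIt]
      have e6 : I ^ (1 / p') ≠ ∞ := ENNReal.rpow_ne_top_of_nonneg (by positivity) hIt
      refine (ENNReal.mul_le_mul_iff_left e5 e6).1 ?_
      rw [← e3]
      exact hI3.trans_eq (by ring)
    calc I = (I ^ (1 / p)) ^ p := by
          rw [← ENNReal.rpow_mul, one_div_mul_cancel hp0.ne', ENNReal.rpow_one]
      _ ≤ _ := by gcongr
  have hsup : ∫⁻ x, ‖F' x‖ₑ ^ p ∂μ ≤ (N * eLpNorm f a μ) ^ p := by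
    rw [← setLIntegral_univ, ← hEU, setLIntegral_iUnion_of_directed _ hEmono.directed_le]
    exact iSup_le key
  rw [eLpNorm_congr_ae hFF', eLpNorm_eq_lintegral_rpow_enorm_toReal ha0 ha]
  calc (∫⁻ x, ‖F' x‖ₑ ^ p ∂μ) ^ (1 / p) ≤ ((N * eLpNorm f a μ) ^ p) ^ (1 / p) := by gcongr
    _ = _ := by rw [← ENNReal.rpow_mul, mul_one_div_cancel hp0.ne', ENNReal.rpow_one]

variable (H)

/-- A Calderón–Zygmund operator is bounded on `L^q` for every `1 < q < ∞`, with norm controlled by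
its `L²` norm plus its kernel constant. -/
lemma exists_lpBound [T2Space X] [BorelSpace X] [μ.Regular] (hH : H.ReverseDoubling)
    {ε : ℝ} (hε : 0 < ε) {q : ℝ≥0∞} (hq1 : 1 < q) (hq : q ≠ ∞) :
    ∃ C : ℝ≥0, ∀ (A : ℝ) (T : Lp ℂ 2 μ →L[ℂ] Lp ℂ 2 μ), H.IsCZOperator ε A T →
      H.LpBound T q (C * (‖T‖ₑ + ENNReal.ofReal A)) := by
  have hkt := H.kernelConst_ne_top ε
  have hk1 : 1 ≤ H.kernelConst ε := by
    rw [kernelConst]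
    exact one_le_mul H.one_le_doublingConst le_self_add
  have hmono : ∀ (C : ℝ≥0) (n A : ℝ≥0∞), C * (n + H.kernelConst ε * A) ≤
      ((C * (H.kernelConst ε).toNNReal : ℝ≥0) : ℝ≥0∞) * (n + A) := by
    intro C n A
    push_cast
    rw [ENNReal.coe_toNNReal hkt, mul_assoc, mul_add (H.kernelConst ε)]
    gcongr
    exact le_mul_of_one_le_left zero_le hk1
  rcases lt_trichotomy q 2 with h2 | rfl | h2
  · have hq0 : 0 < q.toReal := ENNReal.toReal_pos (zero_lt_one.trans hq1).ne' hq
    have hq1' : 1 < q.toReal := by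
      rw [← ENNReal.toReal_one]; exact (ENNReal.toReal_lt_toReal (by simp) hq).2 hq1
    have hq2' : q.toReal < 2 := by
      rw [← ENNReal.toReal_ofNat]; exact (ENNReal.toReal_lt_toReal hq (by simp)).2 h2
    have hconj := Real.HolderConjugate.conjExponent hq1'
    set p' := q.toReal.conjExponent with hp'
    have hp'2 : 2 < p' := by
      rw [hp', Real.conjExponent, lt_div_iff₀ (by linarith)]
      linarith
    obtain ⟨C, hC⟩ := H.exists_lpBound_of_two_lt hH (H.rate_ne_zero ε) (H.rate_lt_one hε)
      (q := ENNReal.ofReal p') (by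
        rw [← ENNReal.ofReal_ofNat]
        exact (ENNReal.ofReal_lt_ofReal_iff (by linarith)).2 hp'2) (by simp)
    refine ⟨C * (H.kernelConst ε).toNNReal, fun A T ⟨_, hA, k, hk, hT⟩ => ?_⟩
    refine LpBound.of_adjoint (b := ENNReal.ofReal p') ?_ hq (by simp) ?_
    · rwa [ENNReal.toReal_ofReal (by linarith)]
    · intro f hf
      refine (hC _ _ (hT.farPairing_adjoint hk hε hA) f hf).trans ?_
      refine mul_le_mul' ?_ le_rfl
      refine le_trans (le_of_eq ?_) (hmono C ‖T‖ₑ (ENNReal.ofReal A))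
      congr 2
      rw [← ofReal_norm, ← ofReal_norm, LinearIsometryEquiv.norm_map]
  · refine ⟨1, fun A T _ f hf => (H.lpBound_two T f hf).trans ?_⟩
    gcongr
    simp
  · obtain ⟨C, hC⟩ := H.exists_lpBound_of_two_lt hH (H.rate_ne_zero ε) (H.rate_lt_one hε) h2 hq
    refine ⟨C * (H.kernelConst ε).toNNReal, fun A T ⟨_, hA, k, hk, hT⟩ f hf => ?_⟩
    refine (hC _ _ (hT.farPairing_osc hk hε hA) f hf).trans ?_
    exact mul_le_mul' (hmono C ‖T‖ₑ (ENNReal.ofReal A)) le_rfl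

/-- The oscillation and size estimates for Calderón–Zygmund operators on test functions. -/
lemma exists_osc_size_le [T2Space X] [BorelSpace X] [μ.Regular] (hH : H.ReverseDoubling)
    {ε : ℝ} (hε : 0 < ε) {s : ℝ≥0∞} (hs1 : 1 < s) (hs : s ≠ ∞) :
    ∃ C : ℝ≥0, ∀ (A : ℝ) (T : Lp ℂ 2 μ →L[ℂ] Lp ℂ 2 μ), H.IsCZOperator ε A T →
      ∀ f, H.IsTest f → ∀ (x : X) (r : ℝ), 0 < r →
        H.osc (applyL2 T f) x r ≤
          C * (‖T‖ₑ + ENNReal.ofReal A) * H.theta (H.rate ε) s f x r ∧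
        ∫⁻ y, ‖applyL2 T f y‖ₑ ∂(H.nu x r) ≤
          C * (‖T‖ₑ + ENNReal.ofReal A) * H.theta 1 s f x r := by
  obtain ⟨C, hC⟩ := H.exists_lpBound hH hε hs1 hs
  have hkt := H.kernelConst_ne_top ε
  have hl1 := localConst_ne_top (H := H) (H.rate ε) (H.rate_ne_zero ε)
  have hl2 := localConst_ne_top (H := H) 1 one_ne_zero
  refine ⟨(H.localConst (H.rate ε) + H.localConst 1).toNNReal *
    (C + 2 * (H.kernelConst ε).toNNReal), fun A T hT f hf x r hr => ?_⟩
  obtain ⟨_, hA, k, hk, hTk⟩ := id hT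
  have hN := hC A T hT
  push_cast
  rw [ENNReal.coe_toNNReal hkt, ENNReal.coe_toNNReal (ENNReal.add_ne_top.2 ⟨hl1, hl2⟩)]
  have hb : ∀ n a : ℝ≥0∞, C * (n + a) + 2 * (H.kernelConst ε * a) ≤
      (C + 2 * H.kernelConst ε) * (n + a) := by
    intro n a
    calc _ ≤ C * (n + a) + 2 * (H.kernelConst ε * (n + a)) := by gcongr; exact le_add_self
      _ = _ := by ring
  constructor
  · refine ((hTk.farPairing_osc hk hε hA).osc_applyL2_le hN hs1.le hs (H.rate_ne_zero ε)
      (H.rate_lt_one hε).le hf x hr).trans ?_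
    refine mul_le_mul' ?_ le_rfl
    rw [mul_assoc]
    refine mul_le_mul' le_self_add (le_trans ?_ (hb _ _))
    exact add_le_add le_rfl (le_mul_of_one_le_left zero_le (by norm_num))
  · refine ((hTk.farPairing_size hk hε hA).lintegral_applyL2_le hN hs1.le hs one_ne_zero
      le_rfl hf x hr).trans ?_
    refine mul_le_mul' ?_ le_rfl
    rw [mul_assoc]
    exact mul_le_mul' le_add_self (le_trans le_rfl (hb _ _))

end LpBounds

/-! ### Values of singular integrals at functions outside `L²` -/

section Admissible

variable {X : Type*} [TopologicalSpace X] [MeasurableSpace X] {μ : Measure X}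
  (H : HomogeneousStructure μ)

/-- Functions to which Calderón–Zygmund operators can be applied: the means of `|f| ^ s` over the
balls with a fixed centre decay summably. -/
def Admissible (s : ℝ≥0∞) (f : X → ℂ) : Prop :=
  AEStronglyMeasurable f μ ∧ ∀ x r, 0 < r → H.theta 1 s f x r ≠ ∞

variable {H}

lemma theta_le_mul {ρ s : ℝ≥0∞} {f g : X → ℂ} {a : ℝ≥0} (h : ∀ y, ‖f y‖ ≤ a * ‖g y‖) (x : X)
    (r : ℝ) : H.theta ρ s f x r ≤ a * H.theta ρ s g x r := by
  rw [theta, theta, ← ENNReal.tsum_mul_left]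
  refine ENNReal.tsum_le_tsum fun i => ?_
  rw [mul_left_comm]
  refine mul_le_mul' le_rfl ?_
  exact eLpNorm_le_nnreal_smul_eLpNorm_of_ae_le_mul (Eventually.of_forall fun y => h y) s

lemma theta_le_add {ρ s : ℝ≥0∞} (hs : 1 ≤ s) {f g h : X → ℂ} (hf : AEStronglyMeasurable f μ)
    (hg : AEStronglyMeasurable g μ) (hle : ∀ y, ‖h y‖ ≤ ‖f y‖ + ‖g y‖) (x : X) (r : ℝ) :
    H.theta ρ s h x r ≤ H.theta ρ s f x r + H.theta ρ s g x r := by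
  rw [theta, theta, theta, ← ENNReal.tsum_add]
  refine ENNReal.tsum_le_tsum fun i => ?_
  rw [← mul_add]
  refine mul_le_mul' le_rfl ?_
  have hac := H.nu_absolutelyContinuous x (H.c ^ i * r)
  rw [← eLpNorm_norm f, ← eLpNorm_norm g]
  refine le_trans ?_ (eLpNorm_add_le (hf.mono_ac hac).norm (hg.mono_ac hac).norm hs)
  refine eLpNorm_mono fun y => (hle y).trans ?_
  simp only [Pi.add_apply]
  exact le_abs_self _

lemma Admissible.const_mul {s : ℝ≥0∞} {f : X → ℂ} (hf : H.Admissible s f) (a : ℂ) :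
    H.Admissible s fun y => a * f y :=
  ⟨hf.1.const_mul a, fun x r hr => ne_top_of_le_ne_top
    (ENNReal.mul_ne_top ENNReal.coe_ne_top (hf.2 x r hr))
    (theta_le_mul (a := ‖a‖₊) (fun _ => (norm_mul _ _).le) x r)⟩

lemma Admissible.norm_add_norm {s : ℝ≥0∞} (hs : 1 ≤ s) {f g : X → ℂ} (hf : H.Admissible s f)
    (hg : H.Admissible s g) : H.Admissible s fun y => ((‖f y‖ + ‖g y‖ : ℝ) : ℂ) := by
  refine ⟨Complex.continuous_ofReal.comp_aestronglyMeasurable (hf.1.norm.add hg.1.norm),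
    fun x r hr => ne_top_of_le_ne_top (ENNReal.add_ne_top.2 ⟨hf.2 x r hr, hg.2 x r hr⟩)
    (theta_le_add hs hf.1 hg.1 (fun y => ?_) x r)⟩
  rw [Complex.norm_real, Real.norm_of_nonneg (by positivity)]

/-- Dominated convergence for the sums `theta`. -/
lemma Admissible.tendsto_theta {s : ℝ≥0∞} (hs0 : s ≠ 0) (hs : s ≠ ∞) {G : X → ℂ}
    (hG : H.Admissible s G) {u : ℕ → X → ℂ} (hu : ∀ n, AEStronglyMeasurable (u n) μ) {a : ℝ≥0}
    (hle : ∀ n y, ‖u n y‖ ≤ a * ‖G y‖) (hlim : ∀ᵐ y ∂μ, Tendsto (fun n => u n y) atTop (𝓝 0))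
    (x : X) {r : ℝ} (hr : 0 < r) :
    Tendsto (fun n => H.theta 1 s (u n) x r) atTop (𝓝 0) := by
  have hs' := ENNReal.toReal_pos hs0 hs
  have hfin := hG.2 x r hr
  have hterm : ∀ i, eLpNorm G s (H.nu x (H.c ^ i * r)) ≠ ∞ := fun i =>
    ne_top_of_le_ne_top hfin (by simpa using H.pow_mul_eLpNorm_le_theta 1 s G x r i)
  have hbd : ∀ n y, ‖u n y‖ₑ ≤ a * ‖G y‖ₑ := fun n y => by
    have h : ‖u n y‖₊ ≤ a * ‖G y‖₊ := by exact_mod_cast hle n y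
    rw [enorm_eq_nnnorm, enorm_eq_nnnorm]
    exact_mod_cast h
  have hi : ∀ i, Tendsto (fun n => eLpNorm (u n) s (H.nu x (H.c ^ i * r))) atTop (𝓝 0) := by
    intro i
    have hac := H.nu_absolutelyContinuous x (H.c ^ i * r)
    simp_rw [eLpNorm_eq_lintegral_rpow_enorm_toReal hs0 hs]
    have h1 : Tendsto (fun n => ∫⁻ y, ‖u n y‖ₑ ^ s.toReal ∂(H.nu x (H.c ^ i * r))) atTop
        (𝓝 (∫⁻ _, 0 ∂(H.nu x (H.c ^ i * r)))) := by
      refine tendsto_lintegral_of_dominated_convergence'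
        (fun y => (a * ‖G y‖ₑ) ^ s.toReal) (fun n => ((hu n).mono_ac hac).enorm.pow_const _)
        (fun n => Eventually.of_forall fun y => ENNReal.rpow_le_rpow (hbd n y) hs'.le) ?_ ?_
      · simp_rw [ENNReal.mul_rpow_of_nonneg _ _ hs'.le]
        rw [lintegral_const_mul'' _ ((hG.1.mono_ac hac).enorm.pow_const _)]
        exact ENNReal.mul_ne_top (ENNReal.rpow_ne_top_of_nonneg hs'.le (by simp))
          (lintegral_rpow_enorm_lt_top_of_eLpNorm_lt_top hs0 hs (hterm i).lt_top).ne
      · filter_upwards [hac.ae_le hlim] with y hy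
        have h2 : Tendsto (fun n => ‖u n y‖ₑ) atTop (𝓝 0) := by
          simpa using hy.enorm
        simpa [hs'] using h2.ennrpow_const s.toReal
    rw [lintegral_zero] at h1
    simpa [hs'] using h1.ennrpow_const (1 / s.toReal)
  have h2 : Tendsto (fun n => ∫⁻ i : ℕ, eLpNorm (u n) s (H.nu x (H.c ^ i * r)) ∂Measure.count) atTop
      (𝓝 (∫⁻ _ : ℕ, 0 ∂Measure.count)) := by
    refine tendsto_lintegral_of_dominated_convergence
      (fun i => a * eLpNorm G s (H.nu x (H.c ^ i * r))) (fun n => measurable_of_countable _)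
      (fun n => Eventually.of_forall fun i => ?_) ?_ (Eventually.of_forall hi)
    · exact eLpNorm_le_nnreal_smul_eLpNorm_of_ae_le_mul (Eventually.of_forall fun y => hle n y) s
    · rw [lintegral_count, ENNReal.tsum_mul_left]
      refine ENNReal.mul_ne_top (by simp) ?_
      simpa [theta] using hfin
  simpa [lintegral_count, theta] using h2

lemma norm_trunc_le (x₀ : X) (n : ℕ) (f : X → ℂ) (y : X) : ‖H.trunc x₀ n f y‖ ≤ ‖f y‖ :=
  norm_indicator_le_norm_self f y

lemma isTest_trunc [OpensMeasurableSpace X] {f : X → ℂ} (hf : AEStronglyMeasurable f μ) (x₀ : X)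
    (n : ℕ) : H.IsTest (H.trunc x₀ n f) := by
  have hm : NullMeasurableSet (H.ball x₀ (n + 1) ∩ {x | ‖f x‖ ≤ n + 1}) μ :=
    (H.measurableSet_ball x₀ (by positivity)).nullMeasurableSet.inter
      (nullMeasurableSet_le hf.norm.aemeasurable aemeasurable_const)
  have hm' : AEStronglyMeasurable (H.trunc x₀ n f) μ := hf.indicator₀ hm
  have hb : ∀ y, ‖H.trunc x₀ n f y‖ ≤ n + 1 := fun y => by
    by_cases hy : y ∈ H.ball x₀ (n + 1) ∩ {x | ‖f x‖ ≤ n + 1}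
    · rw [trunc, Set.indicator_of_mem hy]
      exact hy.2
    · rw [trunc, Set.indicator_of_notMem hy, norm_zero]
      positivity
  exact ⟨hm', ⟨n + 1, hb⟩, x₀, n + 1, by positivity,
    Set.support_indicator_subset.trans Set.inter_subset_left⟩

lemma tendsto_trunc (x₀ : X) (f : X → ℂ) (y : X) :
    Tendsto (fun n => H.trunc x₀ n f y) atTop (𝓝 (f y)) := by
  obtain ⟨m, hm⟩ := Set.mem_iUnion.1 ((H.iUnion_ball x₀).symm ▸ Set.mem_univ y)
  obtain ⟨k, hk⟩ := exists_nat_ge ‖f y‖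
  refine tendsto_atTop_of_eventually_const (i₀ := max m k) fun n hn => ?_
  have hkn : (k : ℝ) ≤ n := by exact_mod_cast (le_max_right m k).trans hn
  have hy : y ∈ H.ball x₀ (n + 1) ∩ {x | ‖f x‖ ≤ n + 1} :=
    ⟨H.ball_nat_mono x₀ ((le_max_left m k).trans hn) hm, (hk.trans hkn).trans (by linarith)⟩
  exact Set.indicator_of_mem hy f

end Admissible

section Values

variable {X : Type*} [TopologicalSpace X] [MeasurableSpace X] {μ : Measure X}
  (H : HomogeneousStructure μ)

/-- The local `L¹` estimate for an operator on test functions. -/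
def SizeBound (T : Lp ℂ 2 μ →L[ℂ] Lp ℂ 2 μ) (s N : ℝ≥0∞) : Prop :=
  ∀ f, H.IsTest f → ∀ x r, 0 < r →
    ∫⁻ y, ‖applyL2 T f y‖ₑ ∂(H.nu x r) ≤ N * H.theta 1 s f x r

/-- Convergence in `L¹` on every ball. -/
def LocTendsto (v : ℕ → X → ℂ) (u : X → ℂ) : Prop :=
  ∀ x r, 0 < r → Tendsto (fun n => ∫⁻ y, ‖v n y - u y‖ₑ ∂(H.nu x r)) atTop (𝓝 0)

variable {H}

lemma locTendsto_iff {v : ℕ → X → ℂ} {u : X → ℂ} : H.LocTendsto v u ↔ ∀ x r, 0 < r →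
    Tendsto (fun n => ∫⁻ y in H.ball x r, ‖v n y - u y‖ₑ ∂μ) atTop (𝓝 0) := by
  refine forall₂_congr fun x r => forall_congr' fun hr => ⟨fun h => ?_, fun h => ?_⟩
  · simp_rw [H.setLIntegral_ball x hr]
    simpa using ENNReal.Tendsto.const_mul h (Or.inr (H.measure_ball_ne_top hr))
  · simp_rw [H.lintegral_nu]
    simpa using ENNReal.Tendsto.const_mul h
      (Or.inr (ENNReal.inv_ne_top.2 (H.measure_ball_ne_zero hr)))

lemma hasValue_iff {T : Lp ℂ 2 μ →L[ℂ] Lp ℂ 2 μ} {f u : X → ℂ} : H.HasValue T f u ↔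
    AEStronglyMeasurable f μ ∧ AEStronglyMeasurable u μ ∧
      ∀ x₀, H.LocTendsto (fun n => applyL2 T (H.trunc x₀ n f)) u := by
  simp only [HasValue, locTendsto_iff]

lemma lintegral_enorm_sub_le {Y : Type*} [MeasurableSpace Y] {ν : Measure Y} {f g h : Y → ℂ}
    (hf : AEStronglyMeasurable f ν) (hg : AEStronglyMeasurable g ν) :
    ∫⁻ y, ‖f y - h y‖ₑ ∂ν ≤ ∫⁻ y, ‖f y - g y‖ₑ ∂ν + ∫⁻ y, ‖g y - h y‖ₑ ∂ν := by
  rw [← lintegral_add_left' (show AEMeasurable (fun y => ‖f y - g y‖ₑ) ν from (hf.sub hg).enorm)]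
  refine lintegral_mono fun y => ?_
  rw [← sub_add_sub_cancel (f y) (g y) (h y)]
  exact enorm_add_le _ _

/-- If `v n → u` and `v n - w n → 0` in `L¹` on every ball, then `w n → u`. -/
lemma LocTendsto.congr {v w : ℕ → X → ℂ} {u : X → ℂ} (hv : H.LocTendsto v u)
    (hvm : ∀ n, AEStronglyMeasurable (v n) μ) (hwm : ∀ n, AEStronglyMeasurable (w n) μ)
    (h : H.LocTendsto (fun n y => w n y - v n y) 0) : H.LocTendsto w u := by
  intro x r hr
  have hac := H.nu_absolutelyContinuous x r
  have h1 := (h x r hr).add (hv x r hr)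
  rw [add_zero] at h1
  refine tendsto_of_tendsto_of_tendsto_of_le_of_le tendsto_const_nhds h1 (fun _ => zero_le)
    fun n => ?_
  simpa using lintegral_enorm_sub_le (h := u) ((hwm n).mono_ac hac) ((hvm n).mono_ac hac)

/-- Local `L¹` limits exist for locally Cauchy sequences. -/
lemma exists_locTendsto [OpensMeasurableSpace X] {v : ℕ → X → ℂ} (hv : ∀ n, H.LocInt (v n))
    (hc : ∀ x r, 0 < r → Tendsto (fun n : ℕ × ℕ => ∫⁻ y, ‖v n.1 y - v n.2 y‖ₑ ∂(H.nu x r)) atTop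
      (𝓝 0)) : ∃ u, AEStronglyMeasurable u μ ∧ H.LocTendsto v u := by
  classical
  rcases isEmpty_or_nonempty X with hX | ⟨⟨x₀⟩⟩
  · refine ⟨0, aestronglyMeasurable_zero, fun x => isEmptyElim x⟩
  have hr : ∀ N : ℕ, (0 : ℝ) < N + 1 := fun N => by positivity
  set B : ℕ → Set X := fun N => H.ball x₀ ((N : ℝ) + 1) with hB
  have hBmono : Monotone B := H.ball_nat_mono x₀
  have hBU : ⋃ N, B N = Set.univ := H.iUnion_ball x₀
  -- the limit on each ball of an exhausting sequence
  have h1 : ∀ N, ∃ u : X → ℂ, AEStronglyMeasurable u (μ.restrict (B N)) ∧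
      Tendsto (fun n => ∫⁻ y in B N, ‖v n y - u y‖ₑ ∂μ) atTop (𝓝 0) := by
    intro N
    have hm : ∀ n, MemLp (v n) 1 (μ.restrict (B N)) := fun n =>
      memLp_one_iff_integrable.2 (hv n x₀ _ (hr N))
    have hcau : CauchySeq fun n => (hm n).toLp (v n) := by
      rw [Lp.cauchySeq_Lp_iff_cauchySeq_eLpNorm]
      have e := ENNReal.Tendsto.const_mul (hc x₀ _ (hr N))
        (Or.inr (H.measure_ball_ne_top (x := x₀) (hr N)))
      rw [mul_zero] at e
      refine e.congr fun n => ?_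
      rw [← H.setLIntegral_ball x₀ (hr N), eLpNorm_one_eq_lintegral_enorm]
      refine lintegral_congr_ae ?_
      filter_upwards [(hm n.1).coeFn_toLp, (hm n.2).coeFn_toLp] with y h1 h2
      simp [h1, h2]
    obtain ⟨u, hu⟩ := cauchySeq_tendsto_of_complete hcau
    refine ⟨u, Lp.aestronglyMeasurable u, ?_⟩
    rw [Lp.tendsto_Lp_iff_tendsto_eLpNorm'] at hu
    refine hu.congr fun n => ?_
    rw [eLpNorm_one_eq_lintegral_enorm]
    refine lintegral_congr_ae ?_
    filter_upwards [(hm n).coeFn_toLp] with y h1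
    simp [h1]
  choose U hUm hU using h1
  have hcompat : ∀ N M, N ≤ M → U N =ᵐ[μ.restrict (B N)] U M := by
    intro N M hNM
    have hle : μ.restrict (B N) ≤ μ.restrict (B M) := Measure.restrict_mono_set _ (hBmono hNM)
    have hM' : AEStronglyMeasurable (U M) (μ.restrict (B N)) :=
      (hUm M).mono_measure hle
    have e0 : ∫⁻ y in B N, ‖U N y - U M y‖ₑ ∂μ = 0 := by
      have e1 := (hU N).add (hU M)
      rw [add_zero] at e1
      refine le_antisymm (ge_of_tendsto' e1 fun n => ?_) zero_le
      refine (lintegral_enorm_sub_le (hUm N) (hv n x₀ _ (hr N)).aestronglyMeasurable).trans ?_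
      refine add_le_add (le_of_eq (lintegral_congr fun y => enorm_sub_rev _ _)) ?_
      exact lintegral_mono_set (hBmono hNM)
    rw [lintegral_eq_zero_iff' (show AEMeasurable (fun y => ‖U N y - U M y‖ₑ) _ from
      ((hUm N).sub hM').enorm)] at e0
    filter_upwards [e0] with y hy
    simpa [sub_eq_zero] using hy
  have hex : ∀ y, ∃ N, y ∈ B N := fun y => Set.mem_iUnion.1 (hBU.symm ▸ Set.mem_univ y)
  set u : X → ℂ := fun y => U (Nat.find (hex y)) y with hu
  have huU : ∀ M, u =ᵐ[μ.restrict (B M)] U M := by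
    intro M
    have e1 : ∀ N ≤ M, ∀ᵐ y ∂μ.restrict (B M), y ∈ B N → U N y = U M y := fun N hN => by
      have e2 := ae_imp_of_ae_restrict (hcompat N M hN)
      exact ae_mono Measure.restrict_le_self e2
    have e3 : ∀ᵐ y ∂μ.restrict (B M), ∀ N : ℕ, N ≤ M → y ∈ B N → U N y = U M y := by
      rw [ae_all_iff]
      intro N
      by_cases hN : N ≤ M
      · filter_upwards [e1 N hN] with y hy _ using hy
      · exact Eventually.of_forall fun y h => absurd h hN
    have e4 : ∀ᵐ y ∂μ.restrict (B M), y ∈ B M := by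
      exact ae_restrict_mem (H.measurableSet_ball x₀ (hr M))
    filter_upwards [e3, e4] with y h1 h2
    exact h1 _ (Nat.find_min' _ h2) (Nat.find_spec (hex y))
  refine ⟨u, ?_, ?_⟩
  · rw [← Measure.restrict_univ (μ := μ), ← hBU, aestronglyMeasurable_iUnion_iff]
    exact fun M => (hUm M).congr (huU M).symm
  · rw [locTendsto_iff]
    intro x r hr
    obtain ⟨N, hN⟩ := H.exists_ball_subset x₀ x hr
    refine tendsto_of_tendsto_of_tendsto_of_le_of_le tendsto_const_nhds (hU N) (fun _ => zero_le)
      fun n => (lintegral_mono_set hN).trans_eq (lintegral_congr_ae ?_)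
    filter_upwards [huU N] with y hy
    rw [hy]

variable {T : Lp ℂ 2 μ →L[ℂ] Lp ℂ 2 μ} {s N : ℝ≥0∞}

lemma SizeBound.lintegral_sub_le (hT : H.SizeBound T s N) {f g : X → ℂ} (hf : H.IsTest f)
    (hg : H.IsTest g) (x : X) {r : ℝ} (hr : 0 < r) :
    ∫⁻ y, ‖applyL2 T f y - applyL2 T g y‖ₑ ∂(H.nu x r) ≤
      N * H.theta 1 s (fun y => f y - g y) x r := by
  refine le_trans (le_of_eq (lintegral_congr_ae ?_)) (hT _ (hf.sub hg) x r hr)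
  filter_upwards [(H.nu_absolutelyContinuous x r).ae_le
    (applyL2_sub_ae T (hf.memLp 2) (hg.memLp 2))] with y hy
  rw [hy]

/-- The images of two dominated sequences of test functions with the same pointwise limit are
asymptotically equal. -/
lemma SizeBound.locTendsto_sub (hT : H.SizeBound T s N) (hN : N ≠ ∞) (hs0 : s ≠ 0) (hs : s ≠ ∞)
    {G : X → ℂ} (hG : H.Admissible s G) {f g : ℕ → X → ℂ} (hf : ∀ n, H.IsTest (f n))
    (hg : ∀ n, H.IsTest (g n)) (hfG : ∀ n y, ‖f n y‖ ≤ ‖G y‖) (hgG : ∀ n y, ‖g n y‖ ≤ ‖G y‖)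
    (hlim : ∀ᵐ y ∂μ, Tendsto (fun n => f n y - g n y) atTop (𝓝 0)) :
    H.LocTendsto (fun n y => applyL2 T (f n) y - applyL2 T (g n) y) 0 := by
  intro x r hr
  have h1 := hG.tendsto_theta hs0 hs (u := fun n y => f n y - g n y) (a := 2)
    (fun n => (hf n).1.sub (hg n).1) (fun n y => (norm_sub_le _ _).trans (by
      have := hfG n y
      have := hgG n y
      push_cast
      linarith)) hlim x hr
  have h2 := ENNReal.Tendsto.const_mul h1 (Or.inr hN)
  rw [mul_zero] at h2
  refine tendsto_of_tendsto_of_tendsto_of_le_of_le tendsto_const_nhds h2 (fun _ => zero_le)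
    fun n => ?_
  simpa using hT.lintegral_sub_le (hf n) (hg n) x hr

/-- A value can be computed along any dominated sequence of test functions. -/
lemma SizeBound.hasValue [OpensMeasurableSpace X] (hT : H.SizeBound T s N) (hN : N ≠ ∞) (hs0 : s ≠ 0) (hs : s ≠ ∞)
    {f u G : X → ℂ} (hf : AEStronglyMeasurable f μ) (hu : AEStronglyMeasurable u μ)
    (hG : H.Admissible s G) (hfG : ∀ y, ‖f y‖ ≤ ‖G y‖) {g : ℕ → X → ℂ} (hg : ∀ n, H.IsTest (g n))
    (hgG : ∀ n y, ‖g n y‖ ≤ ‖G y‖) (hlim : ∀ᵐ y ∂μ, Tendsto (fun n => g n y) atTop (𝓝 (f y)))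
    (h : H.LocTendsto (fun n => applyL2 T (g n)) u) : H.HasValue T f u := by
  rw [hasValue_iff]
  refine ⟨hf, hu, fun x₀ => h.congr (fun n => (memLp_applyL2 T _).1)
    (fun n => (memLp_applyL2 T _).1) ?_⟩
  refine hT.locTendsto_sub hN hs0 hs hG (fun n => isTest_trunc hf x₀ n) hg
    (fun n y => (norm_trunc_le x₀ n f y).trans (hfG y)) hgG ?_
  filter_upwards [hlim] with y hy
  simpa using (tendsto_trunc (H := H) x₀ f y).sub hy

/-- Values exist at admissible functions. -/
lemma SizeBound.exists_hasValue [OpensMeasurableSpace X] (hT : H.SizeBound T s N) (hN : N ≠ ∞) (hs1 : 1 ≤ s) (hs : s ≠ ∞)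
    {f : X → ℂ} (hf : H.Admissible s f) : ∃ u, H.HasValue T f u := by
  have hs0 : s ≠ 0 := (zero_lt_one.trans_le hs1).ne'
  rcases isEmpty_or_nonempty X with hX | ⟨⟨x₀⟩⟩
  · exact ⟨0, hf.1, aestronglyMeasurable_zero, fun x => isEmptyElim x⟩
  have ht : ∀ n, H.IsTest (H.trunc x₀ n f) := fun n => isTest_trunc hf.1 x₀ n
  obtain ⟨u, hum, hu⟩ := exists_locTendsto (H := H) (v := fun n => applyL2 T (H.trunc x₀ n f))
    (fun n => H.locInt_of_memLp one_le_two (memLp_applyL2 T _)) fun x r hr => by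
      have h1 : Tendsto (fun n => H.theta 1 s (fun y => H.trunc x₀ n f y - f y) x r) atTop
          (𝓝 0) := by
        refine hf.tendsto_theta hs0 hs (a := 2) (fun n => (ht n).1.sub hf.1) (fun n y => ?_)
          (Eventually.of_forall fun y => ?_) x hr
        · have := norm_trunc_le (H := H) x₀ n f y
          refine (norm_sub_le _ _).trans ?_
          push_cast
          linarith
        · simpa using (tendsto_trunc (H := H) x₀ f y).sub_const (f y)
      have h2 : Tendsto (fun n : ℕ × ℕ => N * (H.theta 1 s (fun y => H.trunc x₀ n.1 f y - f y) x r +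
          H.theta 1 s (fun y => H.trunc x₀ n.2 f y - f y) x r)) atTop (𝓝 0) := by
        rw [← prod_atTop_atTop_eq]
        have := ENNReal.Tendsto.const_mul ((h1.comp tendsto_fst).add (h1.comp tendsto_snd))
          (Or.inr hN)
        simpa using this
      refine tendsto_of_tendsto_of_tendsto_of_le_of_le tendsto_const_nhds h2 (fun _ => zero_le)
        fun n => (hT.lintegral_sub_le (ht n.1) (ht n.2) x hr).trans (mul_le_mul' le_rfl ?_)
      refine theta_le_add hs1 ((ht n.1).1.sub hf.1) ((ht n.2).1.sub hf.1) (fun y => ?_) x r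
      simp only [Pi.sub_apply]
      rw [← sub_sub_sub_cancel_right _ _ (f y)]
      exact norm_sub_le _ _
  exact ⟨u, hT.hasValue hN hs0 hs hf.1 hum hf (fun _ => le_rfl) ht
    (fun n y => norm_trunc_le x₀ n f y) (Eventually.of_forall fun y => tendsto_trunc x₀ f y) hu⟩

lemma HasValue.ext {f u : X → ℂ} (h : H.HasValue T f u) : H.HasValue T f (H.ext T f) := by
  have h' : ∃ u, H.HasValue T f u := ⟨u, h⟩
  rw [HomogeneousStructure.ext, dif_pos h']
  exact h'.choose_spec

end Values

/-! ### Estimates for values -/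

section Homogeneity

variable {X : Type*} [MeasurableSpace X] {μ : Measure X}

lemma applyL2_const_mul_ae (T : Lp ℂ 2 μ →L[ℂ] Lp ℂ 2 μ) {f : X → ℂ} (hf : MemLp f 2 μ) (a : ℂ) :
    applyL2 T (fun y => a * f y) =ᵐ[μ] fun y => a * applyL2 T f y := by
  have h1 : applyL2 T (fun y => a * f y) = T (a • hf.toLp f) :=
    applyL2_of_memLp T (hf.const_mul a)
  rw [h1, map_smul, applyL2_of_memLp T hf]
  exact Lp.coeFn_smul _ _

end Homogeneity

section ValueEstimates

variable {X : Type*} [TopologicalSpace X] [MeasurableSpace X] {μ : Measure X}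
  (H : HomogeneousStructure μ)

/-- The local oscillation estimate for an operator on test functions. -/
def OscBound (T : Lp ℂ 2 μ →L[ℂ] Lp ℂ 2 μ) (ρ s N : ℝ≥0∞) : Prop :=
  ∀ f, H.IsTest f → ∀ x r, 0 < r → H.osc (applyL2 T f) x r ≤ N * H.theta ρ s f x r

variable {H}

lemma LocTendsto.locInt {v : ℕ → X → ℂ} {u : X → ℂ} (h : H.LocTendsto v u)
    (hv : ∀ n, H.LocInt (v n)) (hu : AEStronglyMeasurable u μ) : H.LocInt u := by
  intro x r hr
  refine ⟨hu.restrict, ?_⟩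
  obtain ⟨n, hn⟩ := (((locTendsto_iff.1 h) x r hr).eventually (gt_mem_nhds zero_lt_one)).exists
  have h1 := (hv n x r hr).2
  rw [hasFiniteIntegral_iff_enorm] at h1 ⊢
  have h2 := lintegral_enorm_sub_le (h := 0) hu.restrict (hv n x r hr).aestronglyMeasurable
  simp only [Pi.zero_apply, sub_zero] at h2
  refine h2.trans_lt (ENNReal.add_lt_top.2 ⟨lt_of_le_of_lt (le_of_eq ?_) (hn.trans
    ENNReal.one_lt_top), h1⟩)
  exact lintegral_congr fun y => enorm_sub_rev _ _

lemma HasValue.locInt {T : Lp ℂ 2 μ →L[ℂ] Lp ℂ 2 μ} {f u : X → ℂ} (h : H.HasValue T f u) :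
    H.LocInt u := by
  rcases isEmpty_or_nonempty X with hX | ⟨⟨x₀⟩⟩
  · exact fun x => isEmptyElim x
  rw [hasValue_iff] at h
  exact (h.2.2 x₀).locInt (fun n => H.locInt_of_memLp one_le_two (memLp_applyL2 T _)) h.2.1

/-- Oscillation is continuous for convergence in the mean. -/
lemma LocInt.osc_le_add {u v : X → ℂ} (hu : H.LocInt u) (hv : H.LocInt v) (x : X) {r : ℝ}
    (hr : 0 < r) : H.osc u x r ≤ H.osc v x r + 2 * ∫⁻ y, ‖v y - u y‖ₑ ∂(H.nu x r) := by
  have hprob := H.isProbabilityMeasure_nu x hr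
  have hui := hu.integrable_nu x hr
  have hvi := hv.integrable_nu x hr
  have h1 : ‖H.mean v x r - H.mean u x r‖ₑ ≤ ∫⁻ y, ‖v y - u y‖ₑ ∂(H.nu x r) := by
    rw [mean, mean, ← integral_sub hvi hui]
    exact enorm_integral_le_lintegral_enorm _
  have e1 := lintegral_enorm_sub_le (h := fun _ => H.mean u x r) hui.1 hvi.1
  have e2 := lintegral_enorm_sub_le (h := fun _ => H.mean u x r) hvi.1
    (aestronglyMeasurable_const (b := H.mean v x r))
  rw [lintegral_const, measure_univ, mul_one] at e2
  refine e1.trans ((add_le_add le_rfl (e2.trans (add_le_add le_rfl h1))).trans_eq ?_)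
  have e3 : ∫⁻ y, ‖u y - v y‖ₑ ∂(H.nu x r) = ∫⁻ y, ‖v y - u y‖ₑ ∂(H.nu x r) :=
    lintegral_congr fun y => enorm_sub_rev _ _
  rw [e3, osc, two_mul]
  ring

/-- Lower semicontinuity of the `L^p` norm for local `L¹` convergence. -/
lemma LocTendsto.eLpNorm_le {p : ℝ≥0∞} (hp0 : p ≠ 0) (hp : p ≠ ∞) {v : ℕ → X → ℂ} {u : X → ℂ}
    (h : H.LocTendsto v u) (hv : ∀ n, AEStronglyMeasurable (v n) μ)
    (hu : AEStronglyMeasurable u μ) {a : ℝ≥0∞} (ha : ∀ n, eLpNorm (v n) p μ ≤ a) :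
    eLpNorm u p μ ≤ a := by
  rcases isEmpty_or_nonempty X with hX | ⟨⟨x₀⟩⟩
  · have h0 : u = 0 := funext fun x => isEmptyElim x
    rw [h0, eLpNorm_zero]
    exact zero_le
  have hp' := ENNReal.toReal_pos hp0 hp
  have h1 : ∀ N : ℕ, eLpNorm u p (μ.restrict (H.ball x₀ ((N : ℝ) + 1))) ≤ a := by
    intro N
    have h2 := locTendsto_iff.1 h x₀ (N + 1) (by positivity)
    have h3 : TendstoInMeasure (μ.restrict (H.ball x₀ ((N : ℝ) + 1))) v atTop u := by
      refine tendstoInMeasure_of_tendsto_eLpNorm one_ne_zero (fun n => (hv n).restrict) hu.restrict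
        ?_
      simp_rw [eLpNorm_one_eq_lintegral_enorm]
      exact h2
    obtain ⟨k, -, hk⟩ := h3.exists_seq_tendsto_ae
    exact Lp.eLpNorm_le_of_ae_tendsto (Eventually.of_forall fun n =>
      (eLpNorm_mono_measure _ Measure.restrict_le_self).trans
      (ha (k n))) (fun n => (hv (k n)).restrict) hk
  rw [eLpNorm_eq_lintegral_rpow_enorm_toReal hp0 hp, one_div, ENNReal.rpow_inv_le_iff hp',
    ← setLIntegral_univ, ← H.iUnion_ball x₀,
    setLIntegral_iUnion_of_directed _ (H.ball_nat_mono x₀).directed_le]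
  refine iSup_le fun N => ?_
  have h4 := h1 N
  rwa [eLpNorm_eq_lintegral_rpow_enorm_toReal hp0 hp, one_div, ENNReal.rpow_inv_le_iff hp'] at h4

variable {T : Lp ℂ 2 μ →L[ℂ] Lp ℂ 2 μ} {ρ s N : ℝ≥0∞}

lemma SizeBound.lintegral_value_le [OpensMeasurableSpace X] (hT : H.SizeBound T s N) {f u : X → ℂ}
    (h : H.HasValue T f u) (x : X) {r : ℝ} (hr : 0 < r) :
    ∫⁻ y, ‖u y‖ₑ ∂(H.nu x r) ≤ N * H.theta 1 s f x r := by
  have hac := H.nu_absolutelyContinuous x r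
  rw [hasValue_iff] at h
  have h1 := (h.2.2 x x r hr).const_add (N * H.theta 1 s f x r)
  rw [add_zero] at h1
  refine ge_of_tendsto' h1 fun n => ?_
  have h2 := lintegral_enorm_sub_le (h := 0) (h.2.1.mono_ac hac)
    ((memLp_applyL2 T (H.trunc x n f)).1.mono_ac hac)
  simp only [Pi.zero_apply, sub_zero] at h2
  rw [add_comm]
  refine h2.trans (add_le_add (le_of_eq (lintegral_congr fun y => enorm_sub_rev _ _)) ?_)
  exact (hT _ (isTest_trunc h.1 x n) x r hr).trans
    (mul_le_mul' le_rfl (theta_mono (norm_trunc_le x n f) x r))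

lemma OscBound.osc_value_le [OpensMeasurableSpace X] (hT : H.OscBound T ρ s N) {f u : X → ℂ}
    (h : H.HasValue T f u) (x : X) {r : ℝ} (hr : 0 < r) :
    H.osc u x r ≤ N * H.theta ρ s f x r := by
  have hu := h.locInt
  rw [hasValue_iff] at h
  have h1 := (ENNReal.Tendsto.const_mul (a := 2) (h.2.2 x x r hr) (Or.inr (by simp))).const_add
    (N * H.theta ρ s f x r)
  rw [mul_zero, add_zero] at h1
  refine ge_of_tendsto' h1 fun n => (hu.osc_le_add
    (H.locInt_of_memLp one_le_two (memLp_applyL2 T (H.trunc x n f))) x hr).trans ?_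
  refine add_le_add ?_ le_rfl
  exact (hT _ (isTest_trunc h.1 x n) x r hr).trans
    (mul_le_mul' le_rfl (theta_mono (norm_trunc_le x n f) x r))

lemma LpBound.eLpNorm_value_le [OpensMeasurableSpace X] {p : ℝ≥0∞} (hp0 : p ≠ 0) (hp : p ≠ ∞)
    (hT : H.LpBound T p N) {f u : X → ℂ} (h : H.HasValue T f u) :
    eLpNorm u p μ ≤ N * eLpNorm f p μ := by
  rcases isEmpty_or_nonempty X with hX | ⟨⟨x₀⟩⟩
  · have h0 : u = 0 := funext fun x => isEmptyElim x
    rw [h0, eLpNorm_zero]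
    exact zero_le
  rw [hasValue_iff] at h
  refine (h.2.2 x₀).eLpNorm_le hp0 hp (fun n => (memLp_applyL2 T _).1) h.2.1 fun n => ?_
  exact (hT _ (isTest_trunc h.1 x₀ n)).trans
    (mul_le_mul' le_rfl (eLpNorm_mono (norm_trunc_le x₀ n f)))

lemma IsTest.const_mul {f : X → ℂ} (hf : H.IsTest f) (a : ℂ) : H.IsTest fun y => a * f y := by
  obtain ⟨hm, ⟨M, hM⟩, x, r, hr, hs⟩ := hf
  refine ⟨hm.const_mul a, ⟨‖a‖ * M, fun y => ?_⟩, x, r, hr, fun y hy => hs fun h => hy ?_⟩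
  · rw [norm_mul]
    exact mul_le_mul_of_nonneg_left (hM y) (norm_nonneg a)
  · simp [h]

/-- Values depend linearly on the function. -/
lemma SizeBound.hasValue_sub_const_mul [OpensMeasurableSpace X] (hT : H.SizeBound T s N)
    (hN : N ≠ ∞) (hs1 : 1 ≤ s) (hs : s ≠ ∞) {f g u v : X → ℂ} (hf : H.Admissible s f)
    (hg : H.Admissible s g) (hu : H.HasValue T f u) (hv : H.HasValue T g v) (a : ℂ) :
    H.HasValue T (fun y => f y - a * g y) (fun y => u y - a * v y) := by
  rcases isEmpty_or_nonempty X with hX | ⟨⟨x₀⟩⟩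
  · have e1 : (fun y => f y - a * g y) = f := funext fun x => isEmptyElim x
    have e2 : (fun y => u y - a * v y) = u := funext fun x => isEmptyElim x
    rwa [e1, e2]
  have hs0 : s ≠ 0 := (zero_lt_one.trans_le hs1).ne'
  have htf := fun n => isTest_trunc (H := H) hf.1 x₀ n
  have htg := fun n => isTest_trunc (H := H) hg.1 x₀ n
  rw [hasValue_iff] at hu hv
  have hG : ∀ y, ‖((‖f y‖ + ‖a * g y‖ : ℝ) : ℂ)‖ = ‖f y‖ + ‖a‖ * ‖g y‖ := fun y => by
    rw [Complex.norm_real, Real.norm_of_nonneg (by positivity), norm_mul]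
  refine hT.hasValue hN hs0 hs (hf.1.sub (hg.1.const_mul a)) (hu.2.1.sub (hv.2.1.const_mul a))
    (hf.norm_add_norm hs1 (hg.const_mul a)) (fun y => ?_)
    (g := fun n y => H.trunc x₀ n f y - a * H.trunc x₀ n g y)
    (fun n => (htf n).sub ((htg n).const_mul a)) (fun n y => ?_)
    (Eventually.of_forall fun y => (tendsto_trunc x₀ f y).sub ((tendsto_trunc x₀ g y).const_mul a))
    fun x r hr => ?_
  · rw [hG, ← norm_mul]
    exact norm_sub_le _ _
  · rw [hG]
    refine (norm_sub_le _ _).trans ?_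
    rw [norm_mul]
    exact add_le_add (norm_trunc_le x₀ n f y)
      (mul_le_mul_of_nonneg_left (norm_trunc_le x₀ n g y) (norm_nonneg a))
  · have hac := H.nu_absolutelyContinuous x r
    have h1 := (hu.2.2 x₀ x r hr).add
      (ENNReal.Tendsto.const_mul (a := ‖a‖ₑ) (hv.2.2 x₀ x r hr) (Or.inr (by simp)))
    rw [mul_zero, add_zero] at h1
    refine tendsto_of_tendsto_of_tendsto_of_le_of_le tendsto_const_nhds h1 (fun _ => zero_le)
      fun n => ?_
    have e1 := applyL2_sub_ae T ((htf n).memLp 2) (((htg n).const_mul a).memLp 2)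
    have e2 := applyL2_const_mul_ae T ((htg n).memLp 2) a
    have hm : AEMeasurable (fun y => ‖applyL2 T (H.trunc x₀ n f) y - u y‖ₑ) (H.nu x r) :=
      (((memLp_applyL2 T _).1.sub hu.2.1).mono_ac hac).enorm
    simp only
    rw [← lintegral_const_mul' _ _ (by simp), ← lintegral_add_left' hm]
    refine lintegral_mono_ae ?_
    filter_upwards [hac.ae_le e1, hac.ae_le e2] with y h1 h2
    rw [h1, h2, ← enorm_mul]
    refine le_trans (le_of_eq ?_) (enorm_sub_le (a := applyL2 T (H.trunc x₀ n f) y - u y)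
      (b := a * (applyL2 T (H.trunc x₀ n g) y - v y)))
    congr 1
    ring

end ValueEstimates

section Products

variable {X : Type*} [TopologicalSpace X] [MeasurableSpace X] {μ : Measure X}
  {H : HomogeneousStructure μ}

lemma exists_eLpNorm_nu_le_geometric (hH : H.ReverseDoubling) {p : ℝ≥0∞} (hp0 : p ≠ 0)
    (hp : p ≠ ∞) :
    ∃ ρ : ℝ≥0∞, ρ < 1 ∧ ∀ (f : X → ℂ) (x : X) (r : ℝ), 0 < r → ∀ i : ℕ,
      eLpNorm f p (H.nu x (H.c ^ i * r)) ≤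
        ρ ^ i * ((μ (H.ball x r))⁻¹ ^ (1 / p.toReal) * eLpNorm f p μ) := by
  have hp' := ENNReal.toReal_pos hp0 hp
  obtain ⟨ε, hε, h⟩ := hH
  have hc := H.c_pos
  have hcε : 1 < H.c ^ ε := Real.one_lt_rpow H.one_lt_c hε
  set a : ℝ≥0∞ := ENNReal.ofReal (H.c ^ ε) with ha
  have ha1 : 1 < a := ENNReal.one_lt_ofReal.2 hcε
  refine ⟨a⁻¹ ^ (1 / p.toReal), ENNReal.rpow_lt_one (ENNReal.inv_lt_one.2 ha1) (by positivity),
    fun f x r hr i => ?_⟩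
  rw [eLpNorm_nu hp, ← mul_assoc]
  refine mul_le_mul' ?_ (eLpNorm_mono_measure _ Measure.restrict_le_self)
  rw [← ENNReal.rpow_natCast, ← ENNReal.rpow_mul, mul_comm (1 / p.toReal), ENNReal.rpow_mul,
    ENNReal.rpow_natCast, ← ENNReal.mul_rpow_of_nonneg _ _ (by positivity)]
  refine ENNReal.rpow_le_rpow ?_ (by positivity)
  have h1 := h x r i hr
  have h2 : ENNReal.ofReal (H.c ^ ((i : ℝ) * ε)) = a ^ i := by
    rw [ha, ← ENNReal.ofReal_pow (by positivity), ← Real.rpow_natCast, ← Real.rpow_mul hc.le,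
      mul_comm]
  rw [h2] at h1
  rw [← ENNReal.inv_pow, ← ENNReal.mul_inv (Or.inr (H.measure_ball_ne_top hr))
    (Or.inr (H.measure_ball_ne_zero hr))]
  exact ENNReal.inv_le_inv.2 h1

lemma tsum_add_one_pow_mul_eLpNorm_nu_ne_top (hH : H.ReverseDoubling) {p : ℝ≥0∞} (hp0 : p ≠ 0)
    (hp : p ≠ ∞) {f : X → ℂ} (hf : MemLp f p μ) (k : ℕ) (x : X) {r : ℝ} (hr : 0 < r) :
    ∑' i : ℕ, ((i : ℝ≥0∞) + 1) ^ k * eLpNorm f p (H.nu x (H.c ^ i * r)) ≠ ∞ := by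
  obtain ⟨ρ, hρ, h⟩ := exists_eLpNorm_nu_le_geometric hH hp0 hp
  have h1 : ∑' i : ℕ, ((i : ℝ≥0∞) + 1) ^ k * eLpNorm f p (H.nu x (H.c ^ i * r)) ≤
      (∑' i : ℕ, ((i : ℝ≥0∞) + 1) ^ k * ρ ^ i) *
        ((μ (H.ball x r))⁻¹ ^ (1 / p.toReal) * eLpNorm f p μ) := by
    rw [← ENNReal.tsum_mul_right]
    refine ENNReal.tsum_le_tsum fun i => ?_
    rw [mul_assoc]
    exact mul_le_mul' le_rfl (h f x r hr i)
  refine ne_top_of_le_ne_top (ENNReal.mul_ne_top (tsum_add_one_pow_mul_pow_ne_top hρ k)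
    (ENNReal.mul_ne_top (ENNReal.rpow_ne_top_of_nonneg (by positivity)
      (ENNReal.inv_ne_top.2 (H.measure_ball_ne_zero hr))) hf.2.ne)) h1

lemma admissible_of_memLp (hH : H.ReverseDoubling) {s p : ℝ≥0∞} (hs0 : s ≠ 0) (hsp : s ≤ p)
    (hp : p ≠ ∞) {f : X → ℂ} (hf : MemLp f p μ) : H.Admissible s f := by
  refine ⟨hf.1, fun x r hr => ne_top_of_le_ne_top ?_ (theta_mono_exponent hsp hf.1 x hr)⟩
  have hp0 : p ≠ 0 := (hs0.bot_lt.trans_le hsp).ne'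
  simpa [theta] using tsum_add_one_pow_mul_eLpNorm_nu_ne_top hH hp0 hp hf 0 x hr

/-- The mean of `b` changes by a bounded amount from one dilate of a ball to the next. -/
lemma LocInt.enorm_mean_pow_sub_mean_le {b : X → ℂ} (hb : H.LocInt b) {β : ℝ≥0∞}
    (hβ : ∀ x r, 0 < r → H.osc b x r ≤ β) (x : X) {r : ℝ} (hr : 0 < r) (i : ℕ) :
    ‖H.mean b x (H.c ^ i * r) - H.mean b x r‖ₑ ≤ i * (H.doublingConst * β) := by
  induction i with
  | zero => simp
  | succ i ih =>
    have hri : 0 < H.c ^ i * r := mul_pos (H.c_pow_pos i) hr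
    have hri' : 0 < H.c ^ (i + 1) * r := mul_pos (H.c_pow_pos (i + 1)) hr
    have he : H.c ^ (i + 1) * r = H.c * (H.c ^ i * r) := by rw [pow_succ', mul_assoc]
    have h1 : ‖H.mean b x (H.c ^ (i + 1) * r) - H.mean b x (H.c ^ i * r)‖ₑ ≤
        H.doublingConst * β := by
      rw [enorm_sub_rev]
      refine (hb.enorm_mean_sub_le x hri _).trans ?_
      refine (H.lintegral_nu_le_of_subset hri hri' ?_ ?_ _).trans
        (mul_le_mul' le_rfl (hβ x _ hri'))
      · rw [he]
        exact H.ball_subset_mul x hri H.one_lt_c.le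
      · rw [he]
        exact H.doubling x _ hri
    calc ‖H.mean b x (H.c ^ (i + 1) * r) - H.mean b x r‖ₑ
        ≤ ‖H.mean b x (H.c ^ (i + 1) * r) - H.mean b x (H.c ^ i * r)‖ₑ +
          ‖H.mean b x (H.c ^ i * r) - H.mean b x r‖ₑ := by
          rw [← sub_add_sub_cancel _ (H.mean b x (H.c ^ i * r))]
          exact enorm_add_le _ _
      _ ≤ H.doublingConst * β + i * (H.doublingConst * β) := add_le_add h1 ih
      _ = _ := by push_cast; ring

/-- Hölder's inequality together with the John–Nirenberg inequality, for the product of a function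
of bounded mean oscillation and an arbitrary function. -/
lemma exists_theta_mul_le [T2Space X] [BorelSpace X] [μ.Regular] (hH : H.ReverseDoubling)
    {s q : ℝ≥0∞} (hs0 : s ≠ 0) (hs1 : 1 ≤ s) (hsq : s < q) :
    ∃ C : ℝ≥0, ∀ b : X → ℂ, H.LocInt b → ∀ β : ℝ≥0∞, β ≠ ∞ →
      (∀ x r, 0 < r → H.osc b x r ≤ β) → ∀ h : X → ℂ, AEStronglyMeasurable h μ →
      ∀ (ρ : ℝ≥0∞) (x : X) (r : ℝ), 0 < r →
        H.theta ρ s (fun y => (b y - H.mean b x r) * h y) x r ≤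
          C * β * ∑' i : ℕ, ((i : ℝ≥0∞) + 1) * ρ ^ i * eLpNorm h q (H.nu x (H.c ^ i * r)) := by
  obtain ⟨v, hv⟩ : ∃ v : ℝ≥0∞, v = (s⁻¹ - q⁻¹)⁻¹ := ⟨_, rfl⟩
  have hsq' : q⁻¹ < s⁻¹ := ENNReal.inv_lt_inv.2 hsq
  have hvt : v ≠ ∞ := hv ▸ ENNReal.inv_ne_top.2 (tsub_pos_iff_lt.2 hsq').ne'
  have hholder : v.HolderTriple q s := ⟨by rw [hv, inv_inv, tsub_add_cancel_of_le hsq'.le]⟩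
  have hv0 : v ≠ 0 := hv ▸ ENNReal.inv_ne_zero.2
    (ENNReal.sub_ne_top (ENNReal.inv_ne_top.2 hs0))
  have hv1 : 1 ≤ v := by
    rw [hv, ENNReal.one_le_inv]
    exact tsub_le_self.trans (ENNReal.inv_le_one.2 hs1)
  obtain ⟨C, hC⟩ := H.exists_eLpNorm_sub_mean_le hH hvt
  refine ⟨C + H.doublingConst.toNNReal, fun b hb β hβt hβ h hh ρ x r hr => ?_⟩
  push_cast
  rw [ENNReal.coe_toNNReal H.doublingConst_ne_top, theta, ← ENNReal.tsum_mul_left]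
  refine ENNReal.tsum_le_tsum fun i => ?_
  have hri : 0 < H.c ^ i * r := mul_pos (H.c_pow_pos i) hr
  have hac := H.nu_absolutelyContinuous x (H.c ^ i * r)
  have hprob := H.isProbabilityMeasure_nu x hri
  have hbm := hb.aestronglyMeasurable.mono_ac hac
  have h1 : eLpNorm (fun y => (b y - H.mean b x r) * h y) s (H.nu x (H.c ^ i * r)) ≤
      eLpNorm (fun y => b y - H.mean b x r) v (H.nu x (H.c ^ i * r)) *
        eLpNorm h q (H.nu x (H.c ^ i * r)) := by
    have e0 : (fun y => (b y - H.mean b x r) * h y) = (fun y => b y - H.mean b x r) • h :=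
      funext fun _ => rfl
    rw [e0]
    exact eLpNorm_smul_le_mul_eLpNorm (hh.mono_ac hac) (hbm.sub aestronglyMeasurable_const)
  have h2 : eLpNorm (fun y => b y - H.mean b x r) v (H.nu x (H.c ^ i * r)) ≤
      (C + H.doublingConst) * β * (i + 1) := by
    have e1 : (fun y => b y - H.mean b x r) = (fun y => b y - H.mean b x (H.c ^ i * r)) +
        fun _ => H.mean b x (H.c ^ i * r) - H.mean b x r := by
      funext y
      simp
    rw [e1]
    refine (eLpNorm_add_le (hbm.sub aestronglyMeasurable_const) aestronglyMeasurable_const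
      hv1).trans ?_
    rw [eLpNorm_const _ hv0 (IsProbabilityMeasure.ne_zero _), measure_univ, ENNReal.one_rpow,
      mul_one]
    refine (add_le_add (hC b hb β hβt hβ x _ hri)
      (hb.enorm_mean_pow_sub_mean_le hβ x hr i)).trans ?_
    calc C * β + i * (H.doublingConst * β)
        ≤ C * β * (i + 1) + H.doublingConst * β * (i + 1) := by
          refine add_le_add (le_mul_of_one_le_right zero_le le_add_self) ?_
          rw [mul_comm]
          exact mul_le_mul' le_rfl le_self_add
      _ = _ := by ring
  calc ρ ^ i * eLpNorm (fun y => (b y - H.mean b x r) * h y) s (H.nu x (H.c ^ i * r))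
      ≤ ρ ^ i * ((C + H.doublingConst) * β * (i + 1) * eLpNorm h q (H.nu x (H.c ^ i * r))) :=
        mul_le_mul' le_rfl (h1.trans (mul_le_mul' h2 le_rfl))
    _ = _ := by ring

/-- Products of functions of bounded mean oscillation and `L^p` functions are admissible. -/
lemma admissible_mul [T2Space X] [BorelSpace X] [μ.Regular] (hH : H.ReverseDoubling)
    {s p : ℝ≥0∞} (hs1 : 1 ≤ s) (hsp : s < p) (hp : p ≠ ∞) {b h : X → ℂ} (hb : H.IsBMO b)
    (hh : MemLp h p μ) : H.Admissible s fun y => b y * h y := by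
  have hs0 : s ≠ 0 := (zero_lt_one.trans_le hs1).ne'
  have hp0 : p ≠ 0 := (hs0.bot_lt.trans hsp).ne'
  obtain ⟨C, hC⟩ := exists_theta_mul_le hH hs0 hs1 hsp
  have hbl : H.LocInt b := hb.1
  have hbm := hbl.aestronglyMeasurable
  refine ⟨hbm.mul hh.1, fun x r hr => ?_⟩
  have h1 := hC b hbl (H.bmoNorm b) hb.2.ne (fun x r hr => H.osc_le_bmoNorm b x hr) h hh.1 1 x r hr
  have h2 := ((admissible_of_memLp hH hs0 hsp.le hp hh).const_mul (H.mean b x r)).2 x r hr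
  refine ne_top_of_le_ne_top (ENNReal.add_ne_top.2 ⟨ne_top_of_le_ne_top ?_ h1, h2⟩)
    (theta_le_add hs1 ((hbm.sub aestronglyMeasurable_const).mul hh.1) (hh.1.const_mul _)
      (fun y => ?_) x r)
  · refine ENNReal.mul_ne_top (ENNReal.mul_ne_top (by simp) hb.2.ne) ?_
    simpa using tsum_add_one_pow_mul_eLpNorm_nu_ne_top hH hp0 hp hh 1 x hr
  · refine le_trans (le_of_eq ?_) (norm_add_le _ _)
    congr 1
    simp only [Pi.mul_apply, Pi.sub_apply]
    ring

end Products

/-! ### Truncation of functions of bounded mean oscillation -/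

section Clamp

/-- The function clamping the real and the imaginary part of a complex number to `[-a, a]`. -/
def clamp (a : ℝ) (z : ℂ) : ℂ := ⟨max (-a) (min a z.re), max (-a) (min a z.im)⟩

lemma abs_clampReal_sub_le (a s t : ℝ) :
    |max (-a) (min a s) - max (-a) (min a t)| ≤ |s - t| := by
  have h1 : LipschitzWith 1 fun s : ℝ => max (-a) (min a s) :=
    (LipschitzWith.id.const_min a).const_max (-a)
  simpa [Real.dist_eq] using h1.dist_le_mul s t

lemma norm_clamp_sub_le (a : ℝ) (z w : ℂ) : ‖clamp a z - clamp a w‖ ≤ 2 * ‖z - w‖ := by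
  refine (Complex.norm_le_abs_re_add_abs_im _).trans ?_
  have h1 := abs_clampReal_sub_le a z.re w.re
  have h2 := abs_clampReal_sub_le a z.im w.im
  have h3 := Complex.abs_re_le_norm (z - w)
  have h4 := Complex.abs_im_le_norm (z - w)
  simp only [clamp, Complex.sub_re, Complex.sub_im] at *
  linarith

lemma norm_clamp_le {a : ℝ} (ha : 0 ≤ a) (z : ℂ) : ‖clamp a z‖ ≤ 2 * a := by
  refine (Complex.norm_le_abs_re_add_abs_im _).trans ?_
  have h : ∀ t : ℝ, |max (-a) (min a t)| ≤ a := fun t =>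
    abs_le.2 ⟨le_max_left _ _, max_le (by linarith) (min_le_left _ _)⟩
  have h1 := h z.re
  have h2 := h z.im
  simp only [clamp]
  linarith

lemma clamp_eq_self {a : ℝ} {z : ℂ} (h : ‖z‖ ≤ a) : clamp a z = z := by
  have key : ∀ t : ℝ, |t| ≤ ‖z‖ → max (-a) (min a t) = t := fun t ht => by
    obtain ⟨h1, h2⟩ := abs_le.1 (ht.trans h)
    rw [min_eq_right h2, max_eq_right h1]
  exact Complex.ext (key _ (Complex.abs_re_le_norm z)) (key _ (Complex.abs_im_le_norm z))

lemma clamp_zero {a : ℝ} (ha : 0 ≤ a) : clamp a 0 = 0 := clamp_eq_self (by simpa using ha)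

lemma norm_clamp_le_two_mul {a : ℝ} (ha : 0 ≤ a) (z : ℂ) : ‖clamp a z‖ ≤ 2 * ‖z‖ := by
  simpa [clamp_zero ha] using norm_clamp_sub_le a z 0

lemma continuous_clamp (a : ℝ) : Continuous (clamp a) :=
  (LipschitzWith.of_dist_le_mul (K := 2) fun z w => by
    simpa [dist_eq_norm] using norm_clamp_sub_le a z w).continuous

variable {X : Type*} [TopologicalSpace X] [MeasurableSpace X] {μ : Measure X}
  {H : HomogeneousStructure μ}

lemma bmoNorm_le {b : X → ℂ} {β : ℝ≥0∞} (h : ∀ x r, 0 < r → H.osc b x r ≤ β) :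
    H.bmoNorm b ≤ β := by
  refine iSup₂_le fun x r => iSup_le fun hr => ?_
  have := h x r hr
  rwa [osc, lintegral_nu, ← setAverage_ball] at this

lemma LocInt.clamp {b : X → ℂ} (hb : H.LocInt b) {a : ℝ} (ha : 0 ≤ a) :
    H.LocInt fun y => clamp a (b y) := by
  intro x r hr
  refine ((hb x r hr).norm.const_mul 2).mono'
    ((continuous_clamp a).comp_aestronglyMeasurable (hb x r hr).aestronglyMeasurable)
    (Eventually.of_forall fun y => norm_clamp_le_two_mul ha (b y))

lemma IsBMO.bmoNorm_clamp_le {b : X → ℂ} (hb : H.IsBMO b) {a : ℝ} (ha : 0 ≤ a) :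
    H.bmoNorm (fun y => HomogeneousStructure.clamp a (b y)) ≤ 4 * H.bmoNorm b := by
  refine bmoNorm_le fun x r hr => ?_
  have hbl : H.LocInt b := hb.1
  refine ((hbl.clamp ha).osc_le_two_mul x hr (HomogeneousStructure.clamp a (H.mean b x r))).trans ?_
  calc 2 * ∫⁻ y, ‖HomogeneousStructure.clamp a (b y) -
        HomogeneousStructure.clamp a (H.mean b x r)‖ₑ ∂(H.nu x r)
      ≤ 2 * ∫⁻ y, 2 * ‖b y - H.mean b x r‖ₑ ∂(H.nu x r) := by
        refine mul_le_mul' le_rfl (lintegral_mono fun y => ?_)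
        have h := norm_clamp_sub_le a (b y) (H.mean b x r)
        rw [← ofReal_norm, ← ofReal_norm, ← ENNReal.ofReal_ofNat, ← ENNReal.ofReal_mul (by norm_num)]
        exact ENNReal.ofReal_le_ofReal h
    _ = 4 * H.osc b x r := by
        rw [lintegral_const_mul' _ _ (by simp), osc, ← mul_assoc]
        norm_num
    _ ≤ _ := mul_le_mul' le_rfl (H.osc_le_bmoNorm b x hr)

lemma IsBMO.clamp {b : X → ℂ} (hb : H.IsBMO b) {a : ℝ} (ha : 0 ≤ a) :
    H.IsBMO fun y => HomogeneousStructure.clamp a (b y) :=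
  ⟨LocInt.clamp hb.1 ha, (hb.bmoNorm_clamp_le ha).trans_lt
    (ENNReal.mul_lt_top (by simp) hb.2)⟩

end Clamp

/-! ### Generalized Toeplitz operators -/

lemma lintegral_enorm_sum_sub_sum_le {Y ι : Type*} [MeasurableSpace Y] {ν : Measure Y}
    {t : Finset ι} {f g : ι → Y → ℂ} (hf : ∀ i, AEStronglyMeasurable (f i) ν)
    (hg : ∀ i, AEStronglyMeasurable (g i) ν) :
    ∫⁻ y, ‖∑ i ∈ t, f i y - ∑ i ∈ t, g i y‖ₑ ∂ν ≤ ∑ i ∈ t, ∫⁻ y, ‖f i y - g i y‖ₑ ∂ν := by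
  have hm : ∀ i ∈ t, AEMeasurable (fun y => ‖f i y - g i y‖ₑ) ν := fun i _ =>
    ((hf i).sub (hg i)).enorm
  rw [← lintegral_finsetSum' t hm]
  refine lintegral_mono fun y => ?_
  rw [← Finset.sum_sub_distrib]
  exact enorm_sum_le _ _

section Toeplitz

variable {X : Type*} [TopologicalSpace X] [MeasurableSpace X] {μ : Measure X}
  {H : HomogeneousStructure μ}

lemma osc_congr_ae {F G : X → ℂ} (h : F =ᵐ[μ] G) (x : X) (r : ℝ) : H.osc F x r = H.osc G x r := by
  have h' := (H.nu_absolutelyContinuous x r).ae_eq h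
  rw [osc, osc, mean, mean, integral_congr_ae h']
  refine lintegral_congr_ae ?_
  filter_upwards [h'] with y hy
  rw [hy]

lemma osc_sum_le {ι : Type*} {t : Finset ι} {F : ι → X → ℂ} (hF : ∀ i, H.LocInt (F i)) (x : X)
    {r : ℝ} (hr : 0 < r) : H.osc (fun y => ∑ i ∈ t, F i y) x r ≤ ∑ i ∈ t, H.osc (F i) x r := by
  have hprob := H.isProbabilityMeasure_nu x hr
  have hi := fun i => (hF i).integrable_nu x hr
  have hm : H.mean (fun y => ∑ i ∈ t, F i y) x r = ∑ i ∈ t, H.mean (F i) x r :=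
    integral_finsetSum t fun i _ => hi i
  simp only [osc]
  rw [hm]
  exact lintegral_enorm_sum_sub_sum_le (g := fun i _ => H.mean (F i) x r) (fun i => (hi i).1)
    fun i => aestronglyMeasurable_const

/-- The sum `∑ j, T_j (b h_j)`. -/
def multSum (H : HomogeneousStructure μ) {m : ℕ} (T : Fin m → Lp ℂ 2 μ →L[ℂ] Lp ℂ 2 μ) (b : X → ℂ)
    (h : Fin m → X → ℂ) : X → ℂ :=
  fun x => ∑ j, H.ext (T j) (fun y => b y * h j y) x

variable [T2Space X] [BorelSpace X] [μ.Regular]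

lemma exists_oscBound_sizeBound (hH : H.ReverseDoubling) {ε : ℝ} (hε : 0 < ε) {s : ℝ≥0∞}
    (hs1 : 1 < s) (hs : s ≠ ∞) :
    ∃ C : ℝ≥0, ∀ (A : ℝ) (T : Lp ℂ 2 μ →L[ℂ] Lp ℂ 2 μ), H.IsCZOperator ε A T →
      H.OscBound T (H.rate ε) s (C * (‖T‖ₑ + ENNReal.ofReal A)) ∧
        H.SizeBound T s (C * (‖T‖ₑ + ENNReal.ofReal A)) := by
  obtain ⟨C, hC⟩ := H.exists_osc_size_le hH hε hs1 hs
  exact ⟨C, fun A T hT => ⟨fun f hf x r hr => (hC A T hT f hf x r hr).1,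
    fun f hf x r hr => (hC A T hT f hf x r hr).2⟩⟩

/-- Values of Calderón–Zygmund operators exist at admissible functions. -/
lemma IsCZOperator.hasValue_ext (hH : H.ReverseDoubling) {ε A : ℝ} {T : Lp ℂ 2 μ →L[ℂ] Lp ℂ 2 μ}
    (hT : H.IsCZOperator ε A T) {s : ℝ≥0∞} (hs1 : 1 < s) (hs : s ≠ ∞) {f : X → ℂ}
    (hf : H.Admissible s f) : H.HasValue T f (H.ext T f) := by
  obtain ⟨C, hC⟩ := exists_oscBound_sizeBound hH hT.1 hs1 hs
  obtain ⟨u, hu⟩ := (hC A T hT).2.exists_hasValue (ENNReal.mul_ne_top (by simp) (by simp))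
    hs1.le hs hf
  exact hu.ext

lemma exists_eLpNorm_ext_le (hH : H.ReverseDoubling) {ε : ℝ} (hε : 0 < ε) {p : ℝ≥0∞} (hp1 : 1 < p)
    (hp : p ≠ ∞) :
    ∃ C : ℝ≥0, ∀ (A : ℝ) (T : Lp ℂ 2 μ →L[ℂ] Lp ℂ 2 μ), H.IsCZOperator ε A T →
      ∀ f : X → ℂ, MemLp f p μ → H.HasValue T f (H.ext T f) ∧ MemLp (H.ext T f) p μ ∧
        eLpNorm (H.ext T f) p μ ≤ C * (‖T‖ₑ + ENNReal.ofReal A) * eLpNorm f p μ := by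
  have hp0 : p ≠ 0 := (zero_lt_one.trans hp1).ne'
  obtain ⟨C, hC⟩ := H.exists_lpBound hH hε hp1 hp
  refine ⟨C, fun A T hT f hf => ?_⟩
  have hv := hT.hasValue_ext hH hp1 hp (admissible_of_memLp hH hp0 le_rfl hp hf)
  have hle := (hC A T hT).eLpNorm_value_le hp0 hp hv
  exact ⟨hv, ⟨hv.2.1, hle.trans_lt (ENNReal.mul_lt_top (ENNReal.mul_lt_top (by simp) (by simp))
    hf.2)⟩, hle⟩

/-- The key estimate: as `∑ j, T_j h_j = 0`, the function `b` may be replaced by `b - m_B(b)` when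
estimating the oscillation of `∑ j, T_j (b h_j)` over a ball `B`. -/
lemma exists_sharp_multSum_le (hH : H.ReverseDoubling) {ε : ℝ} (hε : 0 < ε) {q p : ℝ≥0∞}
    (hq1 : 1 < q) (hqp : q < p) (hp : p ≠ ∞) :
    ∃ C : ℝ≥0, ∀ (m : ℕ) (T : Fin m → Lp ℂ 2 μ →L[ℂ] Lp ℂ 2 μ) (A : Fin m → ℝ),
      (∀ j, H.IsCZOperator ε (A j) (T j)) → ∀ h : Fin m → X → ℂ, (∀ j, MemLp (h j) p μ) →
      H.multSum T (fun _ => 1) h =ᵐ[μ] 0 → ∀ b : X → ℂ, H.IsBMO b → ∀ z,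
        H.sharp (H.multSum T b h) z ≤
          ∑ j, C * H.bmoNorm b * (‖T j‖ₑ + ENNReal.ofReal (A j)) * H.maximalPow q (h j) z := by
  obtain ⟨s, hs1, hsq⟩ := exists_between hq1
  have hs0 : s ≠ 0 := (zero_lt_one.trans hs1).ne'
  have hs : s ≠ ∞ := (hsq.trans_le le_top).ne
  have hq0 : q ≠ 0 := (zero_lt_one.trans hq1).ne'
  have hq : q ≠ ∞ := (hqp.trans_le le_top).ne
  have hρ := H.rate_lt_one hε
  obtain ⟨C₁, hC₁⟩ := exists_oscBound_sizeBound hH hε hs1 hs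
  obtain ⟨C₂, hC₂⟩ := exists_theta_mul_le hH hs0 hs1.le hsq
  have hS := tsum_add_one_pow_mul_pow_ne_top hρ 1
  set S : ℝ≥0∞ := ∑' n : ℕ, ((n : ℝ≥0∞) + 1) ^ 1 * H.rate ε ^ n with hSdef
  refine ⟨C₁ * C₂ * S.toNNReal, fun m T A hT h hh h0 b hb z => H.sharp_le fun x r hr hz => ?_⟩
  push_cast
  rw [ENNReal.coe_toNNReal hS]
  have hbl : H.LocInt b := hb.1
  set a := H.mean b x r with ha
  have hadm : ∀ j, H.Admissible s fun y => b y * h j y := fun j =>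
    admissible_mul hH hs1.le (hsq.trans hqp) hp hb (hh j)
  have hadm1 : ∀ j, H.Admissible s fun y => 1 * h j y := fun j => by
    simpa using admissible_of_memLp hH hs0 (hsq.trans hqp).le hp (hh j)
  have hval : ∀ j, H.HasValue (T j) (fun y => b y * h j y - a * (1 * h j y))
      (fun y => H.ext (T j) (fun y => b y * h j y) y - a * H.ext (T j) (fun y => 1 * h j y) y) :=
    fun j => (hC₁ (A j) (T j) (hT j)).2.hasValue_sub_const_mul
      (ENNReal.mul_ne_top (by simp) (by simp)) hs1.le hs (hadm j) (hadm1 j)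
      ((hT j).hasValue_ext hH hs1 hs (hadm j)) ((hT j).hasValue_ext hH hs1 hs (hadm1 j)) a
  have hae : H.multSum T b h =ᵐ[μ] fun y => ∑ j, (H.ext (T j) (fun y => b y * h j y) y -
      a * H.ext (T j) (fun y => 1 * h j y) y) := by
    filter_upwards [h0] with y hy
    rw [Finset.sum_sub_distrib, ← Finset.mul_sum]
    have hy' : ∑ j, H.ext (T j) (fun y => 1 * h j y) y = 0 := hy
    rw [hy', mul_zero, sub_zero, multSum]
  rw [osc_congr_ae hae]
  refine (osc_sum_le (fun j => (hval j).locInt) x hr).trans (Finset.sum_le_sum fun j _ => ?_)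
  refine ((hC₁ (A j) (T j) (hT j)).1.osc_value_le (hval j) x hr).trans ?_
  have e1 : (fun y => b y * h j y - a * (1 * h j y)) = fun y => (b y - H.mean b x r) * h j y := by
    funext y
    rw [← ha]
    ring
  rw [e1]
  have e2 := hC₂ b hbl (H.bmoNorm b) hb.2.ne (fun x r hr => H.osc_le_bmoNorm b x hr) (h j) (hh j).1
    (H.rate ε) x r hr
  have e3 : ∑' i : ℕ, ((i : ℝ≥0∞) + 1) * H.rate ε ^ i * eLpNorm (h j) q (H.nu x (H.c ^ i * r)) ≤
      S * H.maximalPow q (h j) z := by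
    rw [hSdef, ← ENNReal.tsum_mul_right]
    refine ENNReal.tsum_le_tsum fun i => ?_
    rw [pow_one]
    exact mul_le_mul' le_rfl (H.eLpNorm_nu_le_maximalPow hq0 hq (h j)
      (mul_pos (H.c_pow_pos i) hr) (H.ball_subset_mul x hr (H.one_le_c_pow i) hz))
  refine (mul_le_mul' le_rfl (e2.trans (mul_le_mul' le_rfl e3))).trans_eq ?_
  ring

/-- The estimate for a function `∑ j, T_j (b h_j)` which is already known to lie in `L^p`. -/
lemma exists_eLpNorm_multSum_le_of_memLp (hH : H.ReverseDoubling) {ε : ℝ} (hε : 0 < ε) {p : ℝ≥0∞}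
    (hp1 : 1 < p) (hp : p ≠ ∞) :
    ∃ C : ℝ≥0, ∀ (m : ℕ) (T : Fin m → Lp ℂ 2 μ →L[ℂ] Lp ℂ 2 μ) (A : Fin m → ℝ),
      (∀ j, H.IsCZOperator ε (A j) (T j)) → ∀ h : Fin m → X → ℂ, (∀ j, MemLp (h j) p μ) →
      H.multSum T (fun _ => 1) h =ᵐ[μ] 0 → ∀ b : X → ℂ, H.IsBMO b →
      MemLp (H.multSum T b h) p μ →
        eLpNorm (H.multSum T b h) p μ ≤
          ∑ j, C * H.bmoNorm b * (‖T j‖ₑ + ENNReal.ofReal (A j)) * eLpNorm (h j) p μ := by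
  have hp0 : p ≠ 0 := (zero_lt_one.trans hp1).ne'
  obtain ⟨q, hq1, hqp⟩ := exists_between hp1
  obtain ⟨C₁, hC₁⟩ := exists_sharp_multSum_le hH hε hq1 hqp hp
  obtain ⟨C₂, hC₂⟩ := H.exists_eLpNorm_le_sharp hH hp0 hp
  obtain ⟨C₃, hC₃⟩ := H.exists_eLpNorm_maximalPow_le (zero_lt_one.trans hq1).ne' hqp hp
  refine ⟨C₂ * C₁ * C₃, fun m T A hT h hh h0 b hb hF => ?_⟩
  have hM : ∀ j, Measurable fun z =>
      C₁ * H.bmoNorm b * (‖T j‖ₑ + ENNReal.ofReal (A j)) * H.maximalPow q (h j) z :=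
    fun j => (H.measurable_maximalPow q (h j)).const_mul _
  calc eLpNorm (H.multSum T b h) p μ ≤ C₂ * eLpNorm (H.sharp (H.multSum T b h)) p μ :=
        hC₂ _ p hp1 le_rfl hF
    _ ≤ C₂ * eLpNorm (∑ j, fun z =>
          C₁ * H.bmoNorm b * (‖T j‖ₑ + ENNReal.ofReal (A j)) * H.maximalPow q (h j) z) p μ := by
        refine mul_le_mul' le_rfl (eLpNorm_mono_enorm fun z => ?_)
        simpa only [enorm_eq_self, Finset.sum_apply] using hC₁ m T A hT h hh h0 b hb z
    _ ≤ C₂ * ∑ j, eLpNorm (fun z =>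
          C₁ * H.bmoNorm b * (‖T j‖ₑ + ENNReal.ofReal (A j)) * H.maximalPow q (h j) z) p μ :=
        mul_le_mul' le_rfl (eLpNorm_sum_le (fun j _ => (hM j).aestronglyMeasurable) hp1.le)
    _ ≤ C₂ * ∑ j, C₁ * H.bmoNorm b * (‖T j‖ₑ + ENNReal.ofReal (A j)) *
          (C₃ * eLpNorm (h j) p μ) := by
        refine mul_le_mul' le_rfl (Finset.sum_le_sum fun j _ => ?_)
        refine le_trans ?_ (mul_le_mul' le_rfl (hC₃ (h j) (hh j).1))
        exact eLpNorm_le_mul_of_ae_le hp0 hp (H.measurable_maximalPow q (h j)).aestronglyMeasurable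
          (Eventually.of_forall fun z => by simp only [enorm_eq_self]; exact le_rfl)
    _ = _ := by
        rw [Finset.mul_sum]
        refine Finset.sum_congr rfl fun j _ => ?_
        push_cast
        ring

/-- Bounded multipliers preserve `L^p`. -/
lemma memLp_multSum_of_bounded (hH : H.ReverseDoubling) {ε : ℝ} (hε : 0 < ε) {p : ℝ≥0∞}
    (hp1 : 1 < p) (hp : p ≠ ∞) {m : ℕ} {T : Fin m → Lp ℂ 2 μ →L[ℂ] Lp ℂ 2 μ} {A : Fin m → ℝ}
    (hT : ∀ j, H.IsCZOperator ε (A j) (T j)) {h : Fin m → X → ℂ} (hh : ∀ j, MemLp (h j) p μ)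
    {b : X → ℂ} (hbm : AEStronglyMeasurable b μ) {M : ℝ} (hbM : ∀ y, ‖b y‖ ≤ M) :
    MemLp (H.multSum T b h) p μ := by
  obtain ⟨C, hC⟩ := exists_eLpNorm_ext_le hH hε hp1 hp
  refine memLp_finsetSum _ fun j _ => (hC (A j) (T j) (hT j) _ ?_).2.1
  refine (hh j).of_le_mul (c := M) (hbm.mul (hh j).1) (Eventually.of_forall fun y => ?_)
  rw [norm_mul]
  exact mul_le_mul_of_nonneg_right (hbM y) (norm_nonneg _)

/-- Truncating the symbol approximates `∑ j, T_j (b h_j)` in `L¹` on every ball. -/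
lemma locTendsto_multSum_clamp (hH : H.ReverseDoubling) {ε : ℝ} {p : ℝ≥0∞}
    (hp1 : 1 < p) (hp : p ≠ ∞) {m : ℕ} {T : Fin m → Lp ℂ 2 μ →L[ℂ] Lp ℂ 2 μ} {A : Fin m → ℝ}
    (hT : ∀ j, H.IsCZOperator ε (A j) (T j)) {h : Fin m → X → ℂ} (hh : ∀ j, MemLp (h j) p μ)
    {b : X → ℂ} (hb : H.IsBMO b) :
    H.LocTendsto (fun n : ℕ => H.multSum T (fun y => clamp n (b y)) h) (H.multSum T b h) := by
  intro x r hr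
  obtain ⟨s, hs1, hsp⟩ := exists_between hp1
  have hs0 : s ≠ 0 := (zero_lt_one.trans hs1).ne'
  have hs : s ≠ ∞ := (hsp.trans_le le_top).ne
  have hac := H.nu_absolutelyContinuous x r
  have hadm : ∀ j, H.Admissible s fun y => b y * h j y := fun j =>
    admissible_mul hH hs1.le hsp hp hb (hh j)
  have hadmn : ∀ (n : ℕ) j, H.Admissible s fun y => clamp n (b y) * h j y := fun n j =>
    admissible_mul hH hs1.le hsp hp (hb.clamp n.cast_nonneg) (hh j)
  have hv := fun j => (hT j).hasValue_ext hH hs1 hs (hadm j)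
  have hvn := fun n j => (hT j).hasValue_ext hH hs1 hs (hadmn n j)
  have key : ∀ j, Tendsto (fun n : ℕ => ∫⁻ y, ‖H.ext (T j) (fun y => clamp n (b y) * h j y) y -
      H.ext (T j) (fun y => b y * h j y) y‖ₑ ∂(H.nu x r)) atTop (𝓝 0) := by
    intro j
    obtain ⟨C, hC⟩ := exists_oscBound_sizeBound hH (hT j).1 hs1 hs
    have hsize := (hC (A j) (T j) (hT j)).2
    have hN : (C : ℝ≥0∞) * (‖T j‖ₑ + ENNReal.ofReal (A j)) ≠ ∞ :=
      ENNReal.mul_ne_top (by simp) (by simp)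
    have hval := fun n : ℕ => hsize.hasValue_sub_const_mul hN hs1.le hs (hadmn n j) (hadm j)
      (hvn n j) (hv j) 1
    simp only [one_mul] at hval
    have h1 := (hadm j).tendsto_theta hs0 hs (a := 3)
      (u := fun (n : ℕ) y => clamp n (b y) * h j y - b y * h j y)
      (fun n => (hadmn n j).1.sub (hadm j).1) (fun n y => ?_)
      (Eventually.of_forall fun y => ?_) x hr
    · have h2 := ENNReal.Tendsto.const_mul h1 (Or.inr hN)
      rw [mul_zero] at h2
      exact tendsto_of_tendsto_of_tendsto_of_le_of_le tendsto_const_nhds h2 (fun _ => zero_le)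
        fun n => hsize.lintegral_value_le (hval n) x hr
    · rw [← sub_mul, norm_mul, norm_mul, ← mul_assoc]
      refine mul_le_mul_of_nonneg_right ((norm_sub_le _ _).trans ?_) (norm_nonneg _)
      have := norm_clamp_le_two_mul (n.cast_nonneg (α := ℝ)) (b y)
      push_cast
      linarith
    · obtain ⟨k, hk⟩ := exists_nat_ge ‖b y‖
      refine tendsto_atTop_of_eventually_const (i₀ := k) fun n hn => ?_
      rw [clamp_eq_self (hk.trans (by exact_mod_cast hn)), sub_self]
  have hsum := tendsto_finsetSum (Finset.univ : Finset (Fin m)) fun j _ => key j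
  rw [Finset.sum_const_zero] at hsum
  refine tendsto_of_tendsto_of_tendsto_of_le_of_le tendsto_const_nhds hsum (fun _ => zero_le)
    fun n => ?_
  exact lintegral_enorm_sum_sub_sum_le (fun j => (hvn n j).2.1.mono_ac hac)
    fun j => (hv j).2.1.mono_ac hac

/-- The a priori assumption in `exists_eLpNorm_multSum_le_of_memLp` is removed by truncating `b`. -/
lemma exists_eLpNorm_multSum_le (hH : H.ReverseDoubling) {ε : ℝ} (hε : 0 < ε) {p : ℝ≥0∞}
    (hp1 : 1 < p) (hp : p ≠ ∞) :
    ∃ C : ℝ≥0, ∀ (m : ℕ) (T : Fin m → Lp ℂ 2 μ →L[ℂ] Lp ℂ 2 μ) (A : Fin m → ℝ),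
      (∀ j, H.IsCZOperator ε (A j) (T j)) → ∀ h : Fin m → X → ℂ, (∀ j, MemLp (h j) p μ) →
      H.multSum T (fun _ => 1) h =ᵐ[μ] 0 → ∀ b : X → ℂ, H.IsBMO b →
        AEStronglyMeasurable (H.multSum T b h) μ ∧
        eLpNorm (H.multSum T b h) p μ ≤
          ∑ j, C * H.bmoNorm b * (‖T j‖ₑ + ENNReal.ofReal (A j)) * eLpNorm (h j) p μ := by
  have hp0 : p ≠ 0 := (zero_lt_one.trans hp1).ne'
  obtain ⟨C, hC⟩ := exists_eLpNorm_multSum_le_of_memLp (H := H) hH hε hp1 hp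
  refine ⟨C * 4, fun m T A hT h hh h0 b hb => ?_⟩
  obtain ⟨s, hs1, hsp⟩ := exists_between hp1
  have hs : s ≠ ∞ := (hsp.trans_le le_top).ne
  have hmeas : ∀ b', H.IsBMO b' → AEStronglyMeasurable (H.multSum T b' h) μ := fun b' hb' =>
    Finset.aestronglyMeasurable_fun_sum _ fun j _ => ((hT j).hasValue_ext hH hs1 hs
      (admissible_mul hH hs1.le hsp hp hb' (hh j))).2.1
  refine ⟨hmeas b hb, (locTendsto_multSum_clamp hH hp1 hp hT hh hb).eLpNorm_le hp0 hp
    (fun n => hmeas _ (hb.clamp n.cast_nonneg)) (hmeas b hb) fun n => ?_⟩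
  have hbl : H.LocInt b := hb.1
  refine (hC m T A hT h hh h0 _ (hb.clamp n.cast_nonneg) (memLp_multSum_of_bounded hH hε hp1 hp
    hT hh (hbl.clamp n.cast_nonneg).aestronglyMeasurable
    fun y => norm_clamp_le n.cast_nonneg (b y))).trans (Finset.sum_le_sum fun j _ => ?_)
  refine mul_le_mul' (mul_le_mul' ?_ le_rfl) le_rfl
  push_cast
  rw [mul_assoc]
  exact mul_le_mul' le_rfl (hb.bmoNorm_clamp_le n.cast_nonneg)

end Toeplitz

/-! ### Dependence of the bounds on the operators -/

section Final

variable {X : Type*} [TopologicalSpace X] [MeasurableSpace X] {μ : Measure X}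
  {H : HomogeneousStructure μ}

lemma exists_toeplitz_bound [T2Space X] [BorelSpace X] [μ.Regular] (hH : H.ReverseDoubling) {ε : ℝ}
    (hε : 0 < ε) {p : ℝ≥0∞} (hp1 : 1 < p) (hp : p ≠ ∞) :
    ∃ C : ℝ, 0 ≤ C ∧ ∀ (m : ℕ) (T₁ T₂ : Fin m → Lp ℂ 2 μ →L[ℂ] Lp ℂ 2 μ) (A₁ A₂ : Fin m → ℝ),
      (∀ j, H.IsCZOperator ε (A₁ j) (T₁ j)) → (∀ j, H.IsCZOperator ε (A₂ j) (T₂ j)) →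
      ∀ g : X → ℂ, MemLp g p μ → H.toeplitz T₁ T₂ (fun _ => 1) g =ᵐ[μ] 0 →
      ∀ b : X → ℂ, H.IsBMO b →
        H.ToeplitzDefined T₁ T₂ (fun _ => 1) g ∧ H.ToeplitzDefined T₁ T₂ b g ∧
        MemLp (H.toeplitz T₁ T₂ b g) p μ ∧
        eLpNorm (H.toeplitz T₁ T₂ b g) p μ ≤
          ENNReal.ofReal (C * (∑ j, (‖T₁ j‖ + A₁ j)) * (∑ j, (‖T₂ j‖ + A₂ j))) *
            eLpNorm g p μ * H.bmoNorm b := by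
  obtain ⟨s, hs1, hsp⟩ := exists_between hp1
  have hs0 : s ≠ 0 := (zero_lt_one.trans hs1).ne'
  have hs : s ≠ ∞ := (hsp.trans_le le_top).ne
  obtain ⟨C₁, hC₁⟩ := exists_eLpNorm_multSum_le (H := H) hH hε hp1 hp
  obtain ⟨C₂, hC₂⟩ := exists_eLpNorm_ext_le (H := H) hH hε hp1 hp
  refine ⟨C₁ * C₂, by positivity, fun m T₁ T₂ A₁ A₂ hT₁ hT₂ g hg h0 b hb => ?_⟩
  have hh := fun j => hC₂ (A₂ j) (T₂ j) (hT₂ j) g hg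
  have hN : ∀ (T : Fin m → Lp ℂ 2 μ →L[ℂ] Lp ℂ 2 μ) (A : Fin m → ℝ),
      (∀ j, H.IsCZOperator ε (A j) (T j)) →
      ∑ j, (‖T j‖ₑ + ENNReal.ofReal (A j)) = ENNReal.ofReal (∑ j, (‖T j‖ + A j)) := by
    intro T A hT
    rw [ENNReal.ofReal_sum_of_nonneg fun j _ => add_nonneg (norm_nonneg _) (hT j).2.1]
    refine Finset.sum_congr rfl fun j _ => ?_
    rw [ENNReal.ofReal_add (norm_nonneg _) (hT j).2.1, ofReal_norm]
  have hbound : eLpNorm (H.toeplitz T₁ T₂ b g) p μ ≤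
      ENNReal.ofReal (C₁ * C₂ * (∑ j, (‖T₁ j‖ + A₁ j)) * (∑ j, (‖T₂ j‖ + A₂ j))) *
        eLpNorm g p μ * H.bmoNorm b := by
    have hn₁ : 0 ≤ ∑ j, (‖T₁ j‖ + A₁ j) :=
      Finset.sum_nonneg fun j _ => add_nonneg (norm_nonneg _) (hT₁ j).2.1
    rw [ENNReal.ofReal_mul (by positivity), ENNReal.ofReal_mul (by positivity), ← hN T₁ A₁ hT₁,
      ← hN T₂ A₂ hT₂, ENNReal.ofReal_mul (by positivity), ENNReal.ofReal_coe_nnreal,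
      ENNReal.ofReal_coe_nnreal]
    refine (hC₁ m T₁ A₁ hT₁ _ (fun j => (hh j).2.1) h0 b hb).2.trans ?_
    calc ∑ j, C₁ * H.bmoNorm b * (‖T₁ j‖ₑ + ENNReal.ofReal (A₁ j)) *
          eLpNorm (H.ext (T₂ j) g) p μ
        ≤ ∑ j, (‖T₁ j‖ₑ + ENNReal.ofReal (A₁ j)) * (C₁ * H.bmoNorm b *
          (C₂ * (∑ j, (‖T₂ j‖ₑ + ENNReal.ofReal (A₂ j))) * eLpNorm g p μ)) := by
          refine Finset.sum_le_sum fun j _ => ?_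
          have h1 : ‖T₂ j‖ₑ + ENNReal.ofReal (A₂ j) ≤
              ∑ j, (‖T₂ j‖ₑ + ENNReal.ofReal (A₂ j)) :=
            Finset.single_le_sum (f := fun j => ‖T₂ j‖ₑ + ENNReal.ofReal (A₂ j))
              (fun _ _ => zero_le) (Finset.mem_univ j)
          have h2 := (hh j).2.2.trans (mul_le_mul' (mul_le_mul' le_rfl h1) le_rfl)
          refine (mul_le_mul' le_rfl h2).trans_eq ?_
          ring
      _ = _ := by
          rw [← Finset.sum_mul]
          ring
  have hb1 : ∀ j, H.Admissible s fun y => (fun _ => (1 : ℂ)) y * H.ext (T₂ j) g y := fun j => by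
    simpa using admissible_of_memLp hH hs0 hsp.le hp (hh j).2.1
  refine ⟨fun j => ⟨⟨_, (hh j).1⟩, _, (hT₁ j).hasValue_ext hH hs1 hs (hb1 j)⟩,
    fun j => ⟨⟨_, (hh j).1⟩, _, (hT₁ j).hasValue_ext hH hs1 hs
      (admissible_mul hH hs1.le hsp hp hb (hh j).2.1)⟩, ⟨?_, ?_⟩, hbound⟩
  · exact (hC₁ m T₁ A₁ hT₁ _ (fun j => (hh j).2.1) h0 b hb).1
  · exact hbound.trans_lt (ENNReal.mul_lt_top (ENNReal.mul_lt_top (by simp) hg.2) hb.2)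

lemma IsCZOperator.mono_exponent {ε ε' A : ℝ} {T : Lp ℂ 2 μ →L[ℂ] Lp ℂ 2 μ}
    (hT : H.IsCZOperator ε A T) (hε' : 0 < ε') (hle : ε' ≤ ε) : H.IsCZOperator ε' A T := by
  obtain ⟨-, hA, k, hk, hTk⟩ := hT
  refine ⟨hε', hA, k, ⟨hk.size, fun x x' y hxy hd => (hk.smooth x x' y hxy hd).trans ?_⟩, hTk⟩
  have h1 : H.dist x x' ≤ H.dist x y :=
    (le_mul_of_one_le_left (H.dist_nonneg x x') H.one_lt_c.le).trans hd
  refine mul_le_mul_of_nonneg_right ?_ (div_nonneg hA measureReal_nonneg)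
  exact Real.rpow_le_rpow_of_exponent_ge' (div_nonneg (H.dist_nonneg _ _) (H.dist_nonneg _ _))
    (div_le_one_of_le₀ h1 (H.dist_nonneg _ _)) hε'.le hle

lemma isCZOperator_zero {ε : ℝ} (hε : 0 < ε) : H.IsCZOperator ε 0 (0 : Lp ℂ 2 μ →L[ℂ] Lp ℂ 2 μ) := by
  refine ⟨hε, le_rfl, 0, ⟨fun x y _ => by simp, fun x x' y _ _ => by simp⟩,
    locallyIntegrableOn_zero, fun f g hf _ _ _ _ => ?_⟩
  have h0 : ((0 : Lp ℂ 2 μ →L[ℂ] Lp ℂ 2 μ) (hf.toLp f) : X → ℂ) =ᵐ[μ] 0 := Lp.coeFn_zero ℂ 2 μ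
  have h1 : ∫ x, ((0 : Lp ℂ 2 μ →L[ℂ] Lp ℂ 2 μ) (hf.toLp f)) x * g x ∂μ = 0 := by
    refine integral_eq_zero_of_ae ?_
    filter_upwards [h0] with x hx
    rw [hx]
    simp
  rw [h1]
  simp

/-- The operators of a finite family have a common exponent, and kernel constants which are
together controlled by the operator norms. The kernel constant of the zero operator has to be
taken to be zero. -/
lemma exists_common_exponent {m : ℕ} {T : Fin m → Lp ℂ 2 μ →L[ℂ] Lp ℂ 2 μ}
    (hT : ∀ j, ∃ ε A : ℝ, H.IsCZOperator ε A (T j)) :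
    ∃ ε : ℝ, 0 < ε ∧ ∃ A : Fin m → ℝ,
      (∀ ε', 0 < ε' → ε' ≤ ε → ∀ j, H.IsCZOperator ε' (A j) (T j)) ∧
      ∃ c : ℝ, 0 ≤ c ∧ ∑ j, (‖T j‖ + A j) = c * ∑ j, ‖T j‖ := by
  classical
  choose ε A hεA using hT
  have hmin : ∃ ε₀ : ℝ, 0 < ε₀ ∧ ∀ j, ε₀ ≤ ε j := by
    rcases isEmpty_or_nonempty (Fin m) with hm | hm
    · exact ⟨1, one_pos, fun j => isEmptyElim j⟩
    · obtain ⟨j₀, hj₀⟩ := Finite.exists_min ε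
      exact ⟨ε j₀, (hεA j₀).1, hj₀⟩
  obtain ⟨ε₀, hε₀, hle⟩ := hmin
  refine ⟨ε₀, hε₀, fun j => if T j = 0 then 0 else A j, fun ε' hε' hε'le j => ?_, ?_⟩
  · by_cases h : T j = 0
    · simpa [h] using isCZOperator_zero hε'
    · simpa [h] using (hεA j).mono_exponent hε' (hε'le.trans (hle j))
  · set n : ℝ := ∑ j, (‖T j‖ + if T j = 0 then 0 else A j) with hn
    have hn0 : 0 ≤ n := Finset.sum_nonneg fun j _ => add_nonneg (norm_nonneg _) (by
      split_ifs
      · exact le_rfl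
      · exact (hεA j).2.1)
    have ha0 : 0 ≤ ∑ j, ‖T j‖ := Finset.sum_nonneg fun j _ => norm_nonneg _
    refine ⟨n / ∑ j, ‖T j‖, div_nonneg hn0 ha0, ?_⟩
    rcases eq_or_ne (∑ j, ‖T j‖) 0 with h | h
    · have h' := (Finset.sum_eq_zero_iff_of_nonneg fun j _ => norm_nonneg _).1 h
      rw [h, mul_zero, hn]
      refine Finset.sum_eq_zero fun j hj => ?_
      have hj0 : T j = 0 := norm_eq_zero.1 (h' j hj)
      simp [hj0]
    · rw [div_mul_cancel₀ _ h]

end Final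

end HomogeneousStructure

end

theorem theorem6p1 {X : Type*} [TopologicalSpace X] [T2Space X] [LocallyCompactSpace X]
    [MeasurableSpace X] [BorelSpace X] (μ : Measure X) [μ.Regular]
    (H : HomogeneousStructure μ) (hH : H.ReverseDoubling)
    (p : ℝ≥0∞) (hp₁ : 1 < p) (hp₂ : p < ∞) :
    -- the constant depends only on `X`, `p` and the smoothness exponent of the kernels;
    -- the norm of an operator is its norm on `L²` plus its kernel constant
    (∀ ε : ℝ, 0 < ε → ∃ C : ℝ, 0 ≤ C ∧
      ∀ (m : ℕ) (T₁ T₂ : Fin m → Lp ℂ 2 μ →L[ℂ] Lp ℂ 2 μ) (A₁ A₂ : Fin m → ℝ),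
        (∀ j, H.IsCZOperator ε (A₁ j) (T₁ j)) → (∀ j, H.IsCZOperator ε (A₂ j) (T₂ j)) →
        ∀ g : X → ℂ, MemLp g p μ →
          H.toeplitz T₁ T₂ (fun _ => 1) g =ᵐ[μ] 0 →
          ∀ b : X → ℂ, H.IsBMO b →
            H.ToeplitzDefined T₁ T₂ (fun _ => 1) g ∧ H.ToeplitzDefined T₁ T₂ b g ∧
            MemLp (H.toeplitz T₁ T₂ b g) p μ ∧
            eLpNorm (H.toeplitz T₁ T₂ b g) p μ ≤
              ENNReal.ofReal (C * (∑ j, (‖T₁ j‖ + A₁ j)) * (∑ j, (‖T₂ j‖ + A₂ j))) *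
                eLpNorm g p μ * H.bmoNorm b) ∧
    -- operator norms on `L²`; the constant may depend on the operators as well
    (∀ (m : ℕ) (T₁ T₂ : Fin m → Lp ℂ 2 μ →L[ℂ] Lp ℂ 2 μ),
      (∀ j, ∃ ε A : ℝ, H.IsCZOperator ε A (T₁ j)) → (∀ j, ∃ ε A : ℝ, H.IsCZOperator ε A (T₂ j)) →
      ∃ C : ℝ, 0 ≤ C ∧
        ∀ g : X → ℂ, MemLp g p μ →
          H.toeplitz T₁ T₂ (fun _ => 1) g =ᵐ[μ] 0 →
          ∀ b : X → ℂ, H.IsBMO b →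
            MemLp (H.toeplitz T₁ T₂ b g) p μ ∧
            eLpNorm (H.toeplitz T₁ T₂ b g) p μ ≤
              ENNReal.ofReal (C * (∑ j, ‖T₁ j‖) * (∑ j, ‖T₂ j‖)) *
                eLpNorm g p μ * H.bmoNorm b) := by
  have hp : p ≠ ∞ := hp₂.ne
  refine ⟨fun ε hε => HomogeneousStructure.exists_toeplitz_bound hH hε hp₁ hp,
    fun m T₁ T₂ hT₁ hT₂ => ?_⟩
  obtain ⟨ε₁, hε₁, A₁, hA₁, c₁, hc₁, hsum₁⟩ := HomogeneousStructure.exists_common_exponent hT₁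
  obtain ⟨ε₂, hε₂, A₂, hA₂, c₂, hc₂, hsum₂⟩ := HomogeneousStructure.exists_common_exponent hT₂
  have hε : 0 < min ε₁ ε₂ := lt_min hε₁ hε₂
  obtain ⟨C, hC0, hC⟩ := HomogeneousStructure.exists_toeplitz_bound (H := H) hH hε hp₁ hp
  refine ⟨C * c₁ * c₂, by positivity, fun g hg h0 b hb => ?_⟩
  obtain ⟨-, -, h1, h2⟩ := hC m T₁ T₂ A₁ A₂ (hA₁ _ hε (min_le_left _ _))
    (hA₂ _ hε (min_le_right _ _)) g hg h0 b hb
  refine ⟨h1, h2.trans_eq ?_⟩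
  rw [hsum₁, hsum₂]
  congr 3
  ring
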